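/- Let $M$ be a smooth (Hausdorff, second countable) manifold of dimension $2n+1$ without boundary, compact or not, with a cooriented contact structure $\xi=\ker\alpha$, where $\alpha$ is a contact form on $M$. Let $\widetilde{\mathrm{Cont}}_0(M,\xi)$ be the universal cover of the identity component of the group of compactly supported contactomorphisms of $(M,\xi)$, that is, the group (under pointwise composition) of homotopy classes with fixed endpoints $[\{\phi_t\}]$ of smooth compactly supported contact isotopies $\{\phi_t\}_{t\in[0,1]}$ with $\phi_0=\mathrm{id}$. Here isotopies and homotopies of isotopies have their supports in a common compact set; the support of $\{\phi_t\}$ is the closure of $\{q : \phi_t(q)\neq q \text{ for some } t\}$. For a subset $S$ of a group $G$ and $g\in G$, put $\nu_S(g)=\min\{k\ge 0 : g\in S^k\}$, where $S^0=\{1\}$, $S^k=S\cdot S^{k-1}$, and $\nu_S(g)=\infty$ if $g\notin\bigcup_k S^k$. * For a contact isotopy $\{\phi_t\}$ let $g_t:M\to\mathbb R$ be the function with $\phi_t^*\alpha=e^{g_t}\alpha$. Put $U=M$ if $M$ is compact, and let $U$ be the interior of the support of $\{\phi_t\}$ if $M$ is not compact. The isotopy is *embedded* if the map $[0,1]\times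 U\to M\times M\times\mathbb R$, $(t,q)\mapsto(q,\phi_t(q),g_t(q))$, is an embedding (an immersion which is a homeomorphism onto its image). It is *positive* (*negative*) if $\alpha\big(\tfrac{d}{dt}\phi_t(q)\big)>0$ (respectively $<0$) for all $t\in[0,1]$ and $q\in U$. The *zigzag norm* is $\nu_S$, where $S$ is the set of all classes of embedded contact isotopies that are either positive or negative. * A *Darboux ball* is an open subset of $M$ that is contactomorphic to an open round ball of $\mathbb R^{2n+1}$ with the standard contact structure $\ker\big(dz+\tfrac12(x\,dy-y\,dx)\big)$. The *contact fragmentation norm* is $\nu_D$, where $D$ is the set of all classes of contact isotopies whose support is contained in some Darboux ball; so it is the minimal number of factors in a decomposition as a product of classes of contact isotopies that are each supported in a Darboux ball. Then for every $[\{\phi_t\}]\in\widetilde{\mathrm{Cont}}_0(M,\xi)$ the zigzag norm of $[\{\phi_t\}]$ is at most twice its contact fragmentation norm. -/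

import Mathlib

open scoped Manifold ContDiff Topology Pointwise
open Set

noncomputable section

namespace ContactGeometry

/-! ### Contact forms -/

/-- The model space of a manifold of dimension `2n+1`. -/
abbrev Model (n : ℕ) : Type := EuclideanSpace ℝ (Fin (2 * n + 1))

section Forms

variable {n : ℕ} {M : Type*} [TopologicalSpace M] [ChartedSpace (Model n) M]

/-- The expression of a 1-form `α` in the chart around `x`, i.e. its pullback under the inverse of
this chart. -/
def formInChart (α : ∀ q : M, TangentSpace (𝓡 (2 * n + 1)) q →L[ℝ] ℝ) (x : M) :
    Model n → (Model n →L[ℝ] ℝ) := fun y =>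
  (α ((extChartAt (𝓡 (2 * n + 1)) x).symm y)).comp
    (mfderiv 𝓘(ℝ, Model n) (𝓡 (2 * n + 1)) (extChartAt (𝓡 (2 * n + 1)) x).symm y)

/-- The exterior derivative `dα (u, v)` of a 1-form at the point `x`, computed in the chart
around `x`: if `β` is the expression of `α` in this chart, then
`dβ_y (u, v) = (D_u β) v - (D_v β) u`. -/
def extDerivForm (α : ∀ q : M, TangentSpace (𝓡 (2 * n + 1)) q →L[ℝ] ℝ) (x : M)
    (u v : TangentSpace (𝓡 (2 * n + 1)) x) : ℝ :=
  let κ : TangentSpace (𝓡 (2 * n + 1)) x → Model n := fun w =>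
    mfderiv (𝓡 (2 * n + 1)) 𝓘(ℝ, Model n) (extChartAt (𝓡 (2 * n + 1)) x) x w
  let Dβ : Model n →L[ℝ] (Model n →L[ℝ] ℝ) :=
    fderiv ℝ (formInChart α x) (extChartAt (𝓡 (2 * n + 1)) x x)
  Dβ (κ u) (κ v) - Dβ (κ v) (κ u)

end Forms

/-- A (smooth) contact form `α` on a manifold `M` of dimension `2n+1`: a nowhere vanishing smooth
1-form such that `dα` is non-degenerate on the hyperplane `ξ = ker α` at every point
(equivalently `α ∧ (dα)^n` vanishes nowhere). The pair `(M, α)` is the cooriented contact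
manifold `(M, ξ = ker α)`. -/
structure ContactForm (n : ℕ) (M : Type*) [TopologicalSpace M] [ChartedSpace (Model n) M]
    [IsManifold (𝓡 (2 * n + 1)) ∞ M] where
  /-- the underlying 1-form -/
  form : ∀ q : M, TangentSpace (𝓡 (2 * n + 1)) q →L[ℝ] ℝ
  smooth : ContMDiff (𝓡 (2 * n + 1)) ((𝓡 (2 * n + 1)).prod 𝓘(ℝ, Model n →L[ℝ] ℝ)) ∞
    (fun q => Bundle.TotalSpace.mk' (Model n →L[ℝ] ℝ)
      (E := fun q : M => TangentSpace (𝓡 (2 * n + 1)) q →L[ℝ] ℝ) q (form q))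
  ne_zero : ∀ q, form q ≠ 0
  nondegenerate : ∀ q, ∀ u : TangentSpace (𝓡 (2 * n + 1)) q, form q u = 0 →
    (∀ v : TangentSpace (𝓡 (2 * n + 1)) q, form q v = 0 → extDerivForm form q u v = 0) → u = 0

/-! ### The standard contact structure and Darboux balls -/

/-- `ℝ^{2n+1}` with coordinates `x i = p (inl i)`, `y i = p (inr (inl i))`,
`z = p (inr (inr ()))`, and with the Euclidean norm. -/
abbrev StdSpace (n : ℕ) : Type := EuclideanSpace ℝ (Fin n ⊕ Fin n ⊕ Unit)

/-- The standard contact form `dz + (x dy - y dx) / 2` on `ℝ^{2n+1}`, at the point `p`, evaluated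
on the vector `v`. -/
def stdForm (n : ℕ) (p v : StdSpace n) : ℝ :=
  v (Sum.inr (Sum.inr ())) +
    (1 / 2) * ∑ i : Fin n, (p (Sum.inl i) * v (Sum.inr (Sum.inl i)) -
      p (Sum.inr (Sum.inl i)) * v (Sum.inl i))

variable {n : ℕ} {M : Type*} [TopologicalSpace M] [ChartedSpace (Model n) M]
  [IsManifold (𝓡 (2 * n + 1)) ∞ M]

/-- A Darboux ball of `(M, ξ = ker α)`: an open subset of `M` which is contactomorphic to an open
round ball of `ℝ^{2n+1}` with its standard contact structure. -/
def IsDarbouxBall (α : ContactForm n M) (B : Set M) : Prop :=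
  ∃ r : ℝ, 0 < r ∧ ∃ e : OpenPartialHomeomorph (StdSpace n) M,
    e.source = Metric.ball 0 r ∧ e.target = B ∧
    ContMDiffOn 𝓘(ℝ, StdSpace n) (𝓡 (2 * n + 1)) ∞ e e.source ∧
    ContMDiffOn (𝓡 (2 * n + 1)) 𝓘(ℝ, StdSpace n) ∞ e.symm e.target ∧
    ∀ p ∈ e.source, ∀ v : StdSpace n,
      α.form (e p) (mfderiv 𝓘(ℝ, StdSpace n) (𝓡 (2 * n + 1)) e p v) = 0 ↔ stdForm n p v = 0

/-! ### Families of contactomorphisms -/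

/-- `φ^* α = e^c α` at the point `q`. -/
def ScalesAt (α : ContactForm n M) (φ : M → M) (q : M) (c : ℝ) : Prop :=
  ∀ v : TangentSpace (𝓡 (2 * n + 1)) q,
    α.form (φ q) (mfderiv (𝓡 (2 * n + 1)) (𝓡 (2 * n + 1)) φ q v) = Real.exp c * α.form q v

/-- Smooth families `(φ_p)_{p ∈ P}` of contactomorphisms of `(M, ξ = ker α)`, parametrized by a
manifold `P` (possibly with corners), with all `φ_p` equal to the identity outside a common compact
set; this last condition is empty if `M` is compact. The family `(φ_p^{-1})` is then smooth
too (by the inverse function theorem, this is no additional condition). Such families form a group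
under pointwise composition. -/
def contactFamilies (α : ContactForm n M) {F H : Type*} [NormedAddCommGroup F] [NormedSpace ℝ F]
    [TopologicalSpace H] (J : ModelWithCorners ℝ F H) (P : Type*) [TopologicalSpace P]
    [ChartedSpace H P] : Subgroup (P → Equiv.Perm M) where
  carrier := {φ |
    ContMDiff (J.prod (𝓡 (2 * n + 1))) (𝓡 (2 * n + 1)) ∞ (fun x : P × M => φ x.1 x.2) ∧
    ContMDiff (J.prod (𝓡 (2 * n + 1))) (𝓡 (2 * n + 1)) ∞ (fun x : P × M => (φ x.1)⁻¹ x.2) ∧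
    (∀ p q, ∃ c, ScalesAt α (φ p) q c) ∧
    ∃ K : Set M, IsCompact K ∧ ∀ p, ∀ q ∉ K, φ p q = q}
  mul_mem' := by
    rintro φ ψ ⟨h1, h2, h3, K, hK, h4⟩ ⟨k1, k2, k3, L, hL, k4⟩
    refine ⟨h1.comp (contMDiff_fst.prodMk k1), ?_, ?_, K ∪ L, hK.union hL, ?_⟩
    · have : (fun x : P × M => ((φ * ψ) x.1)⁻¹ x.2) =
          (fun x : P × M => (ψ x.1)⁻¹ x.2) ∘ fun x => (x.1, (φ x.1)⁻¹ x.2) := by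
        funext x
        simp
      rw [this]
      exact k2.comp (contMDiff_fst.prodMk h2)
    · intro p q
      obtain ⟨c, hc⟩ := k3 p q
      obtain ⟨d, hd⟩ := h3 p (ψ p q)
      refine ⟨d + c, fun v => ?_⟩
      have hφ : MDifferentiable (𝓡 (2 * n + 1)) (𝓡 (2 * n + 1)) (φ p) :=
        (h1.comp (contMDiff_const.prodMk contMDiff_id)).mdifferentiable (by simp)
      have hψ : MDifferentiable (𝓡 (2 * n + 1)) (𝓡 (2 * n + 1)) (ψ p) :=
        (k1.comp (contMDiff_const.prodMk contMDiff_id)).mdifferentiable (by simp)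
      have e : ((φ * ψ) p : M → M) = φ p ∘ ψ p := rfl
      rw [e, mfderiv_comp q (hφ _) (hψ _), Real.exp_add, mul_assoc, ← hc v]
      exact hd _
    · intro p q hq
      simp only [mem_union, not_or] at hq
      simp [k4 p q hq.2, h4 p q hq.1]
  one_mem' := by
    refine ⟨contMDiff_snd, by simpa using contMDiff_snd, fun p q => ⟨0, fun v => ?_⟩,
      ∅, isCompact_empty, fun p q _ => rfl⟩
    have e : (((1 : P → Equiv.Perm M) p) : M → M) = id := rfl
    rw [e, mfderiv_id]
    simp
  inv_mem' := by
    rintro φ ⟨h1, h2, h3, K, hK, h4⟩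
    refine ⟨h2, by simpa using h1, ?_, K, hK, ?_⟩
    · intro p q
      obtain ⟨c, hc⟩ := h3 p ((φ p)⁻¹ q)
      refine ⟨-c, fun v => ?_⟩
      have hφ : MDifferentiable (𝓡 (2 * n + 1)) (𝓡 (2 * n + 1)) (φ p) :=
        (h1.comp (contMDiff_const.prodMk contMDiff_id)).mdifferentiable (by simp)
      have hψ : MDifferentiable (𝓡 (2 * n + 1)) (𝓡 (2 * n + 1)) ((φ p)⁻¹ : Equiv.Perm M) :=
        (h2.comp (contMDiff_const.prodMk contMDiff_id)).mdifferentiable (by simp)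
      have e : (φ p : M → M) ∘ ((φ p)⁻¹ : Equiv.Perm M) = id := by
        funext x
        simp
      have key := mfderiv_comp q (hφ _) (hψ q)
      rw [e, mfderiv_id] at key
      have hv := hc (mfderiv (𝓡 (2 * n + 1)) (𝓡 (2 * n + 1)) ((φ p)⁻¹ : Equiv.Perm M) q v)
      have hv' : mfderiv (𝓡 (2 * n + 1)) (𝓡 (2 * n + 1)) (φ p) ((φ p)⁻¹ q)
          (mfderiv (𝓡 (2 * n + 1)) (𝓡 (2 * n + 1)) ((φ p)⁻¹ : Equiv.Perm M) q v) = v :=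
        (DFunLike.congr_fun key v).symm
      rw [hv'] at hv
      have hq : φ p ((φ p)⁻¹ q) = q := by simp
      have hv'' : α.form q v = Real.exp c * α.form ((φ p)⁻¹ q)
          (mfderiv (𝓡 (2 * n + 1)) (𝓡 (2 * n + 1)) ((φ p)⁻¹ : Equiv.Perm M) q v) := by
        rw [← hv]
        congr! 1
        rw [hq]
      rw [hv'', ← mul_assoc, ← Real.exp_add]
      simp
    · intro p q hq
      show (φ p)⁻¹ q = q
      rw [Equiv.Perm.inv_eq_iff_eq]
      exact (h4 p q hq).symm

/-! ### Contact isotopies and the universal cover -/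

/-- The group (under pointwise composition) of compactly supported contact isotopies
`{φ_t}_{t ∈ [0,1]}` of `(M, ξ = ker α)` that start at the identity. -/
def ContactIsotopy (α : ContactForm n M) : Subgroup (unitInterval → Equiv.Perm M) where
  carrier := {φ | φ ∈ contactFamilies α (𝓡∂ 1) unitInterval ∧ φ 0 = 1}
  mul_mem' := by
    rintro φ ψ ⟨h, h0⟩ ⟨k, k0⟩
    exact ⟨mul_mem h k, by simp [h0, k0]⟩
  one_mem' := ⟨one_mem _, rfl⟩
  inv_mem' := by
    rintro φ ⟨h, h0⟩
    exact ⟨inv_mem h, by simp [h0]⟩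

/-- Two contact isotopies are homotopic (with fixed endpoints) if they are joined by a smooth
family `{φ^s_t}`, `(s, t) ∈ [0,1] × [0,1]`, of compactly supported contactomorphisms with
`φ^s_0 = id` and `φ^s_1 = φ_1` for all `s`. -/
def Homotopic (α : ContactForm n M) (φ ψ : ContactIsotopy α) : Prop :=
  ∃ Φ : unitInterval × unitInterval → Equiv.Perm M,
    Φ ∈ contactFamilies α ((𝓡∂ 1).prod (𝓡∂ 1)) (unitInterval × unitInterval) ∧
    (∀ t, Φ (0, t) = φ.1 t) ∧ (∀ t, Φ (1, t) = ψ.1 t) ∧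
    (∀ s, Φ (s, 0) = 1) ∧ ∀ s, Φ (s, 1) = φ.1 1

/-- A contact isotopy, regarded as a family with two parameters `(s, t)` that does not depend
on `s`. -/
theorem const_family_mem (α : ContactForm n M) (φ : ContactIsotopy α) :
    (fun x : unitInterval × unitInterval => φ.1 x.2) ∈
      contactFamilies α ((𝓡∂ 1).prod (𝓡∂ 1)) (unitInterval × unitInterval) := by
  obtain ⟨⟨h1, h2, h3, K, hK, h4⟩, -⟩ := φ.2
  have hpr : ContMDiff (((𝓡∂ 1).prod (𝓡∂ 1)).prod (𝓡 (2 * n + 1)))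
      ((𝓡∂ 1).prod (𝓡 (2 * n + 1))) ∞
      (fun x : (unitInterval × unitInterval) × M => (x.1.2, x.2)) :=
    (contMDiff_snd.comp contMDiff_fst).prodMk contMDiff_snd
  exact ⟨h1.comp hpr, h2.comp hpr, fun p q => h3 p.2 q, K, hK, fun p q hq => h4 p.2 q hq⟩

/-- Homotopy with fixed endpoints is an equivalence relation, compatible with the pointwise
composition of contact isotopies. -/
def homotopyCon (α : ContactForm n M) : Con (ContactIsotopy α) where
  r := Homotopic α
  iseqv :=
    { refl := fun φ => ⟨fun x => φ.1 x.2, const_family_mem α φ, fun _ => rfl, fun _ => rfl,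
        fun _ => φ.2.2, fun _ => rfl⟩
      symm := by
        rintro φ ψ ⟨Φ, hΦ, h0, h1, h2, h3⟩
        have e : φ.1 1 = ψ.1 1 := by rw [← h1, h3]
        refine ⟨(fun x => φ.1 x.2) * Φ⁻¹ * (fun x => ψ.1 x.2),
          mul_mem (mul_mem (const_family_mem α φ) (inv_mem hΦ)) (const_family_mem α ψ),
          fun t => ?_, fun t => ?_, fun s => ?_, fun s => ?_⟩
        · simp [h0]
        · simp [h1]
        · simp [h2, φ.2.2, ψ.2.2]
        · simp [h3]
      trans := by
        rintro φ ψ χ ⟨Φ, hΦ, h0, h1, h2, h3⟩ ⟨Ψ, hΨ, k0, k1, k2, k3⟩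
        refine ⟨Φ * (fun x => ψ.1 x.2)⁻¹ * Ψ,
          mul_mem (mul_mem hΦ (inv_mem (const_family_mem α ψ))) hΨ,
          fun t => ?_, fun t => ?_, fun s => ?_, fun s => ?_⟩
        · simp [h0, k0]
        · simp [h1, k1]
        · simp [h2, k2, ψ.2.2]
        · simp [h3, k3] }
  mul' := by
    rintro φ φ' ψ ψ' ⟨Φ, hΦ, h0, h1, h2, h3⟩ ⟨Ψ, hΨ, k0, k1, k2, k3⟩
    exact ⟨Φ * Ψ, mul_mem hΦ hΨ, fun t => by simp [h0, k0], fun t => by simp [h1, k1],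
      fun s => by simp [h2, k2], fun s => by simp [h3, k3]⟩

/-- The universal cover of the identity component of the group of compactly supported
contactomorphisms of `(M, ξ = ker α)`: the group of homotopy classes with fixed endpoints
`[{φ_t}]` of contact isotopies that start at the identity. -/
abbrev UniversalCover (α : ContactForm n M) : Type _ := (homotopyCon α).Quotient

/-- The element `[{φ_t}]` of the universal cover represented by a contact isotopy. -/
def homotopyClass (α : ContactForm n M) (φ : ContactIsotopy α) : UniversalCover α :=
  (φ : (homotopyCon α).Quotient)

/-! ### Positive, negative and embedded isotopies -/

/-- The support of a contact isotopy. -/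
def isotopySupport {α : ContactForm n M} (φ : ContactIsotopy α) : Set M :=
  closure {q | ∃ t, φ.1 t q ≠ q}

/-- The part of `M` on which positivity and embeddedness of an isotopy are tested: the whole of
`M` if `M` is compact, and the interior of the support of the isotopy otherwise. -/
def testRegion {α : ContactForm n M} (φ : ContactIsotopy α) : Set M :=
  {q | CompactSpace M ∨ q ∈ interior (isotopySupport φ)}

/-- The velocity `d/dt φ_t(q)`, a tangent vector at `φ_t(q)`. -/
def velocity {α : ContactForm n M} (φ : ContactIsotopy α) (t : unitInterval) (q : M) :
    TangentSpace (𝓡 (2 * n + 1)) (φ.1 t q) :=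
  mfderiv (𝓡∂ 1) (𝓡 (2 * n + 1)) (fun s : unitInterval => φ.1 s q) t 1

/-- The isotopy moves every point in a direction positively transverse to `ξ`. -/
def IsPositive {α : ContactForm n M} (φ : ContactIsotopy α) : Prop :=
  ∀ t, ∀ q ∈ testRegion φ, 0 < α.form (φ.1 t q) (velocity φ t q)

/-- The isotopy moves every point in a direction negatively transverse to `ξ`. -/
def IsNegative {α : ContactForm n M} (φ : ContactIsotopy α) : Prop :=
  ∀ t, ∀ q ∈ testRegion φ, α.form (φ.1 t q) (velocity φ t q) < 0

open Classical in
/-- The value at `q` of the function `g` with `φ^* α = e^g α` (this determines `g` because `α`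
vanishes nowhere; the value is `0` if `φ^* α` is not a positive multiple of `α` at `q`). -/
def conformalFactor (α : ContactForm n M) (φ : M → M) (q : M) : ℝ :=
  if h : ∃ c, ScalesAt α φ q c then h.choose else 0

/-- The map `(t, q) ↦ (q, φ_t(q), g_t(q))` into `M × M × ℝ`, whose restriction to a fixed `t`
parametrizes the graph of the contactomorphism `φ_t`. -/
def graphMap {α : ContactForm n M} (φ : ContactIsotopy α) (x : unitInterval × M) : M × M × ℝ :=
  (x.2, φ.1 x.1 x.2, conformalFactor α (φ.1 x.1) x.2)

/-- The union over `t ∈ [0,1]` of the graphs of the `φ_t` is an embedded submanifold of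
`M × M × ℝ`: the map `(t, q) ↦ (q, φ_t(q), g_t(q))` is an immersion and a homeomorphism onto
its image. -/
def IsEmbeddedIsotopy {α : ContactForm n M} (φ : ContactIsotopy α) : Prop :=
  Topology.IsEmbedding ((univ ×ˢ testRegion φ : Set (unitInterval × M)).domRestrict (graphMap φ)) ∧
  ∀ t, ∀ q ∈ testRegion φ, Function.Injective
    (mfderiv ((𝓡∂ 1).prod (𝓡 (2 * n + 1)))
      ((𝓡 (2 * n + 1)).prod ((𝓡 (2 * n + 1)).prod 𝓘(ℝ, ℝ))) (graphMap φ) (t, q))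

/-! ### The norms -/

/-- The word norm `min {k | g ∈ S ^ k}` of an element `g` of a group with respect to a subset `S`,
where `S ^ 0 = {1}`; it is `⊤` if `g` is not a product of elements of `S`. -/
def wordNorm {G : Type*} [Group G] (S : Set G) (g : G) : ℕ∞ :=
  sInf {k : ℕ∞ | ∃ m : ℕ, k = m ∧ g ∈ S ^ m}

/-- The classes of positive embedded contact isotopies. -/
def positiveEmbedded (α : ContactForm n M) : Set (UniversalCover α) :=
  {a | ∃ φ, homotopyClass α φ = a ∧ IsEmbeddedIsotopy φ ∧ IsPositive φ}

/-- The classes of negative embedded contact isotopies. -/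
def negativeEmbedded (α : ContactForm n M) : Set (UniversalCover α) :=
  {a | ∃ φ, homotopyClass α φ = a ∧ IsEmbeddedIsotopy φ ∧ IsNegative φ}

/-- The zigzag norm: the word norm with respect to the classes of embedded contact isotopies that
are either positive or negative. -/
def zigzagNorm (α : ContactForm n M) (a : UniversalCover α) : ℕ∞ :=
  wordNorm (positiveEmbedded α ∪ negativeEmbedded α) a

/-- The classes of contact isotopies supported in a Darboux ball. -/
def darbouxSupported (α : ContactForm n M) : Set (UniversalCover α) :=
  {a | ∃ φ, homotopyClass α φ = a ∧ ∃ B, IsDarbouxBall α B ∧ isotopySupport φ ⊆ B}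

/-- The contact fragmentation norm: the minimal number of factors in a decomposition as a product
of classes of contact isotopies, each supported in a Darboux ball. -/
def fragmentationNorm (α : ContactForm n M) (a : UniversalCover α) : ℕ∞ :=
  wordNorm (darbouxSupported α) a

end ContactGeometry

end

/-! Word norms reduce the claim to generators: if every class supported in a Darboux ball is a
product of two classes of embedded positive or negative isotopies, the inequality follows
(`wordNorm_le_two_mul`). For φ supported in a Darboux ball the factorization is φ = (φΨ)·Ψ⁻¹, where
Ψ is a positive isotopy that moves the support of φ so fast that φΨ is still positive and embedded
(`exists_mul_mem_positiveEmbedded`).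

Embeddedness comes almost for free. The graph map remembers the point q, so an isotopy transverse to
ξ has an immersed graph map, and compactness of [0,1] turns injectivity of the individual orbits
into a homeomorphism onto the image (`isEmbeddedIsotopy`). Hence only two things are to be arranged
for φΨ: positivity and injective orbits.

To build Ψ, start from a contact flow X that is positive on a region containing the centre of the
Darboux ball and fixes every point outside it (`exists_positiveFlow`): the Reeb flow if M is
compact, otherwise the flow of a radial Hamiltonian supported in a smaller ball. Run it only for a
time ε so short that no orbit closes up. Then conjugate it by a contactomorphism T that near the
support of φ is the contact dilation (x, y, z) ↦ (cx, cy, c²z). Since T contracts the contact form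
by a factor of order c², the conjugate Ψ has transverse speed of order c⁻² on the support of φ, and
it raises the coordinate z there at a rate of order c⁻². The data of φ do not depend on c, so a
small c wins twice.

Positivity: the transverse speed of φΨ is that of φ plus e^g times that of Ψ
(`transverseSpeed_mul`), and the second term dominates. Injectivity: if φ_tΨ_t(q) = φ_t'Ψ_t'(q) = Q,
then Ψ_t(q) = φ_t⁻¹(Q) and Ψ_t'(q) = φ_t'⁻¹(Q) have z-coordinates that differ by at most L|t' − t|
(`exists_abs_sub_le`), whereas Ψ makes them differ by much more. If one of the two points lies off
the support of φ, the equation reduces to the injectivity of the orbits of Ψ.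

Underneath lie the smooth dependence of flows on initial values, from the inverse function theorem
in a space of paths; the Reeb field; and contact Hamiltonians on the standard space, whose flows are
transported to M by Darboux charts (`exists_extension`). -/

noncomputable section

namespace SmoothFlow

universe u

/-! ### Superposition operators on spaces of continuous functions -/

section Nemytskii

variable {X : Type*} [TopologicalSpace X] [CompactSpace X]

/-- Pointwise evaluation, `A ↦ (h ↦ (x ↦ A x (h x)))`, for continuous functions on a compact space. -/
def applyCLM (X : Type*) [TopologicalSpace X] [CompactSpace X]
    (E F : Type*) [NormedAddCommGroup E] [NormedSpace ℝ E]
    [NormedAddCommGroup F] [NormedSpace ℝ F] :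
    C(X, E →L[ℝ] F) →L[ℝ] (C(X, E) →L[ℝ] C(X, F)) :=
  LinearMap.mkContinuous₂
    (LinearMap.mk₂ ℝ (fun (A : C(X, E →L[ℝ] F)) (h : C(X, E)) =>
        (⟨fun x => A x (h x), by fun_prop⟩ : C(X, F)))
      (fun _ _ _ => by ext; simp) (fun _ _ _ => by ext; simp)
      (fun _ _ _ => by ext; simp) (fun _ _ _ => by ext; simp)) 1
    (fun A h => by
      rw [ContinuousMap.norm_le _ (by positivity)]
      intro x
      rw [one_mul]
      exact (ContinuousLinearMap.le_opNorm _ _).trans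
        (mul_le_mul (A.norm_coe_le_norm x) (h.norm_coe_le_norm x) (norm_nonneg (h x))
          (norm_nonneg A)))

@[simp] theorem applyCLM_apply {E F : Type*} [NormedAddCommGroup E] [NormedSpace ℝ E]
    [NormedAddCommGroup F] [NormedSpace ℝ F] (A : C(X, E →L[ℝ] F)) (h : C(X, E)) (x : X) :
    applyCLM X E F A h x = A x (h x) := rfl

/-- Superposition with a `C¹` map is differentiable on spaces of continuous functions. -/
theorem hasFDerivAt_postcomp {E F : Type*} [NormedAddCommGroup E] [NormedSpace ℝ E]
    [NormedAddCommGroup F] [NormedSpace ℝ F] (f : C(E, F)) (f' : C(E, E →L[ℝ] F))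
    (hf : ∀ x, HasFDerivAt f (f' x) x) (γ : C(X, E)) :
    HasFDerivAt (fun η : C(X, E) => f.comp η) (applyCLM X E F (f'.comp γ)) γ := by
  rw [hasFDerivAt_iff_isLittleO_nhds_zero, Asymptotics.isLittleO_iff]
  intro ε hε
  have hc : Continuous fun η : C(X, E) => f'.comp η := ContinuousMap.continuous_postcomp f'
  have hc' : ∀ ε > 0, ∃ δ > 0, ∀ η : C(X, E), dist η γ < δ →
      dist (f'.comp η) (f'.comp γ) < ε :=
    Metric.tendsto_nhds_nhds.1 (by exact hc.tendsto γ)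
  obtain ⟨δ, hδ, hδ'⟩ := hc' ε hε
  filter_upwards [Metric.ball_mem_nhds (0 : C(X, E)) hδ] with h hh
  rw [ContinuousMap.norm_le _ (by positivity)]
  intro x
  have hh' : ‖h‖ < δ := by simpa using hh
  -- A bound uniform in `x` comes from the continuity of η ↦ f' ∘ η at γ in the sup metric, tested
  -- on the translates of γ by constant functions.
  have key : ∀ y ∈ Metric.ball (γ x) δ, ‖f' y - f' (γ x)‖ ≤ ε := by
    intro y hy
    have h1 : dist (γ + ContinuousMap.const X (y - γ x)) γ < δ := by
      rw [dist_eq_norm, add_sub_cancel_left]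
      refine lt_of_le_of_lt ?_ (mem_ball_iff_norm.1 hy)
      rw [ContinuousMap.norm_le _ (norm_nonneg _)]
      intro z; simp
    have h2 := hδ' _ h1
    have h3 : dist (f' (γ x + (y - γ x))) (f' (γ x)) ≤ ε :=
      (ContinuousMap.dist_apply_le_dist x).trans h2.le
    rwa [add_sub_cancel, dist_eq_norm] at h3
  have := (convex_ball (γ x) δ).norm_image_sub_le_of_norm_hasFDerivWithin_le'
    (f := f) (f' := f') (φ := f' (γ x)) (C := ε) (x := γ x) (y := γ x + h x)
    (fun y _ => (hf y).hasFDerivWithinAt) key (Metric.mem_ball_self hδ)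
    (by rw [mem_ball_iff_norm, add_sub_cancel_left]
        exact (h.norm_coe_le_norm x).trans_lt hh')
  simp only [add_sub_cancel_left] at this
  calc _ = ‖f (γ x + h x) - f (γ x) - f' (γ x) (h x)‖ := rfl
    _ ≤ ε * ‖h x‖ := this
    _ ≤ ε * ‖h‖ := by gcongr; exact h.norm_coe_le_norm x

/-- Superposition with a smooth map is smooth on spaces of continuous functions. -/
theorem contDiff_postcomp_nat {E : Type u} [NormedAddCommGroup E] [NormedSpace ℝ E] (k : ℕ) :
    ∀ {F : Type u} [NormedAddCommGroup F] [NormedSpace ℝ F] (f : C(E, F)), ContDiff ℝ k f →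
      ContDiff ℝ k (fun η : C(X, E) => f.comp η) := by
  induction k with
  | zero =>
    intro F _ _ f _
    exact contDiff_zero.2 (ContinuousMap.continuous_postcomp f)
  | succ k ih =>
    intro F _ _ f hf
    rw [Nat.cast_succ] at hf
    have hf' : ContDiff ℝ k (fderiv ℝ f) := (contDiff_succ_iff_fderiv.1 hf).2.2
    have hd : ∀ x, HasFDerivAt f (fderiv ℝ f x) x := fun x =>
      ((contDiff_succ_iff_fderiv.1 hf).1 x).hasFDerivAt
    let f' : C(E, E →L[ℝ] F) := ⟨fderiv ℝ f, hf'.continuous⟩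
    have hder := fun γ : C(X, E) => hasFDerivAt_postcomp f f' hd γ
    rw [Nat.cast_succ, contDiff_succ_iff_fderiv]
    refine ⟨fun γ => (hder γ).differentiableAt, by simp, ?_⟩
    -- The derivative is again a superposition operator, now with `fderiv ℝ f`, followed by a fixed
    -- linear map. The induction therefore has to run over all target spaces, and `E →L[ℝ] F` has to
    -- stay in the same universe.
    have : fderiv ℝ (fun η : C(X, E) => f.comp η) = fun γ => applyCLM X E F (f'.comp γ) :=
      funext fun γ => (hder γ).fderiv
    rw [this]
    exact (applyCLM X E F).contDiff.comp (ih f' hf')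

theorem contDiff_postcomp {E F : Type u} [NormedAddCommGroup E] [NormedSpace ℝ E]
    [NormedAddCommGroup F] [NormedSpace ℝ F] (f : C(E, F)) (hf : ContDiff ℝ ∞ f) :
    ContDiff ℝ ∞ (fun η : C(X, E) => f.comp η) :=
  contDiff_infty.2 fun k => contDiff_postcomp_nat k f (contDiff_infty.1 hf k)

end Nemytskii

/-! ### Smooth local flows from the inverse function theorem -/

section LocalFlow

variable {E : Type u} [NormedAddCommGroup E] [NormedSpace ℝ E] [CompleteSpace E]

/-- Integration from `0`, as an operator on continuous functions on the unit interval. -/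
def integralCLM (E : Type*) [NormedAddCommGroup E] [NormedSpace ℝ E] [CompleteSpace E] :
    C(unitInterval, E) →L[ℝ] C(unitInterval, E) :=
  LinearMap.mkContinuous
    { toFun := fun γ => ⟨fun t => ∫ s in (0 : ℝ)..t, γ (projIcc 0 1 zero_le_one s), by
        have hc : Continuous fun s => γ (projIcc 0 1 zero_le_one s) :=
          γ.continuous.comp continuous_projIcc
        exact (intervalIntegral.continuous_primitive
          (fun a b => hc.intervalIntegrable a b) 0).comp continuous_subtype_val⟩
      map_add' := fun γ η => by
        ext t
        have h : ∀ γ : C(unitInterval, E), Continuous fun s => γ (projIcc 0 1 zero_le_one s) :=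
          fun γ => γ.continuous.comp continuous_projIcc
        exact intervalIntegral.integral_add ((h γ).intervalIntegrable _ _)
          ((h η).intervalIntegrable _ _)
      map_smul' := fun c γ => by
        ext t
        exact intervalIntegral.integral_smul _ _ } 1
    (fun γ => by
      rw [one_mul, ContinuousMap.norm_le _ (norm_nonneg _)]
      intro t
      have := intervalIntegral.norm_integral_le_of_norm_le_const (a := (0 : ℝ)) (b := t)
        (f := fun s => γ (projIcc 0 1 zero_le_one s)) (C := ‖γ‖)
        (fun s _ => γ.norm_coe_le_norm _)
      refine this.trans ?_
      have h1 : |(t : ℝ) - 0| ≤ 1 := by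
        rw [sub_zero, abs_of_nonneg t.2.1]; exact t.2.2
      exact mul_le_of_le_one_right (norm_nonneg _) h1)

theorem integralCLM_apply (γ : C(unitInterval, E)) (t : unitInterval) :
    integralCLM E γ t = ∫ s in (0 : ℝ)..t, γ (projIcc 0 1 zero_le_one s) := rfl

theorem hasDerivWithinAt_integralCLM (γ : C(unitInterval, E)) (t : unitInterval) :
    HasDerivWithinAt (fun s => integralCLM E γ (projIcc 0 1 zero_le_one s)) (γ t) (Icc 0 1) t := by
  have hc : Continuous fun s => γ (projIcc 0 1 zero_le_one s) :=
    γ.continuous.comp continuous_projIcc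
  have h := (hc.integral_hasStrictDerivAt 0 (t : ℝ)).hasDerivAt.hasDerivWithinAt (s := Icc 0 1)
  rw [projIcc_val] at h
  refine h.congr (fun s hs => ?_) ?_
  · rw [integralCLM_apply, projIcc_of_mem _ hs]
  · rw [integralCLM_apply, projIcc_val]

/-- The reparametrization of a path `γ` by `u ↦ u t`. -/
def rescale (t : unitInterval) (γ : C(unitInterval, E)) : C(unitInterval, E) :=
  γ.comp ⟨fun u => u * t, by fun_prop⟩

/-- Substitution in the integral. Consequently, if γ solves the Picard equation with time scale τ,
then u ↦ γ(ut) solves it with time scale tτ, so that uniqueness makes solutions for different time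
scales fit together. -/
theorem integralCLM_rescale (t u : unitInterval) (γ : C(unitInterval, E)) :
    (t : ℝ) • integralCLM E (rescale t γ) u = integralCLM E γ (u * t) := by
  rw [integralCLM_apply, integralCLM_apply]
  have h := intervalIntegral.smul_integral_comp_mul_right (a := 0) (b := u)
    (fun s => γ (projIcc 0 1 zero_le_one s)) (t : ℝ)
  rw [zero_mul] at h
  rw [Icc.coe_mul, ← h]
  congr 1
  apply intervalIntegral.integral_congr
  intro s hs
  rw [uIcc_of_le u.2.1] at hs
  have hs1 : s ∈ Icc (0 : ℝ) 1 := ⟨hs.1, hs.2.trans u.2.2⟩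
  have hs2 : s * t ∈ Icc (0 : ℝ) 1 := unitInterval.mul_mem hs1 t.2
  simp only [rescale, ContinuousMap.comp_apply, ContinuousMap.coe_mk]
  rw [projIcc_of_mem _ hs1, projIcc_of_mem _ hs2]
  rfl

/-- The map whose zero set in the last component consists of the solutions `γ` of
`γ t = x + τ ∫₀ᵗ f (γ s) ds`. -/
def picardMap (f : C(E, E)) (p : (E × ℝ) × C(unitInterval, E)) : (E × ℝ) × C(unitInterval, E) :=
  (p.1, p.2 - ContinuousMap.const _ p.1.1 - p.1.2 • integralCLM E (f.comp p.2))

/-- The inclusion of the constant paths. -/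
def constCLM (E : Type*) [NormedAddCommGroup E] [NormedSpace ℝ E] : E →L[ℝ] C(unitInterval, E) :=
  LinearMap.mkContinuous
    { toFun := fun x => ContinuousMap.const _ x
      map_add' := fun _ _ => by ext; rfl
      map_smul' := fun _ _ => by ext; rfl } 1
    (fun x => by
      rw [one_mul, ContinuousMap.norm_le _ (norm_nonneg _)]
      intro t; rfl)

theorem contDiff_picardMap (f : C(E, E)) (hf : ContDiff ℝ ∞ f) : ContDiff ℝ ∞ (picardMap f) := by
  refine contDiff_fst.prodMk ((contDiff_snd.sub ?_).sub ?_)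
  · exact (constCLM E).contDiff.comp (contDiff_fst.comp contDiff_fst)
  · refine (contDiff_snd.comp contDiff_fst).smul ?_
    exact (integralCLM E).contDiff.comp ((contDiff_postcomp f hf).comp contDiff_snd)

/-- The derivative of `picardMap` at a stationary path. -/
def picardEquiv (f : C(E, E)) (x : E) :
    ((E × ℝ) × C(unitInterval, E)) ≃L[ℝ] ((E × ℝ) × C(unitInterval, E)) :=
  ContinuousLinearEquiv.equivOfInverse
    ((ContinuousLinearMap.fst ℝ _ _).prod (ContinuousLinearMap.snd ℝ _ _ -
      ((constCLM E).comp (ContinuousLinearMap.fst ℝ E ℝ) +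
        (ContinuousLinearMap.snd ℝ E ℝ).smulRight (integralCLM E (f.comp (constCLM E x)))).comp
          (ContinuousLinearMap.fst ℝ _ _)))
    ((ContinuousLinearMap.fst ℝ _ _).prod (ContinuousLinearMap.snd ℝ _ _ +
      ((constCLM E).comp (ContinuousLinearMap.fst ℝ E ℝ) +
        (ContinuousLinearMap.snd ℝ E ℝ).smulRight (integralCLM E (f.comp (constCLM E x)))).comp
          (ContinuousLinearMap.fst ℝ _ _)))
    (fun p => by ext <;> simp) (fun p => by ext <;> simp)

/-- Time enters as a scalar in front of the integral. At time scale 0 this scalar kills the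
dependence of the integral on the path, so the derivative is triangular with identity diagonal,
hence invertible without any contraction estimate. -/
theorem hasStrictFDerivAt_picardMap (f : C(E, E)) (hf : ContDiff ℝ ∞ f) (x : E) :
    HasStrictFDerivAt (picardMap f) (picardEquiv f x : ((E × ℝ) × C(unitInterval, E)) →L[ℝ] _)
      ((x, 0), constCLM E x) := by
  have h := (contDiff_picardMap f hf).contDiffAt (x := ((x, 0), constCLM E x))
    |>.hasStrictFDerivAt (by simp)
  suffices hs : HasFDerivAt (picardMap f)
      (picardEquiv f x : ((E × ℝ) × C(unitInterval, E)) →L[ℝ] _) ((x, 0), constCLM E x) by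
    rwa [hs.fderiv] at h
  have hN : HasFDerivAt (fun p : (E × ℝ) × C(unitInterval, E) => integralCLM E (f.comp p.2))
      (fderiv ℝ (fun p : (E × ℝ) × C(unitInterval, E) => integralCLM E (f.comp p.2))
        ((x, 0), constCLM E x)) ((x, 0), constCLM E x) := by
    apply DifferentiableAt.hasFDerivAt
    have : ContDiff ℝ ∞ (fun p : (E × ℝ) × C(unitInterval, E) => integralCLM E (f.comp p.2)) :=
      (integralCLM E).contDiff.comp ((contDiff_postcomp f hf).comp contDiff_snd)
    exact (this.differentiable (by simp)).differentiableAt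
  have h1 : HasFDerivAt (fun p : (E × ℝ) × C(unitInterval, E) => p.1.2)
      ((ContinuousLinearMap.snd ℝ E ℝ).comp (ContinuousLinearMap.fst ℝ _ _))
      ((x, 0), constCLM E x) :=
    ((ContinuousLinearMap.snd ℝ E ℝ).comp (ContinuousLinearMap.fst ℝ (E × ℝ) C(unitInterval, E))).hasFDerivAt
  have h2 : HasFDerivAt (fun p : (E × ℝ) × C(unitInterval, E) => constCLM E p.1.1)
      ((constCLM E).comp ((ContinuousLinearMap.fst ℝ E ℝ).comp (ContinuousLinearMap.fst ℝ _ _)))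
      ((x, 0), constCLM E x) :=
    ((constCLM E).comp ((ContinuousLinearMap.fst ℝ E ℝ).comp (ContinuousLinearMap.fst ℝ (E × ℝ) C(unitInterval, E)))).hasFDerivAt
  have key := HasFDerivAt.prodMk (hasFDerivAt_fst (𝕜 := ℝ) (p := ((x, (0 : ℝ)), constCLM E x)))
    ((hasFDerivAt_snd.sub h2).sub (h1.smul hN))
  refine key.congr_fderiv ?_
  ext p <;> simp [picardEquiv]

/-- A smooth vector field has a smooth local flow near every point. -/
theorem exists_smooth_localFlow {f : E → E} (hf : ContDiff ℝ ∞ f) (x₀ : E) :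
    ∃ Φ : ℝ × E → E, ∃ ρ > 0, (∀ p ∈ Metric.ball ((0 : ℝ), x₀) ρ, ContDiffAt ℝ ∞ Φ p) ∧
      (∀ x ∈ Metric.ball x₀ ρ, Φ (0, x) = x) ∧
      ∀ p ∈ Metric.ball ((0 : ℝ), x₀) ρ,
        HasDerivAt (fun s => Φ (s, p.2)) (f (Φ p)) p.1 := by
  let F : C(E, E) := ⟨f, hf.continuous⟩
  have hstrict := hasStrictFDerivAt_picardMap F hf x₀
  have hΨ := contDiff_picardMap F hf
  set a₀ : (E × ℝ) × C(unitInterval, E) := ((x₀, 0), constCLM E x₀) with ha₀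
  set P := hstrict.toOpenPartialHomeomorph (picardMap F) with hP
  have hPc : ∀ a, P a = picardMap F a := fun a => rfl
  have ha₀s : a₀ ∈ P.source := hstrict.mem_toOpenPartialHomeomorph_source
  -- The solution path with initial value x and time scale s is the preimage of `((x, s), 0)` under
  -- the local inverse of `picardMap`; its endpoint, the value at 1, is the flow at time s.
  let ι : ℝ × E → (E × ℝ) × C(unitInterval, E) := fun p => ((p.2, p.1), 0)
  have hι : ContDiff ℝ ∞ ι := (contDiff_snd.prodMk contDiff_fst).prodMk contDiff_const
  have hι₀ : ι (0, x₀) = P a₀ := by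
    rw [hPc]
    simp only [ι, picardMap, ha₀]
    ext <;> simp [constCLM]
  have hs₀ : P.symm (ι (0, x₀)) = a₀ := by rw [hι₀, P.left_inv ha₀s]
  have ht₀ : ι (0, x₀) ∈ P.target := by rw [hι₀]; exact P.map_source ha₀s
  have hcont : ContinuousAt (fun p => P.symm (ι p)) (0, x₀) :=
    ContinuousAt.comp (f := ι) (P.continuousAt_symm ht₀) hι.continuous.continuousAt
  obtain ⟨ρ₁, hρ₁, hball⟩ := Metric.mem_nhds_iff.1 (P.open_source.mem_nhds ha₀s)
  -- Smoothness of the local inverse at points other than the centre needs an invertible derivative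
  -- there; invertibility is an open condition.
  have hopen : IsOpen {a | fderiv ℝ (picardMap F) a ∈ range ((↑) :
      (((E × ℝ) × C(unitInterval, E)) ≃L[ℝ] ((E × ℝ) × C(unitInterval, E))) → _)} :=
    ContinuousLinearEquiv.isOpen.preimage (hΨ.continuous_fderiv (by simp))
  have hmem₀ : a₀ ∈ {a | fderiv ℝ (picardMap F) a ∈ range ((↑) :
      (((E × ℝ) × C(unitInterval, E)) ≃L[ℝ] ((E × ℝ) × C(unitInterval, E))) → _)} :=
    ⟨picardEquiv F x₀, hstrict.hasFDerivAt.fderiv.symm⟩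
  have hev : ∀ᶠ p in 𝓝 ((0 : ℝ), x₀), ι p ∈ P.target ∧
      (fderiv ℝ (picardMap F) (P.symm (ι p)) ∈ range ((↑) :
      (((E × ℝ) × C(unitInterval, E)) ≃L[ℝ] ((E × ℝ) × C(unitInterval, E))) → _)) ∧
      P.symm (ι p) ∈ Metric.ball a₀ ρ₁ := by
    refine (hι.continuous.continuousAt.eventually (P.open_target.mem_nhds ht₀)).and
      ((hcont.eventually (hopen.mem_nhds ?_)).and (hcont.eventually ?_))
    · show P.symm (ι (0, x₀)) ∈ _
      rw [hs₀]; exact hmem₀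
    · show ∀ᶠ y in 𝓝 (P.symm (ι (0, x₀))), _
      rw [hs₀]; exact Metric.ball_mem_nhds _ hρ₁
  obtain ⟨ρ, hρ, hev⟩ := Metric.eventually_nhds_iff_ball.1 hev
  have hfst : ∀ p ∈ Metric.ball ((0 : ℝ), x₀) ρ, (P.symm (ι p)).1 = (p.2, p.1) := fun p hp => by
    have := P.right_inv (hev p hp).1
    rw [hPc] at this
    exact congrArg Prod.fst this
  have hsol : ∀ p ∈ Metric.ball ((0 : ℝ), x₀) ρ, (P.symm (ι p)).2 =
      ContinuousMap.const _ p.2 + p.1 • integralCLM E (F.comp (P.symm (ι p)).2) := fun p hp => by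
    have := P.right_inv (hev p hp).1
    rw [hPc] at this
    have h2 := congrArg Prod.snd this
    simp only [picardMap, hfst p hp, ι] at h2
    rw [sub_sub, sub_eq_zero] at h2
    exact h2
  have hmulball : ∀ p ∈ Metric.ball ((0 : ℝ), x₀) ρ, ∀ t : unitInterval,
      ((p.1 * t, p.2) : ℝ × E) ∈ Metric.ball ((0 : ℝ), x₀) ρ := fun p hp t => by
    rw [← ball_prod_same] at hp ⊢
    refine ⟨?_, hp.2⟩
    have h1 : ‖p.1‖ < ρ := by simpa using hp.1
    have : ‖p.1 * t‖ < ρ := by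
      rw [norm_mul, Real.norm_of_nonneg t.2.1]
      exact (mul_le_of_le_one_right (norm_nonneg _) t.2.2).trans_lt h1
    simpa using this
  -- Both paths lie in the ball where `picardMap` is injective and have the same image under it, so
  -- they agree. This gives γ(t) = Φ(st, x) for the path γ with parameters (s, x).
  have hresc : ∀ p ∈ Metric.ball ((0 : ℝ), x₀) ρ, ∀ t : unitInterval,
      (P.symm (ι (p.1 * t, p.2))).2 = rescale t (P.symm (ι p)).2 := by
    intro p hp t
    have hp' := hmulball p hp t
    have hb := (hev p hp).2.2
    have hb' := (hev _ hp').2.2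
    have hmem : ((p.2, p.1 * t), rescale t (P.symm (ι p)).2) ∈ P.source := by
      apply hball
      have e := hfst _ hp'
      rw [← ball_prod_same] at hb hb' ⊢
      refine ⟨?_, ?_⟩
      · rw [← e]; exact hb'.1
      · refine lt_of_le_of_lt ?_ (Metric.mem_ball.1 hb.2)
        rw [ContinuousMap.dist_le dist_nonneg]
        intro u
        exact ContinuousMap.dist_apply_le_dist (f := (P.symm (ι p)).2) (g := constCLM E x₀) (u * t)
    have hval : P ((p.2, p.1 * t), rescale t (P.symm (ι p)).2) = ι (p.1 * t, p.2) := by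
      rw [hPc]
      refine Prod.ext rfl ?_
      ext u
      have h1 := congrArg (fun γ => γ (u * t)) (hsol p hp)
      have h2 := integralCLM_rescale t u (F.comp (P.symm (ι p)).2)
      simp only [picardMap, ι, ContinuousMap.sub_apply, ContinuousMap.smul_apply,
        ContinuousMap.const_apply, ContinuousMap.add_apply, ContinuousMap.zero_apply] at h1 ⊢
      rw [mul_smul]
      have h3 : F.comp (rescale t (P.symm (ι p)).2) = rescale t (F.comp (P.symm (ι p)).2) := rfl
      rw [h3, h2]
      have h4 : rescale t (P.symm (ι p)).2 u = (P.symm (ι p)).2 (u * t) := rfl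
      rw [h4, h1]
      abel
    rw [← hval, P.left_inv hmem]
  have hsmooth : ∀ p ∈ Metric.ball ((0 : ℝ), x₀) ρ,
      ContDiffAt ℝ ∞ (fun p => (P.symm (ι p)).2 1) p := by
    intro p hp
    obtain ⟨h1, ⟨A, hA⟩, -⟩ := hev p hp
    have hd : HasFDerivAt P (A : ((E × ℝ) × C(unitInterval, E)) →L[ℝ] _) (P.symm (ι p)) := by
      have := (hΨ.differentiable (by simp)).differentiableAt (x := P.symm (ι p)) |>.hasFDerivAt
      rw [← hA] at this
      exact this
    have h2 := P.contDiffAt_symm h1 hd (n := ∞) (hΨ.contDiffAt)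
    have h3 : ContDiffAt ℝ ∞ (fun p => P.symm (ι p)) p := h2.comp p hι.contDiffAt
    exact ((ContinuousMap.evalCLM ℝ (1 : unitInterval)).contDiff.contDiffAt.comp p
      (contDiff_snd.contDiffAt.comp p h3))
  refine ⟨fun p => (P.symm (ι p)).2 1, ρ, hρ, hsmooth, ?_, ?_⟩
  · intro x hx
    have hp : ((0 : ℝ), x) ∈ Metric.ball ((0 : ℝ), x₀) ρ := by
      rw [← ball_prod_same]; exact ⟨Metric.mem_ball_self hρ, hx⟩
    have := congrArg (fun γ => γ 1) (hsol _ hp)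
    simpa using this
  · have hsmooth' : ∀ p ∈ Metric.ball ((0 : ℝ), x₀) ρ,
        ContDiffAt ℝ ∞ (fun s => (P.symm (ι (s, p.2))).2 1) p.1 := fun p hp =>
      ContDiffAt.comp (f := fun s : ℝ => (s, p.2)) (g := fun p => (P.symm (ι p)).2 1) p.1
        (hsmooth p hp) (contDiffAt_id.prodMk contDiffAt_const)
    -- For s ≠ 0 the path γ is differentiated at its endpoint in two ways, through the integral
    -- equation and through γ(t) = Φ(st, x); the common factor s is then cancelled.
    have hne : ∀ p ∈ Metric.ball ((0 : ℝ), x₀) ρ, p.1 ≠ 0 →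
        deriv (fun s => (P.symm (ι (s, p.2))).2 1) p.1 = f ((P.symm (ι p)).2 1) := by
      intro p hp hp0
      have hd := ((hsmooth' p hp).differentiableAt (by simp)).hasDerivAt
      set γ := (P.symm (ι p)).2 with hγ
      have h1 : HasDerivWithinAt (fun t : ℝ => γ (projIcc 0 1 zero_le_one t)) (p.1 • f (γ 1))
          (Icc 0 1) 1 := by
        have h2 := ((hasDerivWithinAt_integralCLM (F.comp γ) 1).const_smul p.1).const_add p.2
        refine (h2.congr_of_mem (fun t ht => ?_) (by simp))
        exact congrArg (fun γ => γ (projIcc 0 1 zero_le_one t)) (hsol p hp)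
      have h2 : HasDerivWithinAt (fun t : ℝ => γ (projIcc 0 1 zero_le_one t))
          (p.1 • deriv (fun s => (P.symm (ι (s, p.2))).2 1) p.1) (Icc 0 1) 1 := by
        have h3 : HasDerivAt (fun t : ℝ => (P.symm (ι (p.1 * t, p.2))).2 1)
            (p.1 • deriv (fun s => (P.symm (ι (s, p.2))).2 1) p.1) 1 := by
          have h4 : HasDerivAt (fun t : ℝ => p.1 * t) p.1 1 := by
            simpa using (hasDerivAt_id (1 : ℝ)).const_mul p.1
          refine HasDerivAt.scomp (h := fun t : ℝ => p.1 * t)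
            (g₁ := fun s => (P.symm (ι (s, p.2))).2 1) (1 : ℝ) ?_ h4
          rw [mul_one]; exact hd
        refine h3.hasDerivWithinAt.congr_of_mem (fun t ht => ?_) (by simp)
        have h5 := hresc p hp ⟨t, ht⟩
        have h6 := congrArg (fun γ => γ 1) h5
        simp only [rescale, ContinuousMap.comp_apply, ContinuousMap.coe_mk, one_mul] at h6
        rw [projIcc_of_mem _ ht]
        exact h6.symm
      have h3 := UniqueDiffWithinAt.eq_deriv (Icc (0 : ℝ) 1)
        (uniqueDiffOn_Icc zero_lt_one 1 (by simp)) h2 h1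
      exact smul_right_injective E hp0 h3
    intro p hp
    have hd := ((hsmooth' p hp).differentiableAt (by simp)).hasDerivAt
    suffices h : deriv (fun s => (P.symm (ι (s, p.2))).2 1) p.1 = f ((P.symm (ι p)).2 1) by
      rw [h] at hd; exact hd
    by_cases hp0 : p.1 = 0
    -- At time 0 there is no factor to cancel; the equation extends there by continuity of both
    -- sides.
    · have hc1 : ContinuousAt (deriv fun s => (P.symm (ι (s, p.2))).2 1) p.1 :=
        ((hsmooth' p hp).continuousAt_fderiv (by simp)).clm_apply continuousAt_const
      have hc2 : ContinuousAt (fun s => f ((P.symm (ι (s, p.2))).2 1)) p.1 :=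
        hf.continuous.continuousAt.comp (f := fun s => (P.symm (ι (s, p.2))).2 1)
          (hsmooth' p hp).continuousAt
      have hee : (deriv fun s => (P.symm (ι (s, p.2))).2 1) =ᶠ[𝓝[≠] p.1]
          (fun s => f ((P.symm (ι (s, p.2))).2 1)) := by
        have : ∀ᶠ s in 𝓝 p.1, (s, p.2) ∈ Metric.ball ((0 : ℝ), x₀) ρ :=
          (Continuous.prodMk_left p.2).continuousAt.eventually (Metric.isOpen_ball.mem_nhds hp)
        filter_upwards [self_mem_nhdsWithin, nhdsWithin_le_nhds this] with s hs hs'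
        exact hne _ hs' (by rw [hp0] at hs; exact hs)
      exact tendsto_nhds_unique ((hc1.tendsto.mono_left nhdsWithin_le_nhds).congr' hee)
        (hc2.tendsto.mono_left nhdsWithin_le_nhds)
    · exact hne p hp hp0

end LocalFlow
end SmoothFlow

namespace SmoothFlow

universe u

/-! ### Flows of vector fields on manifolds without boundary -/

section Manifold

variable {E : Type u} [NormedAddCommGroup E] [NormedSpace ℝ E]
  {H : Type*} [TopologicalSpace H] {I : ModelWithCorners ℝ E H}
  {N : Type*} [TopologicalSpace N] [ChartedSpace H N]

/-- The expression of a vector field in the chart around `x₀`. -/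
def fieldInChart (X : ∀ q : N, TangentSpace I q) (x₀ : N) (y : E) : E :=
  mfderiv I 𝓘(ℝ, E) (extChartAt I x₀) ((extChartAt I x₀).symm y) (X ((extChartAt I x₀).symm y))

/-- The trivialization of the tangent bundle at x₀ acts on fibres as the derivative of the chart, so
`fieldInChart` is precisely the section read in this trivialization. -/
theorem contMDiff_of_fieldInChart [IsManifold I ∞ N] [I.Boundaryless]
    {X : ∀ q : N, TangentSpace I q}
    (hX : ∀ x₀, ContDiffOn ℝ ∞ (fieldInChart X x₀) (extChartAt I x₀).target) :
    ContMDiff I I.tangent ∞ (fun x => (⟨x, X x⟩ : TangentBundle I N)) := by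
  intro x₀
  refine (Bundle.contMDiffAt_section (E := fun x : N => TangentSpace I x) (F := E) x₀).2 ?_
  have h1 : ContMDiffAt I 𝓘(ℝ, E) ∞ (fieldInChart X x₀ ∘ extChartAt I x₀) x₀ := by
    refine ContMDiffAt.comp (I' := 𝓘(ℝ, E)) x₀ ?_ contMDiffAt_extChartAt
    exact ((hX x₀).contDiffAt (extChartAt_target_mem_nhds x₀)).contMDiffAt
  refine h1.congr_of_eventuallyEq ?_
  filter_upwards [extChartAt_source_mem_nhds (I := I) x₀] with x hx
  rw [extChartAt_source] at hx
  have hb : x ∈ (trivializationAt E (TangentSpace I) x₀).baseSet := by simpa using hx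
  rw [Function.comp_apply, fieldInChart, (extChartAt I x₀).left_inv (by rwa [extChartAt_source])]
  exact (congrFun (Bundle.Trivialization.coe_linearMapAt_of_mem (R := ℝ)
    (trivializationAt E (TangentSpace I) x₀) hb) (X x)).symm.trans
    (DFunLike.congr_fun (TangentBundle.continuousLinearMapAt_trivializationAt (I := I) hx) (X x))

variable [FiniteDimensional ℝ E] [IsManifold I ∞ N] [I.Boundaryless]

/-- A smooth vector field on a manifold without boundary has smooth local flows. -/
theorem exists_smooth_localFlow_manifold {X : ∀ q : N, TangentSpace I q}
    (hX : ∀ x₀, ContDiffOn ℝ ∞ (fieldInChart X x₀) (extChartAt I x₀).target) (x₀ : N) :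
    ∃ ε > 0, ∃ U : Set N, IsOpen U ∧ x₀ ∈ U ∧ ∃ Φ : ℝ × N → N,
      (∀ p ∈ Ioo (-ε) ε ×ˢ U, ContMDiffAt (𝓘(ℝ, ℝ).prod I) I ∞ Φ p) ∧
      (∀ q ∈ U, Φ (0, q) = q) ∧
      ∀ q ∈ U, IsMIntegralCurveOn (fun s => Φ (s, q)) X (Ioo (-ε) ε) := by
  have : CompleteSpace E := FiniteDimensional.complete ℝ E
  set φ := extChartAt I x₀ with hφ
  set y₀ := φ x₀ with hy₀
  have hopen : IsOpen φ.target := isOpen_extChartAt_target x₀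
  have hy₀t : y₀ ∈ φ.target := mem_extChartAt_target x₀
  obtain ⟨R, hR, hball⟩ := Metric.nhds_basis_closedBall.mem_iff.1 (hopen.mem_nhds hy₀t)
  -- The cutoff makes the chart expression a smooth field on all of `E`. For short times the flow
  -- stays in the ball of radius R/2, where the cutoff is 1 and the field is the original one.
  let b : ContDiffBump y₀ := ⟨R / 2, R, by positivity, by linarith⟩
  let f : E → E := fun y => b y • fieldInChart X x₀ y
  have hf : ContDiff ℝ ∞ f := by
    rw [contDiff_iff_contDiffAt]
    intro y
    by_cases hy : y ∈ φ.target
    · exact b.contDiffAt.smul ((hX x₀).contDiffAt (hopen.mem_nhds hy))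
    · have : f =ᶠ[𝓝 y] fun _ => 0 := by
        have hy' : y ∈ (Metric.closedBall y₀ R)ᶜ := fun h => hy (hball h)
        filter_upwards [Metric.isClosed_closedBall.isOpen_compl.mem_nhds hy'] with z hz
        have hz' : ¬ dist z y₀ ≤ R := hz
        have : b z = 0 := b.zero_of_le_dist (not_le.1 hz').le
        simp [f, this]
      exact contDiffAt_const.congr_of_eventuallyEq this
  obtain ⟨Ψ, ρ, hρ, hsm, h0, hder⟩ := exists_smooth_localFlow hf y₀
  have hcont : ContinuousAt Ψ (0, y₀) := (hsm _ (Metric.mem_ball_self hρ)).continuousAt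
  have hΨ0 : Ψ (0, y₀) = y₀ := h0 _ (Metric.mem_ball_self hρ)
  have hev : ∀ᶠ p in 𝓝 ((0 : ℝ), y₀), p ∈ Metric.ball ((0 : ℝ), y₀) ρ ∧
      Ψ p ∈ Metric.ball y₀ (R / 2) := by
    refine Filter.Eventually.and (Metric.ball_mem_nhds _ hρ) (hcont.preimage_mem_nhds ?_)
    rw [hΨ0]
    exact Metric.ball_mem_nhds _ (by positivity)
  obtain ⟨ε, hε, hev⟩ := Metric.eventually_nhds_iff_ball.1 hev
  have htar : ∀ p ∈ Metric.ball ((0 : ℝ), y₀) ε, Ψ p ∈ φ.target := fun p hp =>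
    hball (Metric.ball_subset_closedBall
      (Metric.ball_subset_ball (by linarith) (hev p hp).2))
  have hU : IsOpen (φ.source ∩ φ ⁻¹' Metric.ball y₀ ε) :=
    (continuousOn_extChartAt x₀).isOpen_inter_preimage (isOpen_extChartAt_source x₀)
      Metric.isOpen_ball
  have hmem : ∀ p ∈ Ioo (-ε) ε ×ˢ (φ.source ∩ φ ⁻¹' Metric.ball y₀ ε),
      ((p.1, φ p.2) : ℝ × E) ∈ Metric.ball ((0 : ℝ), y₀) ε := by
    rintro ⟨s, q⟩ ⟨hs, hq⟩
    rw [← ball_prod_same]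
    refine ⟨?_, hq.2⟩
    simpa [abs_lt] using hs
  refine ⟨ε, hε, φ.source ∩ φ ⁻¹' Metric.ball y₀ ε, hU,
    ⟨mem_extChartAt_source x₀, Metric.mem_ball_self hε⟩, fun p => φ.symm (Ψ (p.1, φ p.2)),
    ?_, ?_, ?_⟩
  · intro p hp
    have h1 := hmem p hp
    have h2 : ContMDiffAt (𝓘(ℝ, ℝ).prod I) 𝓘(ℝ, ℝ × E) ∞
        (fun p : ℝ × N => (p.1, φ p.2)) p := by
      refine contMDiffAt_fst.prodMk_space ?_
      refine ContMDiffAt.comp (I' := I) p ?_ contMDiffAt_snd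
      exact contMDiffAt_extChartAt' (by simpa [hφ] using hp.2.1)
    have h3 : ContMDiffAt (𝓘(ℝ, ℝ).prod I) 𝓘(ℝ, E) ∞ (fun p : ℝ × N => Ψ (p.1, φ p.2)) p :=
      ContMDiffAt.comp (I' := 𝓘(ℝ, ℝ × E)) p (hsm _ (hev _ h1).1).contMDiffAt h2
    refine ContMDiffAt.comp (I' := 𝓘(ℝ, E)) p ?_ h3
    exact (contMDiffOn_extChartAt_symm x₀).contMDiffAt (hopen.mem_nhds (htar _ h1))
  · rintro q ⟨hq1, hq2⟩
    have : φ q ∈ Metric.ball y₀ ρ := by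
      have := (hev _ (hmem (0, q) ⟨by simpa using hε, hq1, hq2⟩)).1
      rw [← ball_prod_same] at this
      exact this.2
    simp only
    rw [h0 _ this, φ.left_inv hq1]
  · intro q hq s hs
    apply HasMFDerivAt.hasMFDerivWithinAt
    have h1 := hmem (s, q) ⟨hs, hq⟩
    have ht := htar _ h1
    have h2 : HasDerivAt (fun s => Ψ (s, φ q)) (f (Ψ (s, φ q))) s := hder _ (hev _ h1).1
    have hb : b (Ψ (s, φ q)) = 1 := b.one_of_mem_closedBall
      (Metric.ball_subset_closedBall (hev _ h1).2)
    have hf1 : f (Ψ (s, φ q)) = fieldInChart X x₀ (Ψ (s, φ q)) := by simp [f, hb]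
    rw [hf1] at h2
    have h3 : HasMFDerivAt 𝓘(ℝ, E) I φ.symm (Ψ (s, φ q))
        (mfderiv 𝓘(ℝ, E) I φ.symm (Ψ (s, φ q))) :=
      ((((contMDiffOn_extChartAt_symm (n := ∞) x₀).contMDiffAt
        (hopen.mem_nhds ht)).mdifferentiableAt (by simp))).hasMFDerivAt
    have h4 := HasMFDerivAt.comp (f := fun s => Ψ (s, φ q)) s h3 h2.hasFDerivAt.hasMFDerivAt
    refine h4.congr_mfderiv ?_
    have h5 := mfderivWithin_extChartAt_symm_comp_mfderiv_extChartAt (I := I) (x := x₀) ht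
    rw [I.range_eq_univ, mfderivWithin_univ] at h5
    have h6 : mfderiv 𝓘(ℝ, E) I φ.symm (Ψ (s, φ q)) (fieldInChart (E := E) X x₀ (Ψ (s, φ q))) = X (φ.symm (Ψ (s, φ q))) := DFunLike.congr_fun h5 (X (φ.symm (Ψ (s, φ q))))
    refine ContinuousLinearMap.ext fun a : ℝ => ?_
    exact (ContinuousLinearMap.map_smul (mfderiv 𝓘(ℝ, E) I φ.symm (Ψ (s, φ q))) a _).trans (congrArg (a • ·) h6)

variable [T2Space N]

/-- A compactly supported smooth vector field on a manifold without boundary has a smooth global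
flow. -/
theorem exists_smooth_globalFlow {X : ∀ q : N, TangentSpace I q}
    (hX : ∀ x₀, ContDiffOn ℝ ∞ (fieldInChart X x₀) (extChartAt I x₀).target)
    {K : Set N} (hK : IsCompact K) (hXK : ∀ q ∉ K, X q = 0) :
    ∃ ψ : ℝ → N → N, (∀ q, ψ 0 q = q) ∧ (∀ s t q, ψ (s + t) q = ψ s (ψ t q)) ∧
      ContMDiff (𝓘(ℝ, ℝ).prod I) I ∞ (fun p : ℝ × N => ψ p.1 p.2) ∧
      (∀ q, IsMIntegralCurve (fun s => ψ s q) X) ∧ ∀ s, ∀ q ∉ K, ψ s q = q := by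
  have hX1 : ContMDiff I I.tangent 1 (fun x => (⟨x, X x⟩ : TangentBundle I N)) :=
    (contMDiff_of_fieldInChart hX).of_le (by simp)
  choose ε hε U hU hxU Φ hΦ hΦ0 hΦX using exists_smooth_localFlow_manifold hX
  obtain ⟨T, hTK, hT⟩ := hK.elim_nhds_subcover U (fun x _ => (hU x).mem_nhds (hxU x))
  -- Finitely many flow boxes cover `K`, and outside `K` the constant curves are integral, so all
  -- points share an existence time δ; this yields integral curves defined for all times.
  obtain ⟨δ, hδ, hδT⟩ : ∃ δ > 0, ∀ x ∈ T, δ ≤ ε x := by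
    rcases T.eq_empty_or_nonempty with rfl | hne
    · exact ⟨1, one_pos, by simp⟩
    · exact ⟨T.inf' hne ε, by simpa using fun x _ => hε x, fun x hx => T.inf'_le _ hx⟩
  have hloc : ∀ q, ∃ γ : ℝ → N, γ 0 = q ∧ IsMIntegralCurveOn γ X (Ioo (-δ) δ) := by
    intro q
    by_cases hq : q ∈ K
    · obtain ⟨x, hx, hqx⟩ := mem_iUnion₂.1 (hT hq)
      refine ⟨fun s => Φ x (s, q), hΦ0 x q hqx, (hΦX x q hqx).mono ?_⟩
      exact Ioo_subset_Ioo (neg_le_neg (hδT x hx)) (hδT x hx)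
    · exact ⟨fun _ => q, rfl, (isMIntegralCurve_const (hXK q hq)).isMIntegralCurveOn _⟩
  choose γ hγ0 hγX using exists_isMIntegralCurve_of_isMIntegralCurveOn hX1 hδ hloc
  have hadd : ∀ s t q, γ q (s + t) = γ (γ q t) s := by
    intro s t q
    have h1 : IsMIntegralCurve (γ q ∘ (· + t)) X := (hγX q).comp_add t
    have h2 := isMIntegralCurve_Ioo_eq_of_contMDiff_boundaryless (t₀ := 0) hX1 h1 (hγX (γ q t))
      (by simp [hγ0])
    exact congrFun h2 s
  have hfix : ∀ s, ∀ q ∉ K, γ q s = q := by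
    intro s q hq
    have h2 := isMIntegralCurve_Ioo_eq_of_contMDiff_boundaryless (t₀ := 0) hX1 (hγX q)
      (isMIntegralCurve_const (hXK q hq)) (hγ0 q)
    exact congrFun h2 s
  -- By uniqueness of integral curves the global curves agree with a smooth local flow near points
  -- of `K`, and off `K` they are constant.
  have hsmall : ∀ s, |s| < δ → ∀ q, ContMDiffAt (𝓘(ℝ, ℝ).prod I) I ∞
      (fun p : ℝ × N => γ p.2 p.1) (s, q) := by
    intro s hs q
    by_cases hq : q ∈ K
    · obtain ⟨x, hx, hqx⟩ := mem_iUnion₂.1 (hT hq)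
      have hsx : s ∈ Ioo (-ε x) (ε x) := abs_lt.1 (hs.trans_le (hδT x hx))
      refine (hΦ x (s, q) ⟨hsx, hqx⟩).congr_of_eventuallyEq ?_
      have hn : Ioo (-ε x) (ε x) ×ˢ U x ∈ 𝓝 (s, q) :=
        (isOpen_Ioo.prod (hU x)).mem_nhds ⟨hsx, hqx⟩
      filter_upwards [hn] with p hp
      exact isMIntegralCurveOn_Ioo_eqOn_of_contMDiff_boundaryless (t₀ := 0)
        (by simpa using hε x) hX1 ((hγX p.2).isMIntegralCurveOn _) (hΦX x p.2 hp.2)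
        (by rw [hγ0, hΦ0 x _ hp.2]) hp.1
    · have : (fun p : ℝ × N => γ p.2 p.1) =ᶠ[𝓝 (s, q)] Prod.snd := by
        have : ∀ᶠ p : ℝ × N in 𝓝 (s, q), p.2 ∈ Kᶜ :=
          continuous_snd.continuousAt.eventually (hK.isClosed.isOpen_compl.mem_nhds hq)
        filter_upwards [this] with p hp
        exact hfix _ _ hp
      exact contMDiffAt_snd.congr_of_eventuallyEq this
  have hslice : ∀ s, |s| < δ → ContMDiff I I ∞ (fun q => γ q s) := fun s hs q =>
    ContMDiffAt.comp (I' := 𝓘(ℝ, ℝ).prod I) (f := fun q => (s, q)) q (hsmall s hs q)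
      (contMDiffAt_const.prodMk contMDiffAt_id)
  have hiter : ∀ (s : ℝ) (k : ℕ) q, γ q (k * s) = (fun q => γ q s)^[k] q := by
    intro s k
    induction k with
    | zero => intro q; simp [hγ0]
    | succ k ih =>
      intro q
      rw [Function.iterate_succ_apply, ← ih, ← hadd]
      congr 1; push_cast; ring
  -- The time-s map is the k-fold iterate of the time-s/k map, which is smooth once |s/k| < δ.
  have hslice' : ∀ s, ContMDiff I I ∞ (fun q => γ q s) := by
    intro s
    obtain ⟨k, hk⟩ := exists_nat_gt (|s| / δ)
    have hk0 : (0 : ℝ) < k := lt_of_le_of_lt (by positivity) hk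
    have hs : |s / k| < δ := by
      rw [abs_div, Nat.abs_cast, div_lt_iff₀ hk0, mul_comm]
      exact (div_lt_iff₀ hδ).1 hk
    have : (fun q => γ q s) = (fun q => γ q (s / k))^[k] := by
      funext q
      rw [← hiter, mul_div_cancel₀ _ hk0.ne']
    rw [this]
    have hg := hslice _ hs
    generalize (fun q => γ q (s / k)) = g at hg
    clear hk hk0 hs this
    induction k with
    | zero => exact contMDiff_id
    | succ k ih => rw [Function.iterate_succ]; exact ih.comp hg
  refine ⟨fun s q => γ q s, hγ0, hadd, ?_, hγX, hfix⟩
  rintro ⟨s₀, q⟩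
  -- The group law moves joint smoothness from times near 0 to times near s₀.
  have h1 : (fun p : ℝ × N => γ p.2 p.1) =
      (fun p : ℝ × N => γ p.2 p.1) ∘ fun p => (p.1 - s₀, γ p.2 s₀) := by
    funext p
    simp only [Function.comp_apply]
    rw [← hadd, sub_add_cancel]
  rw [h1]
  refine ContMDiffAt.comp (I' := 𝓘(ℝ, ℝ).prod I) _ ?_ ?_
  · simpa using hsmall 0 (by simpa using hδ) (γ q s₀)
  · refine ContMDiffAt.prodMk ?_ ?_
    · exact contMDiffAt_fst.sub contMDiffAt_const
    · exact (hslice' s₀).contMDiffAt.comp (s₀, q) contMDiffAt_snd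

end Manifold
end SmoothFlow

namespace ContactGeometry

variable {n : ℕ} {M : Type*} [TopologicalSpace M] [ChartedSpace (Model n) M]
  [IsManifold (𝓡 (2 * n + 1)) ∞ M]

/-! ### Smoothness of pairings and pull-backs of the contact form -/

section Pairing

variable {F G : Type*} [NormedAddCommGroup F] [NormedSpace ℝ F] [TopologicalSpace G]
  {J : ModelWithCorners ℝ F G} {P : Type*} [TopologicalSpace P] [ChartedSpace G P]

/-- A smooth form applied to a smooth vector field along a map is smooth. -/
theorem ContactForm.contMDiffWithinAt_apply (α : ContactForm n M) {b : P → M}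
    {v : ∀ p, TangentSpace (𝓡 (2 * n + 1)) (b p)} {s : Set P} {p₀ : P}
    (hv : ContMDiffWithinAt J (𝓡 (2 * n + 1)).tangent ∞
      (fun p => (⟨b p, v p⟩ : TangentBundle (𝓡 (2 * n + 1)) M)) s p₀) :
    ContMDiffWithinAt J 𝓘(ℝ, ℝ) ∞ (fun p => α.form (b p) (v p)) s p₀ := by
  have hb : ContMDiffWithinAt J (𝓡 (2 * n + 1)) ∞ b s p₀ := by
    have := (Bundle.contMDiff_proj (TangentSpace (𝓡 (2 * n + 1)) : M → Type _)
      (IB := 𝓡 (2 * n + 1)) (n := ∞)).contMDiffAt.comp_contMDiffWithinAt p₀ hv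
    exact this
  have hα := (α.smooth.contMDiffAt (x := b p₀)).comp_contMDiffWithinAt p₀ hb
  have := ContMDiffWithinAt.clm_bundle_apply (E₂ := Bundle.Trivial M ℝ) (F₂ := ℝ) hα hv
  rw [Bundle.contMDiffWithinAt_totalSpace] at this
  exact this.2

end Pairing

/-- The pull-back `φ^* α`. -/
def pullForm (α : ContactForm n M) (φ : M → M) (q : M) (v : TangentSpace (𝓡 (2 * n + 1)) q) : ℝ :=
  α.form (φ q) (mfderiv (𝓡 (2 * n + 1)) (𝓡 (2 * n + 1)) φ q v)

theorem pullForm_comp (α : ContactForm n M) {φ ψ : M → M} {q : M}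
    (hφ : MDifferentiableAt (𝓡 (2 * n + 1)) (𝓡 (2 * n + 1)) φ (ψ q))
    (hψ : MDifferentiableAt (𝓡 (2 * n + 1)) (𝓡 (2 * n + 1)) ψ q)
    (v : TangentSpace (𝓡 (2 * n + 1)) q) :
    pullForm α (φ ∘ ψ) q v =
      pullForm α φ (ψ q) (mfderiv (𝓡 (2 * n + 1)) (𝓡 (2 * n + 1)) ψ q v) := by
  unfold pullForm
  rw [mfderiv_comp q hφ hψ]
  rfl

section Push

variable {F : Type*} [NormedAddCommGroup F] [NormedSpace ℝ F]

/-- The pull-back of the contact form under a parametrization. -/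
def pullParam (α : ContactForm n M) (G : F → M) (y : F) : F →L[ℝ] ℝ :=
  (α.form (G y)).comp (mfderiv 𝓘(ℝ, F) (𝓡 (2 * n + 1)) G y)

/-- The tangent map of `G` carries the constant field `w` to a smooth vector field along `G`, to
which the form is then applied. -/
theorem contDiffOn_pullParam_apply (α : ContactForm n M) {G : F → M} {O : Set F} (hO : IsOpen O)
    (hG : ContMDiffOn 𝓘(ℝ, F) (𝓡 (2 * n + 1)) ∞ G O) (w : F) :
    ContDiffOn ℝ ∞ (fun y => pullParam α G y w) O := by
  rw [← contMDiffOn_iff_contDiffOn]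
  intro y hy
  refine ContMDiffWithinAt.congr (f := fun y => pullParam α G y w) ?_ (fun _ _ => rfl) rfl
  refine α.contMDiffWithinAt_apply (b := G)
    (v := fun y => mfderiv 𝓘(ℝ, F) (𝓡 (2 * n + 1)) G y w) ?_
  have h1 := hG.contMDiffOn_tangentMapWithin (m := ∞) (by simp) hO.uniqueMDiffOn
  have h2 : ContMDiff 𝓘(ℝ, F) 𝓘(ℝ, F).tangent ∞
      (fun y : F => (⟨y, w⟩ : TangentBundle 𝓘(ℝ, F) F)) := by
    intro y
    refine (Bundle.contMDiffAt_section (E := fun x : F => TangentSpace 𝓘(ℝ, F) x) (F := F) y).2 ?_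
    simpa using contMDiffAt_const
  have h3 := (h1 ⟨y, w⟩ hy).comp y (h2.contMDiffAt (x := y)).contMDiffWithinAt
    (fun z (hz : z ∈ O) => hz)
  refine h3.congr (fun z hz => ?_) ?_
  · simp only [Function.comp_apply, tangentMapWithin]
    rw [mfderivWithin_of_isOpen hO hz]
  · simp only [Function.comp_apply, tangentMapWithin]
    rw [mfderivWithin_of_isOpen hO hy]

theorem contDiffOn_pullParam [FiniteDimensional ℝ F] (α : ContactForm n M) {G : F → M} {O : Set F}
    (hO : IsOpen O) (hG : ContMDiffOn 𝓘(ℝ, F) (𝓡 (2 * n + 1)) ∞ G O) :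
    ContDiffOn ℝ ∞ (pullParam α G) O :=
  contDiffOn_clm_apply.2 fun w => contDiffOn_pullParam_apply α hO hG w

theorem contDiffOn_formInChart (α : ContactForm n M) (x : M) :
    ContDiffOn ℝ ∞ (formInChart α.form x) (extChartAt (𝓡 (2 * n + 1)) x).target :=
  contDiffOn_pullParam α (isOpen_extChartAt_target x) (contMDiffOn_extChartAt_symm x)

end Push

/-! ### Contact forms and Reeb fields on normed spaces -/

section Pencil

variable {E F : Type*} [NormedAddCommGroup E] [NormedSpace ℝ E]
  [NormedAddCommGroup F] [NormedSpace ℝ F]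

/-- The exterior derivative of a 1-form on a normed space. -/
def extDerivOne (β : E → E →L[ℝ] ℝ) (y : E) : E →L[ℝ] E →L[ℝ] ℝ :=
  fderiv ℝ β y - (fderiv ℝ β y).flip

theorem extDerivOne_apply (β : E → E →L[ℝ] ℝ) (y u v : E) :
    extDerivOne β y u v = fderiv ℝ β y u v - fderiv ℝ β y v u := rfl

/-- The exterior derivative commutes with pull-backs. -/
theorem extDerivOne_pullback {β : F → F →L[ℝ] ℝ} {τ : E → F} {y : E}
    (hβ : DifferentiableAt ℝ β (τ y)) (hτ : ContDiffAt ℝ 2 τ y) {β' : E → E →L[ℝ] ℝ}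
    (h : β' =ᶠ[𝓝 y] fun z => (β (τ z)).comp (fderiv ℝ τ z)) (u v : E) :
    extDerivOne β' y u v = extDerivOne β (τ y) (fderiv ℝ τ y u) (fderiv ℝ τ y v) := by
  have hτ1 : DifferentiableAt ℝ τ y := hτ.differentiableAt (by simp)
  have hτ2 : DifferentiableAt ℝ (fderiv ℝ τ) y :=
    (hτ.fderiv_right (m := 1) (by norm_num)).differentiableAt (by simp)
  have hs : IsSymmSndFDerivAt ℝ τ y := hτ.isSymmSndFDerivAt (by simp)
  have hd : ∀ u v, fderiv ℝ β' y u v =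
      fderiv ℝ β (τ y) (fderiv ℝ τ y u) (fderiv ℝ τ y v) +
        β (τ y) (fderiv ℝ (fderiv ℝ τ) y u v) := by
    intro u v
    rw [h.fderiv_eq]
    have h1 : HasFDerivAt (fun z => β (τ z)) ((fderiv ℝ β (τ y)).comp (fderiv ℝ τ y)) y :=
      hβ.hasFDerivAt.comp y hτ1.hasFDerivAt
    rw [(h1.clm_comp hτ2.hasFDerivAt).fderiv]
    simp [add_comm]
  rw [extDerivOne_apply, extDerivOne_apply, hd, hd, hs u v]
  ring

/-- The linear map `u ↦ dβ(u, ·) + β(u) β`. -/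
def reebOperator (β : E → E →L[ℝ] ℝ) (y : E) : E →L[ℝ] E →L[ℝ] ℝ :=
  extDerivOne β y + (β y).smulRight (β y)

theorem reebOperator_apply (β : E → E →L[ℝ] ℝ) (y u v : E) :
    reebOperator β y u v = extDerivOne β y u v + β y u * β y v := rfl

theorem extDerivOne_self (β : E → E →L[ℝ] ℝ) (y u : E) : extDerivOne β y u u = 0 := by
  rw [extDerivOne_apply, sub_self]

/-- The contact condition for a 1-form on a normed space. -/
def IsContactAt (β : E → E →L[ℝ] ℝ) (y : E) : Prop :=
  β y ≠ 0 ∧ ∀ u, β y u = 0 → (∀ v, β y v = 0 → extDerivOne β y u v = 0) → u = 0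

/-- Evaluating dβ(u, ·) + β(u)β = 0 on u itself gives β(u)² = 0; then dβ(u, ·) = 0, and the contact
condition applies. In finite dimension this makes the operator invertible, so the Reeb field is
obtained by inverting it. -/
theorem IsContactAt.injective {β : E → E →L[ℝ] ℝ} {y : E} (h : IsContactAt β y) :
    Function.Injective (reebOperator β y) := by
  rw [injective_iff_map_eq_zero]
  intro u hu
  have hv : ∀ v, extDerivOne β y u v + β y u * β y v = 0 := fun v => by
    rw [← reebOperator_apply, hu]; rfl
  have h0 : β y u = 0 := by
    have := hv u
    rw [extDerivOne_self, zero_add] at this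
    exact mul_self_eq_zero.1 this
  exact h.2 u h0 fun v _ => by simpa [h0] using hv v

variable [FiniteDimensional ℝ E]

/-- The operator `u ↦ dβ(u, ·) + β(u) β` as an isomorphism, for a contact form. -/
def IsContactAt.equiv {β : E → E →L[ℝ] ℝ} {y : E} (h : IsContactAt β y) :
    E ≃L[ℝ] (E →L[ℝ] ℝ) :=
  (LinearEquiv.ofInjectiveOfFinrankEq (reebOperator β y : E →ₗ[ℝ] (E →L[ℝ] ℝ)) h.injective
    (by rw [LinearMap.toContinuousLinearMap.symm.finrank_eq, Module.finrank_linearMap_self]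
        )).toContinuousLinearEquiv

theorem IsContactAt.coe_equiv {β : E → E →L[ℝ] ℝ} {y : E} (h : IsContactAt β y) :
    (h.equiv : E →L[ℝ] (E →L[ℝ] ℝ)) = reebOperator β y := by
  ext u v; rfl

/-- The Reeb vector field of a contact form on a normed space. -/
def reebLocal (β : E → E →L[ℝ] ℝ) (y : E) : E := (reebOperator β y).inverse (β y)

theorem IsContactAt.reebOperator_reebLocal {β : E → E →L[ℝ] ℝ} {y : E} (h : IsContactAt β y) :
    reebOperator β y (reebLocal β y) = β y := by
  have : reebLocal β y = h.equiv.symm (β y) := by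
    rw [reebLocal, ← h.coe_equiv, ContinuousLinearMap.inverse_equiv]; rfl
  rw [this, ← h.coe_equiv]
  exact h.equiv.apply_symm_apply _

/-- The defining equation, evaluated on the Reeb vector R itself, reads β(R)² = β(R). If β(R) were
0, the contact condition would give R = 0, and then the equation would give β = 0. -/
theorem IsContactAt.apply_reebLocal {β : E → E →L[ℝ] ℝ} {y : E} (h : IsContactAt β y) :
    β y (reebLocal β y) = 1 := by
  have hv : ∀ v, extDerivOne β y (reebLocal β y) v + β y (reebLocal β y) * β y v = β y v :=
    fun v => by rw [← reebOperator_apply, h.reebOperator_reebLocal]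
  have h1 := hv (reebLocal β y)
  rw [extDerivOne_self, zero_add] at h1
  by_contra hne
  have h0 : β y (reebLocal β y) = 0 := by
    have : β y (reebLocal β y) * (β y (reebLocal β y) - 1) = 0 := by linarith
    exact (mul_eq_zero.1 this).resolve_right (sub_ne_zero.2 hne)
  have h2 := h.2 _ h0 fun v hv' => by simpa [h0, hv'] using hv v
  apply h.1
  ext v
  have := hv v
  rw [h2] at this
  simpa using this.symm

theorem IsContactAt.extDerivOne_reebLocal {β : E → E →L[ℝ] ℝ} {y : E} (h : IsContactAt β y)
    (v : E) : extDerivOne β y (reebLocal β y) v = 0 := by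
  have hv : extDerivOne β y (reebLocal β y) v + β y (reebLocal β y) * β y v = β y v := by
    rw [← reebOperator_apply, h.reebOperator_reebLocal]
  rw [h.apply_reebLocal] at hv
  linarith

/-- The two Reeb equations, unlike the operator, are visibly natural under coordinate changes; this
characterization is what makes the field independent of charts. -/
theorem IsContactAt.eq_reebLocal {β : E → E →L[ℝ] ℝ} {y : E} (h : IsContactAt β y) {u : E}
    (h1 : β y u = 1) (h2 : ∀ v, extDerivOne β y u v = 0) : u = reebLocal β y := by
  apply h.injective
  rw [h.reebOperator_reebLocal]
  ext v
  rw [reebOperator_apply, h1, h2]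
  simp

/-- Inversion of operators is smooth at invertible ones, and the operator depends smoothly on β and
its derivative. -/
theorem contDiffOn_reebLocal {β : E → E →L[ℝ] ℝ} {O : Set E} (hO : IsOpen O)
    (hβ : ContDiffOn ℝ ∞ β O) (h : ∀ y ∈ O, IsContactAt β y) :
    ContDiffOn ℝ ∞ (reebLocal β) O := by
  intro y hy
  have : CompleteSpace E := FiniteDimensional.complete ℝ E
  have hβy : ContDiffAt ℝ ∞ β y := hβ.contDiffAt (hO.mem_nhds hy)
  have hd : ContDiffAt ℝ ∞ (fderiv ℝ β) y := hβy.fderiv_right (by simp)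
  have hop : ContDiffAt ℝ ∞ (reebOperator β) y := by
    refine (hd.sub ?_).add ?_
    · exact (LinearIsometryEquiv.contDiff (F := E →L[ℝ] E →L[ℝ] ℝ)
        (ContinuousLinearMap.flipₗᵢ ℝ E E ℝ)).contDiffAt.comp y hd
    · exact hβy.smulRight hβy
  have hinv : ContDiffAt ℝ ∞ ContinuousLinearMap.inverse (reebOperator β y) := by
    rw [← (h y hy).coe_equiv]
    exact contDiffAt_map_inverse _
  exact ((hinv.comp y hop).clm_apply hβy).contDiffWithinAt

end Pencil

end ContactGeometry

namespace ContactGeometry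

variable {n : ℕ} {M : Type*} [TopologicalSpace M] [ChartedSpace (Model n) M]
  [IsManifold (𝓡 (2 * n + 1)) ∞ M]

theorem ContactForm.form_congr (α : ContactForm n M) {q q' : M} (hq : q = q') {v v' : Model n}
    (hv : v = v') : α.form q v = α.form q' v' := by
  subst hq hv; rfl

/-! ### The Reeb field of a contact form on a manifold -/

section Charts

variable {F F' : Type*} [NormedAddCommGroup F] [NormedSpace ℝ F]
  [NormedAddCommGroup F'] [NormedSpace ℝ F']

theorem pullParam_congr (α : ContactForm n M) {G G' : F → M} {y : F} (h : G =ᶠ[𝓝 y] G') :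
    pullParam α G y = pullParam α G' y := by
  ext w
  exact α.form_congr h.self_of_nhds (congrArg (fun T : F →L[ℝ] Model n => T w) h.mfderiv_eq)

theorem pullParam_comp (α : ContactForm n M) {G : F' → M} {τ : F → F'} {y : F}
    (hG : MDifferentiableAt 𝓘(ℝ, F') (𝓡 (2 * n + 1)) G (τ y)) (hτ : DifferentiableAt ℝ τ y) :
    pullParam α (G ∘ τ) y = (pullParam α G (τ y)).comp (fderiv ℝ τ y) := by
  unfold pullParam
  rw [mfderiv_comp y hG hτ.mdifferentiableAt, mfderiv_eq_fderiv]
  rfl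

/-- The transition map between the charts around `x` and `x'`. -/
def transition (x x' : M) : Model n → Model n :=
  extChartAt (𝓡 (2 * n + 1)) x' ∘ (extChartAt (𝓡 (2 * n + 1)) x).symm

theorem mdifferentiableAt_chart_symm {x : M} {y : Model n}
    (hy : y ∈ (extChartAt (𝓡 (2 * n + 1)) x).target) :
    MDifferentiableAt 𝓘(ℝ, Model n) (𝓡 (2 * n + 1)) (extChartAt (𝓡 (2 * n + 1)) x).symm y :=
  ((contMDiffOn_extChartAt_symm (n := ∞) x).contMDiffAt
    ((isOpen_extChartAt_target x).mem_nhds hy)).mdifferentiableAt (by simp)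

theorem mdifferentiableAt_chart {x q : M} (hq : q ∈ (extChartAt (𝓡 (2 * n + 1)) x).source) :
    MDifferentiableAt (𝓡 (2 * n + 1)) 𝓘(ℝ, Model n) (extChartAt (𝓡 (2 * n + 1)) x) q :=
  mdifferentiableAt_extChartAt (by rwa [extChartAt_source] at hq)

theorem contDiffAt_transition {x x' : M} {y : Model n}
    (hy : y ∈ (extChartAt (𝓡 (2 * n + 1)) x).target)
    (hy' : (extChartAt (𝓡 (2 * n + 1)) x).symm y ∈ (extChartAt (𝓡 (2 * n + 1)) x').source) :
    ContDiffAt ℝ ∞ (transition x x') y := by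
  rw [← contMDiffAt_iff_contDiffAt]
  refine ContMDiffAt.comp (I' := 𝓡 (2 * n + 1)) y ?_ ?_
  · exact contMDiffAt_extChartAt' (by rwa [extChartAt_source] at hy')
  · exact (contMDiffOn_extChartAt_symm (n := ∞) x).contMDiffAt
      ((isOpen_extChartAt_target x).mem_nhds hy)

theorem chart_symm_eventuallyEq {N : Type*} [TopologicalSpace N] [ChartedSpace (Model n) N]
    {x x' : N} {y : Model n}
    (hy : y ∈ (extChartAt (𝓡 (2 * n + 1)) x).target)
    (hy' : (extChartAt (𝓡 (2 * n + 1)) x).symm y ∈ (extChartAt (𝓡 (2 * n + 1)) x').source) :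
    ∀ᶠ z in 𝓝 y, z ∈ (extChartAt (𝓡 (2 * n + 1)) x).target ∧
      (extChartAt (𝓡 (2 * n + 1)) x).symm z ∈ (extChartAt (𝓡 (2 * n + 1)) x').source := by
  refine Filter.Eventually.and ((isOpen_extChartAt_target x).mem_nhds hy) ?_
  exact ((continuousOn_extChartAt_symm x).continuousAt
    ((isOpen_extChartAt_target x).mem_nhds hy)).preimage_mem_nhds
      ((isOpen_extChartAt_source x').mem_nhds hy')

theorem chart_symm_eq_comp_transition {N : Type*} [TopologicalSpace N]
    [ChartedSpace (Model n) N] {x x' : N} {y : Model n}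
    (hy : y ∈ (extChartAt (𝓡 (2 * n + 1)) x).target)
    (hy' : (extChartAt (𝓡 (2 * n + 1)) x).symm y ∈ (extChartAt (𝓡 (2 * n + 1)) x').source) :
    (extChartAt (𝓡 (2 * n + 1)) x).symm =ᶠ[𝓝 y]
      (extChartAt (𝓡 (2 * n + 1)) x').symm ∘ transition x x' := by
  filter_upwards [chart_symm_eventuallyEq hy hy'] with z hz
  exact ((extChartAt (𝓡 (2 * n + 1)) x').left_inv hz.2).symm

theorem formInChart_transition (α : ContactForm n M) {x x' : M} {y : Model n}
    (hy : y ∈ (extChartAt (𝓡 (2 * n + 1)) x).target)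
    (hy' : (extChartAt (𝓡 (2 * n + 1)) x).symm y ∈ (extChartAt (𝓡 (2 * n + 1)) x').source) :
    formInChart α.form x =ᶠ[𝓝 y] fun z =>
      (formInChart α.form x' (transition x x' z)).comp (fderiv ℝ (transition x x') z) := by
  filter_upwards [chart_symm_eventuallyEq hy hy'] with z hz
  have h1 := pullParam_congr α (chart_symm_eq_comp_transition hz.1 hz.2)
  rw [pullParam_comp α] at h1
  · exact h1
  · exact mdifferentiableAt_chart_symm ((extChartAt (𝓡 (2 * n + 1)) x').map_source hz.2)
  · exact (contDiffAt_transition hz.1 hz.2).differentiableAt (by simp)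

theorem fderiv_transition {x x' : M} {y : Model n}
    (hy : y ∈ (extChartAt (𝓡 (2 * n + 1)) x).target)
    (hy' : (extChartAt (𝓡 (2 * n + 1)) x).symm y ∈ (extChartAt (𝓡 (2 * n + 1)) x').source)
    (u : Model n) :
    fderiv ℝ (transition x x') y u =
      mfderiv (𝓡 (2 * n + 1)) 𝓘(ℝ, Model n) (extChartAt (𝓡 (2 * n + 1)) x')
        ((extChartAt (𝓡 (2 * n + 1)) x).symm y)
        (mfderiv 𝓘(ℝ, Model n) (𝓡 (2 * n + 1)) (extChartAt (𝓡 (2 * n + 1)) x).symm y u) := by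
  have h := mfderiv_comp y (mdifferentiableAt_chart hy') (mdifferentiableAt_chart_symm hy)
  rw [← mfderiv_eq_fderiv]
  exact DFunLike.congr_fun h u

/-- Nondegeneracy is stated at each point in the chart around that very point; naturality of the
exterior derivative carries it to every other chart. -/
theorem extDerivOne_transition (α : ContactForm n M) {x x' : M} {y : Model n}
    (hy : y ∈ (extChartAt (𝓡 (2 * n + 1)) x).target)
    (hy' : (extChartAt (𝓡 (2 * n + 1)) x).symm y ∈ (extChartAt (𝓡 (2 * n + 1)) x').source)
    (u v : Model n) :
    extDerivOne (formInChart α.form x) y u v =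
      extDerivOne (formInChart α.form x') (transition x x' y)
        (fderiv ℝ (transition x x') y u) (fderiv ℝ (transition x x') y v) := by
  have h1 : transition x x' y ∈ (extChartAt (𝓡 (2 * n + 1)) x').target :=
    (extChartAt (𝓡 (2 * n + 1)) x').map_source hy'
  refine extDerivOne_pullback ?_ ((contDiffAt_transition hy hy').of_le (by norm_cast))
    (formInChart_transition α hy hy') u v
  exact ((contDiffOn_formInChart α x').contDiffAt
    ((isOpen_extChartAt_target x').mem_nhds h1)).differentiableAt (by simp)

theorem mfderiv_chart_symm_chart {x : M} {y : Model n}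
    (hy : y ∈ (extChartAt (𝓡 (2 * n + 1)) x).target) (u : Model n) :
    mfderiv (𝓡 (2 * n + 1)) 𝓘(ℝ, Model n) (extChartAt (𝓡 (2 * n + 1)) x)
        ((extChartAt (𝓡 (2 * n + 1)) x).symm y)
        (mfderiv 𝓘(ℝ, Model n) (𝓡 (2 * n + 1)) (extChartAt (𝓡 (2 * n + 1)) x).symm y u) = u := by
  have h5 := mfderiv_extChartAt_comp_mfderivWithin_extChartAt_symm (I := 𝓡 (2 * n + 1)) hy
  rw [ModelWithCorners.range_eq_univ, mfderivWithin_univ] at h5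
  exact DFunLike.congr_fun h5 u

theorem mfderiv_chart_chart_symm {x q : M} (hq : q ∈ (extChartAt (𝓡 (2 * n + 1)) x).source)
    (u : TangentSpace (𝓡 (2 * n + 1)) q) :
    mfderiv 𝓘(ℝ, Model n) (𝓡 (2 * n + 1)) (extChartAt (𝓡 (2 * n + 1)) x).symm
        (extChartAt (𝓡 (2 * n + 1)) x q)
        (mfderiv (𝓡 (2 * n + 1)) 𝓘(ℝ, Model n) (extChartAt (𝓡 (2 * n + 1)) x) q u) = u := by
  have h5 := mfderivWithin_extChartAt_symm_comp_mfderiv_extChartAt' (I := 𝓡 (2 * n + 1)) hq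
  rw [ModelWithCorners.range_eq_univ, mfderivWithin_univ] at h5
  exact DFunLike.congr_fun h5 u

theorem formInChart_apply_mfderiv (α : ContactForm n M) {x q : M}
    (hq : q ∈ (extChartAt (𝓡 (2 * n + 1)) x).source) (u : TangentSpace (𝓡 (2 * n + 1)) q) :
    formInChart α.form x (extChartAt (𝓡 (2 * n + 1)) x q)
      (mfderiv (𝓡 (2 * n + 1)) 𝓘(ℝ, Model n) (extChartAt (𝓡 (2 * n + 1)) x) q u) =
        α.form q u :=
  α.form_congr ((extChartAt (𝓡 (2 * n + 1)) x).left_inv hq) (mfderiv_chart_chart_symm hq u)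

/-- A contact form satisfies the contact condition in every chart. -/
theorem isContactAt_formInChart (α : ContactForm n M) {x : M} {y : Model n}
    (hy : y ∈ (extChartAt (𝓡 (2 * n + 1)) x).target) : IsContactAt (formInChart α.form x) y := by
  set q := (extChartAt (𝓡 (2 * n + 1)) x).symm y with hq
  have hqs : q ∈ (extChartAt (𝓡 (2 * n + 1)) x).source :=
    (extChartAt (𝓡 (2 * n + 1)) x).map_target hy
  have hyq : extChartAt (𝓡 (2 * n + 1)) x q = y := (extChartAt (𝓡 (2 * n + 1)) x).right_inv hy
  have hqq : (extChartAt (𝓡 (2 * n + 1)) x).symm y ∈ (extChartAt (𝓡 (2 * n + 1)) q).source :=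
    mem_extChartAt_source q
  have hform : ∀ u : TangentSpace (𝓡 (2 * n + 1)) q, formInChart α.form x y
      (mfderiv (𝓡 (2 * n + 1)) 𝓘(ℝ, Model n) (extChartAt (𝓡 (2 * n + 1)) x) q u) =
        α.form q u := fun u => by
    have := formInChart_apply_mfderiv α hqs u
    rwa [hyq] at this
  refine ⟨fun h0 => α.ne_zero q ?_, fun u hu hd => ?_⟩
  · ext u
    rw [← hform u, h0]; rfl
  · set u' : TangentSpace (𝓡 (2 * n + 1)) q :=
      mfderiv 𝓘(ℝ, Model n) (𝓡 (2 * n + 1)) (extChartAt (𝓡 (2 * n + 1)) x).symm y u with hu'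
    have hz : u' = 0 := by
      refine α.nondegenerate q u' hu fun v hv => ?_
      set v' : Model n :=
        mfderiv (𝓡 (2 * n + 1)) 𝓘(ℝ, Model n) (extChartAt (𝓡 (2 * n + 1)) x) q v with hv'
      have h1 := hd v' ((hform v).trans hv)
      have h2 : mfderiv 𝓘(ℝ, Model n) (𝓡 (2 * n + 1)) (extChartAt (𝓡 (2 * n + 1)) x).symm y v' =
          v := by
        have := mfderiv_chart_chart_symm hqs v
        rwa [hyq] at this
      rw [extDerivOne_transition α hy hqq, fderiv_transition hy hqq, fderiv_transition hy hqq,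
        h2] at h1
      exact h1
    have h3 := mfderiv_chart_symm_chart hy u
    rw [← hu', hz] at h3
    exact h3.symm.trans (ContinuousLinearMap.map_zero _)

/-- The Reeb vector field of a contact form. -/
def reeb (α : ContactForm n M) (q : M) : TangentSpace (𝓡 (2 * n + 1)) q :=
  mfderiv 𝓘(ℝ, Model n) (𝓡 (2 * n + 1)) (extChartAt (𝓡 (2 * n + 1)) q).symm
    (extChartAt (𝓡 (2 * n + 1)) q q)
    (reebLocal (E := Model n) (formInChart α.form q) (extChartAt (𝓡 (2 * n + 1)) q q))

/-- `reeb` uses a different chart at every point, so its smoothness is not apparent. Its expression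
in a fixed chart still solves the two Reeb equations, since both are natural under transition maps,
and their solution is unique. -/
theorem fieldInChart_reeb (α : ContactForm n M) {x : M} {y : Model n}
    (hy : y ∈ (extChartAt (𝓡 (2 * n + 1)) x).target) :
    SmoothFlow.fieldInChart (reeb α) x y = reebLocal (formInChart α.form x) y := by
  set q := (extChartAt (𝓡 (2 * n + 1)) x).symm y with hq
  have hqs : q ∈ (extChartAt (𝓡 (2 * n + 1)) x).source :=
    (extChartAt (𝓡 (2 * n + 1)) x).map_target hy
  have hyq : extChartAt (𝓡 (2 * n + 1)) x q = y := (extChartAt (𝓡 (2 * n + 1)) x).right_inv hy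
  have hqq : (extChartAt (𝓡 (2 * n + 1)) x).symm y ∈ (extChartAt (𝓡 (2 * n + 1)) q).source :=
    mem_extChartAt_source q
  set y' := extChartAt (𝓡 (2 * n + 1)) q q with hy'
  have hyt : y' ∈ (extChartAt (𝓡 (2 * n + 1)) q).target := mem_extChartAt_target q
  have hc := isContactAt_formInChart α hyt
  have hτy : transition x q y = y' := rfl
  set R := reebLocal (formInChart α.form q) y' with hR
  have hDR : mfderiv (𝓡 (2 * n + 1)) 𝓘(ℝ, Model n) (extChartAt (𝓡 (2 * n + 1)) q) q (reeb α q) =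
      R := by
    have h1 := mfderiv_chart_symm_chart hyt R
    have h2 : (extChartAt (𝓡 (2 * n + 1)) q).symm y' = q := extChartAt_to_inv q
    let w : Model n :=
      mfderiv 𝓘(ℝ, Model n) (𝓡 (2 * n + 1)) (extChartAt (𝓡 (2 * n + 1)) q).symm y' R
    have h3 := congrArg (fun p => (mfderiv (𝓡 (2 * n + 1)) 𝓘(ℝ, Model n)
      (extChartAt (𝓡 (2 * n + 1)) q) p : Model n →L[ℝ] Model n) w) h2
    exact h3.symm.trans h1
  have hτR : fderiv ℝ (transition x q) y (SmoothFlow.fieldInChart (reeb α) x y) = R := by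
    rw [fderiv_transition hy hqq, ← hDR]
    have := mfderiv_chart_chart_symm hqs (reeb α q)
    rw [hyq] at this
    exact congrArg _ this
  refine (isContactAt_formInChart α hy).eq_reebLocal ?_ fun v => ?_
  · have h1 := (formInChart_transition α hy hqq).self_of_nhds
    rw [h1, ContinuousLinearMap.comp_apply, hτR, hτy, hR]
    exact hc.apply_reebLocal
  · rw [extDerivOne_transition α hy hqq, hτR, hτy]
    exact hc.extDerivOne_reebLocal _

theorem contDiffOn_fieldInChart_reeb (α : ContactForm n M) (x : M) :
    ContDiffOn ℝ ∞ (SmoothFlow.fieldInChart (reeb α) x) (extChartAt (𝓡 (2 * n + 1)) x).target :=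
  (contDiffOn_reebLocal (isOpen_extChartAt_target x) (contDiffOn_formInChart α x)
    fun _ hy => isContactAt_formInChart α hy).congr fun _ hy => fieldInChart_reeb α hy

theorem form_reeb (α : ContactForm n M) (q : M) : α.form q (reeb α q) = 1 := by
  have h := formInChart_apply_mfderiv α (mem_extChartAt_source (I := 𝓡 (2 * n + 1)) q) (reeb α q)
  have h2 := fieldInChart_reeb α (mem_extChartAt_target (I := 𝓡 (2 * n + 1)) q)
  rw [← h, ← (isContactAt_formInChart α
    (mem_extChartAt_target (I := 𝓡 (2 * n + 1)) q)).apply_reebLocal, ← h2,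
    SmoothFlow.fieldInChart, extChartAt_to_inv]

end Charts

end ContactGeometry

namespace ContactGeometry

/-! ### Lie derivatives along flows; the Reeb flow -/

section LieDerivative

variable {E : Type*} [NormedAddCommGroup E] [NormedSpace ℝ E]

/-- The derivative at time `0` of the pull-backs of a 1-form under a flow is its Lie derivative. -/
theorem hasDerivAt_pullback_flow {Ψ : ℝ × E → E} {y : E} (hΨ : ContDiffAt ℝ 2 Ψ (0, y))
    {β : E → E →L[ℝ] ℝ} (hβ : DifferentiableAt ℝ β y) {X : E → E}
    (h0 : ∀ᶠ z in 𝓝 y, Ψ (0, z) = z)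
    (hX : ∀ᶠ z in 𝓝 y, HasDerivAt (fun τ => Ψ (τ, z)) (X z) 0) (v : E) :
    HasDerivAt (fun τ => β (Ψ (τ, y)) (fderiv ℝ (fun z => Ψ (τ, z)) y v))
      (fderiv ℝ β y (X y) v + β y (fderiv ℝ X y v)) 0 := by
  have hev : ∀ᶠ p in 𝓝 ((0 : ℝ), y), DifferentiableAt ℝ Ψ p :=
    (hΨ.eventually (by simp)).mono fun p hp => hp.differentiableAt (by simp)
  have hd2 : DifferentiableAt ℝ (fderiv ℝ Ψ) (0, y) :=
    (hΨ.fderiv_right (m := 1) (by norm_num)).differentiableAt (by simp)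
  have hsymm : IsSymmSndFDerivAt ℝ Ψ (0, y) := hΨ.isSymmSndFDerivAt (by simp)
  have hc1 : ContinuousAt (fun τ : ℝ => (τ, y)) 0 := by fun_prop
  have hc2 : ContinuousAt (fun z : E => ((0 : ℝ), z)) y := by fun_prop
  have hi1 : ∀ τ : ℝ, HasFDerivAt (fun z : E => (τ, z)) (ContinuousLinearMap.inr ℝ ℝ E) y :=
    fun τ => hasFDerivAt_prodMk_right τ y
  have hi2 : ∀ z : E, HasDerivAt (fun τ : ℝ => (τ, z)) ((1 : ℝ), (0 : E)) 0 :=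
    fun z => (hasDerivAt_id (0 : ℝ)).prodMk (hasDerivAt_const 0 z)
  have hXe : X =ᶠ[𝓝 y] fun z => fderiv ℝ Ψ (0, z) (1, 0) := by
    filter_upwards [hX, hc2.eventually hev] with z hz hz'
    exact hz.unique (hz'.hasFDerivAt.comp_hasDerivAt (0 : ℝ) (hi2 z))
  have hpart : (fun τ => β (Ψ (τ, y)) (fderiv ℝ (fun z => Ψ (τ, z)) y v)) =ᶠ[𝓝 0]
      fun τ => β (Ψ (τ, y)) (fderiv ℝ Ψ (τ, y) (0, v)) := by
    filter_upwards [hc1.eventually hev] with τ hτ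
    have : HasFDerivAt (fun z => Ψ (τ, z)) ((fderiv ℝ Ψ (τ, y)).comp
        (ContinuousLinearMap.inr ℝ ℝ E)) y := hτ.hasFDerivAt.comp y (hi1 τ)
    rw [this.fderiv]; rfl
  refine HasDerivAt.congr_of_eventuallyEq ?_ hpart
  have hΨ0 : Ψ (0, y) = y := h0.self_of_nhds
  have hv : fderiv ℝ Ψ (0, y) (0, v) = v := by
    have h1 : HasFDerivAt (fun z => Ψ (0, z)) ((fderiv ℝ Ψ (0, y)).comp
        (ContinuousLinearMap.inr ℝ ℝ E)) y :=
      HasFDerivAt.comp (g := Ψ) (f := fun z : E => ((0 : ℝ), z)) y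
        hev.self_of_nhds.hasFDerivAt (hi1 0)
    have h2 : HasFDerivAt (fun z => Ψ (0, z)) (ContinuousLinearMap.id ℝ E) y :=
      (hasFDerivAt_id y).congr_of_eventuallyEq h0
    have := DFunLike.congr_fun (h1.unique h2) v
    simpa using this
  have hg : HasDerivAt (fun τ => fderiv ℝ Ψ (τ, y) (0, v)) (fderiv ℝ X y v) 0 := by
    have h1 : HasDerivAt (fun τ => fderiv ℝ Ψ (τ, y)) (fderiv ℝ (fderiv ℝ Ψ) (0, y) (1, 0)) 0 :=
      HasFDerivAt.comp_hasDerivAt (l := fderiv ℝ Ψ) (f := fun τ : ℝ => (τ, y)) (0 : ℝ)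
        hd2.hasFDerivAt (hi2 y)
    have h2 : HasFDerivAt (fun z => fderiv ℝ Ψ (0, z)) ((fderiv ℝ (fderiv ℝ Ψ) (0, y)).comp
        (ContinuousLinearMap.inr ℝ ℝ E)) y :=
      HasFDerivAt.comp (g := fderiv ℝ Ψ) (f := fun z : E => ((0 : ℝ), z)) y
        hd2.hasFDerivAt (hi1 0)
    -- Symmetry of the second derivative: the time derivative of the spatial derivative of the flow
    -- is the spatial derivative of the vector field.
    have h3 : fderiv ℝ X y v = fderiv ℝ (fderiv ℝ Ψ) (0, y) (1, 0) (0, v) := by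
      rw [hXe.fderiv_eq, (h2.clm_apply (hasFDerivAt_const _ _)).fderiv, hsymm (1, 0) (0, v)]
      simp
    rw [h3]
    simpa using h1.clm_apply (hasDerivAt_const (0 : ℝ) ((0 : ℝ), v))
  have hcβ : HasDerivAt (fun τ => β (Ψ (τ, y))) (fderiv ℝ β y (X y)) 0 := by
    have hβ' : HasFDerivAt β (fderiv ℝ β y) (Ψ (0, y)) := by rw [hΨ0]; exact hβ.hasFDerivAt
    exact HasFDerivAt.comp_hasDerivAt (l := β) (f := fun τ : ℝ => Ψ (τ, y)) (0 : ℝ) hβ'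
      hX.self_of_nhds
  have := hcβ.clm_apply hg
  rw [hv, hΨ0] at this
  exact this

end LieDerivative

variable {n : ℕ} {M : Type*} [TopologicalSpace M] [ChartedSpace (Model n) M]
  [IsManifold (𝓡 (2 * n + 1)) ∞ M]

/-- A smooth one-parameter group of contactomorphisms with compact support. -/
structure ContactFlow (α : ContactForm n M) where
  /-- the contactomorphism at time `s` -/
  toFun : ℝ → Equiv.Perm M
  map_zero : toFun 0 = 1
  map_add : ∀ s t, toFun (s + t) = toFun s * toFun t
  smooth : ContMDiff (𝓘(ℝ, ℝ).prod (𝓡 (2 * n + 1))) (𝓡 (2 * n + 1)) ∞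
    (fun p : ℝ × M => toFun p.1 p.2)
  scales : ∀ s q, ∃ c, ScalesAt α (toFun s) q c
  compact : ∃ K : Set M, IsCompact K ∧ ∀ s, ∀ q ∉ K, toFun s q = q

/-- A one-parameter family of self-maps satisfying the group law consists of bijections. -/
def permOfFlow {N : Type*} (ψ : ℝ → N → N) (h0 : ∀ q, ψ 0 q = q)
    (hadd : ∀ s t q, ψ (s + t) q = ψ s (ψ t q)) (s : ℝ) : Equiv.Perm N where
  toFun := ψ s
  invFun := ψ (-s)
  left_inv q := by rw [← hadd, neg_add_cancel, h0]
  right_inv q := by rw [← hadd, add_neg_cancel, h0]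

/-- The Lie derivative of a contact form along its Reeb field vanishes. -/
theorem hasDerivAt_pullForm_reeb (α : ContactForm n M) {ψ : ℝ → M → M} (h0 : ∀ q, ψ 0 q = q)
    (hψ : ContMDiff (𝓘(ℝ, ℝ).prod (𝓡 (2 * n + 1))) (𝓡 (2 * n + 1)) ∞
      (fun p : ℝ × M => ψ p.1 p.2))
    (hint : ∀ q, IsMIntegralCurve (fun s => ψ s q) (reeb α)) (q : M)
    (v : TangentSpace (𝓡 (2 * n + 1)) q) :
    HasDerivAt (fun τ => pullForm α (ψ τ) q v) 0 0 := by
  set φ := extChartAt (𝓡 (2 * n + 1)) q with hφ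
  set y : Model n := φ q with hy
  have hyt : y ∈ φ.target := mem_extChartAt_target q
  have hq : φ.symm y = q := extChartAt_to_inv q
  set β := formInChart α.form q with hβ
  set Ψ : ℝ × Model n → Model n := fun p => φ (ψ p.1 (φ.symm p.2)) with hΨ
  set v' : Model n := mfderiv (𝓡 (2 * n + 1)) 𝓘(ℝ, Model n) φ q v with hv'
  have hslice : ∀ τ, ContMDiff (𝓡 (2 * n + 1)) (𝓡 (2 * n + 1)) ∞ (ψ τ) := fun τ =>
    hψ.comp (contMDiff_const.prodMk contMDiff_id)
  have hsymm : ContMDiffAt 𝓘(ℝ, Model n) (𝓡 (2 * n + 1)) ∞ φ.symm y :=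
    (contMDiffOn_extChartAt_symm (n := ∞) q).contMDiffAt ((isOpen_extChartAt_target q).mem_nhds hyt)
  have hψφ : ContMDiffAt 𝓘(ℝ, ℝ × Model n) (𝓡 (2 * n + 1)) ∞
      (fun p : ℝ × Model n => ψ p.1 (φ.symm p.2)) ((0 : ℝ), y) := by
    have hfst : ContMDiffAt 𝓘(ℝ, ℝ × Model n) 𝓘(ℝ, ℝ) ∞ (Prod.fst : ℝ × Model n → ℝ)
      ((0 : ℝ), y) := contDiff_fst.contMDiff.contMDiffAt
    have hsnd : ContMDiffAt 𝓘(ℝ, ℝ × Model n) 𝓘(ℝ, Model n) ∞ (Prod.snd : ℝ × Model n → Model n)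
      ((0 : ℝ), y) := contDiff_snd.contMDiff.contMDiffAt
    have hin : ContMDiffAt 𝓘(ℝ, ℝ × Model n) (𝓘(ℝ, ℝ).prod (𝓡 (2 * n + 1))) ∞
        (fun p : ℝ × Model n => (p.1, φ.symm p.2)) ((0 : ℝ), y) :=
      hfst.prodMk (ContMDiffAt.comp (g := φ.symm) ((0 : ℝ), y) hsymm hsnd)
    exact ContMDiffAt.comp (g := fun p : ℝ × M => ψ p.1 p.2) ((0 : ℝ), y) hψ.contMDiffAt hin
  have hΨs : ContDiffAt ℝ ∞ Ψ (0, y) := by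
    rw [← contMDiffAt_iff_contDiffAt]
    refine ContMDiffAt.comp (I' := 𝓡 (2 * n + 1)) (0, y) ?_ hψφ
    simp only [hq, h0]
    exact contMDiffAt_extChartAt
  have hβd : ContDiffAt ℝ ∞ β y :=
    (contDiffOn_formInChart α q).contDiffAt ((isOpen_extChartAt_target q).mem_nhds hyt)
  have hRd : ContDiffAt ℝ ∞ (reebLocal β) y :=
    (contDiffOn_reebLocal (isOpen_extChartAt_target q) (contDiffOn_formInChart α q)
      fun _ hy => isContactAt_formInChart α hy).contDiffAt
        ((isOpen_extChartAt_target q).mem_nhds hyt)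
  have hnt : ∀ᶠ z in 𝓝 y, z ∈ φ.target := (isOpen_extChartAt_target q).mem_nhds hyt
  have hΨ0 : ∀ᶠ z in 𝓝 y, Ψ (0, z) = z := by
    filter_upwards [hnt] with z hz
    simp only [hΨ, h0]
    exact φ.right_inv hz
  have hX : ∀ᶠ z in 𝓝 y, HasDerivAt (fun τ => Ψ (τ, z)) (reebLocal β z) 0 := by
    filter_upwards [hnt] with z hz
    have h1 := hint (φ.symm z) 0
    have hz' : ψ 0 (φ.symm z) ∈ φ.source := by rw [h0]; exact φ.map_target hz
    have h2 := HasMFDerivAt.comp (0 : ℝ) (mdifferentiableAt_chart hz').hasMFDerivAt h1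
    have h4 : HasDerivAt (fun τ => Ψ (τ, z)) _ 0 :=
      HasFDerivAt.hasDerivAt (F := Model n) (h2.hasFDerivAt : HasFDerivAt (E := ℝ) (F := Model n)
        (fun τ => Ψ (τ, z)) _ 0)
    refine h4.congr_deriv ?_
    rw [← fieldInChart_reeb α hz]
    refine (congrArg _ (one_smul ℝ (reeb α (ψ 0 (φ.symm z))))).trans ?_
    have h5 := congrArg (fun p => (mfderiv (𝓡 (2 * n + 1)) 𝓘(ℝ, Model n) φ p
      (reeb α p) : Model n)) (h0 (φ.symm z))
    exact h5
  have key := hasDerivAt_pullback_flow (hΨs.of_le (by norm_cast)) (hβd.differentiableAt (by simp))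
    hΨ0 hX v'
  -- Cartan's formula in disguise: differentiate β(R) = 1 in the direction v' and use dβ(R, v') = 0
  -- to exchange the two arguments.
  have hval : fderiv ℝ β y (reebLocal β y) v' + β y (fderiv ℝ (reebLocal β) y v') = 0 := by
    have h1 : (fun z => β z (reebLocal β z)) =ᶠ[𝓝 y] fun _ => 1 := by
      filter_upwards [hnt] with z hz
      exact (isContactAt_formInChart α hz).apply_reebLocal
    have h2 : fderiv ℝ (fun z => β z (reebLocal β z)) y v' = 0 := by
      rw [h1.fderiv_eq]; simp
    rw [((hβd.differentiableAt (by simp)).hasFDerivAt.clm_apply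
      (hRd.differentiableAt (by simp)).hasFDerivAt).fderiv] at h2
    have h3 := (isContactAt_formInChart α hyt).extDerivOne_reebLocal v'
    rw [extDerivOne_apply] at h3
    simp only [_root_.add_apply, ContinuousLinearMap.comp_apply,
      ContinuousLinearMap.flip_apply] at h2
    linarith
  rw [hval] at key
  refine key.congr_of_eventuallyEq ?_
  have hsrc : ∀ᶠ τ in 𝓝 (0 : ℝ), ψ τ q ∈ φ.source := by
    have hc : Continuous fun τ => ψ τ q :=
      hψ.continuous.comp (Continuous.prodMk_left q)
    refine hc.continuousAt.eventually ((isOpen_extChartAt_source q).mem_nhds ?_)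
    show ψ 0 q ∈ _
    rw [h0]; exact mem_extChartAt_source q
  filter_upwards [hsrc] with τ hτ
  have hgerm : ψ τ ∘ φ.symm =ᶠ[𝓝 y] φ.symm ∘ fun z => Ψ (τ, z) := by
    have hc : ContinuousAt (fun z => ψ τ (φ.symm z)) y :=
      ((hslice τ).continuous.continuousAt).comp hsymm.continuousAt
    have : ∀ᶠ z in 𝓝 y, ψ τ (φ.symm z) ∈ φ.source := by
      refine hc.eventually ((isOpen_extChartAt_source q).mem_nhds ?_)
      show ψ τ (φ.symm y) ∈ _
      rw [hq]; exact hτ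
    filter_upwards [this] with z hz
    exact (φ.left_inv hz).symm
  have hΨτ : DifferentiableAt ℝ (fun z => Ψ (τ, z)) y := by
    have : ContMDiffAt 𝓘(ℝ, Model n) 𝓘(ℝ, Model n) ∞ (fun z => Ψ (τ, z)) y := by
      refine ContMDiffAt.comp (I' := 𝓡 (2 * n + 1)) y ?_
        (((hslice τ).contMDiffAt).comp y hsymm)
      refine contMDiffAt_extChartAt' ?_
      rw [← extChartAt_source (𝓡 (2 * n + 1))]
      show ψ τ (φ.symm y) ∈ _
      rw [hq]; exact hτ
    exact this.contDiffAt.differentiableAt (by simp)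
  have h1 := pullParam_congr α hgerm
  rw [pullParam_comp α (G := φ.symm) (τ := fun z => Ψ (τ, z)) (y := y) (mdifferentiableAt_chart_symm (φ.map_source (by rw [hq]; exact hτ)))
    hΨτ] at h1
  have h2 := DFunLike.congr_fun h1 v'
  refine Eq.trans ?_ h2
  have hd : mfderiv 𝓘(ℝ, Model n) (𝓡 (2 * n + 1)) (ψ τ ∘ φ.symm) y =
      (mfderiv (𝓡 (2 * n + 1)) (𝓡 (2 * n + 1)) (ψ τ) (φ.symm y)).comp
        (mfderiv 𝓘(ℝ, Model n) (𝓡 (2 * n + 1)) φ.symm y) :=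
    mfderiv_comp y ((hslice τ).mdifferentiableAt (by simp)) (mdifferentiableAt_chart_symm hyt)
  refine α.form_congr (congrArg (ψ τ) hq.symm) ?_
  have h3 : mfderiv 𝓘(ℝ, Model n) (𝓡 (2 * n + 1)) φ.symm y v' = v :=
    mfderiv_chart_chart_symm (mem_extChartAt_source q) v
  have h4 := DFunLike.congr_fun hd v'
  refine Eq.trans ?_ h4.symm
  refine Eq.trans ?_ (congrArg (mfderiv (𝓡 (2 * n + 1)) (𝓡 (2 * n + 1)) (ψ τ) (φ.symm y)) h3).symm
  exact congrArg (fun p => (mfderiv (𝓡 (2 * n + 1)) (𝓡 (2 * n + 1)) (ψ τ) p :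
    Model n →L[ℝ] Model n) v) hq.symm

/-- If the derivative at time `0` of the pull-backs of `α` vanishes at all points, then the flow
preserves `α`. -/
theorem pullForm_eq_of_hasDerivAt (α : ContactForm n M) {ψ : ℝ → M → M} (h0 : ∀ q, ψ 0 q = q)
    (hadd : ∀ s t q, ψ (s + t) q = ψ s (ψ t q))
    (hslice : ∀ τ, ContMDiff (𝓡 (2 * n + 1)) (𝓡 (2 * n + 1)) ∞ (ψ τ))
    (hder : ∀ q v, HasDerivAt (fun τ => pullForm α (ψ τ) q v) 0 0) (s : ℝ) (q : M)
    (v : TangentSpace (𝓡 (2 * n + 1)) q) : pullForm α (ψ s) q v = α.form q v := by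
  -- By the group law, the derivative at time s is the derivative at time 0 at the point ψ_s(q),
  -- applied to the pushed-forward vector.
  have hd : ∀ s, HasDerivAt (fun τ => pullForm α (ψ τ) q v) 0 s := by
    intro s
    have h1 := hder (ψ s q) (mfderiv (𝓡 (2 * n + 1)) (𝓡 (2 * n + 1)) (ψ s) q v)
    have h2 : (fun τ => pullForm α (ψ τ) (ψ s q)
        (mfderiv (𝓡 (2 * n + 1)) (𝓡 (2 * n + 1)) (ψ s) q v)) =
        fun τ => pullForm α (ψ (τ + s)) q v := by
      funext τ
      have e : ψ (τ + s) = ψ τ ∘ ψ s := funext fun q => hadd τ s q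
      rw [e, pullForm_comp α ((hslice τ).mdifferentiableAt (by simp))
        ((hslice s).mdifferentiableAt (by simp))]
    rw [h2] at h1
    have h3 := HasDerivAt.comp_sub_const (f := fun τ => pullForm α (ψ (τ + s)) q v) (x := s)
      (a := s) (f' := 0) (by rwa [sub_self])
    simpa using h3
  have hconst := is_const_of_deriv_eq_zero (f := fun τ => pullForm α (ψ τ) q v)
    (fun s => (hd s).differentiableAt) (fun s => (hd s).deriv) s 0
  have e0 : ψ 0 = id := funext h0
  have h1 : pullForm α (ψ 0) q v = α.form q v := by
    rw [e0, pullForm, mfderiv_id]; rfl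
  exact hconst.trans h1

/-- The Reeb flow of a contact form on a closed manifold. -/
theorem exists_reebFlow [T2Space M] [CompactSpace M] (α : ContactForm n M) :
    ∃ Ψ : ContactFlow α, ∀ q, IsMIntegralCurve (fun s => Ψ.toFun s q) (reeb α) := by
  obtain ⟨ψ, h0, hadd, hsm, hint, -⟩ := SmoothFlow.exists_smooth_globalFlow
    (contDiffOn_fieldInChart_reeb α) isCompact_univ (fun q hq => (hq (mem_univ q)).elim)
  have hslice : ∀ τ, ContMDiff (𝓡 (2 * n + 1)) (𝓡 (2 * n + 1)) ∞ (ψ τ) := fun τ =>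
    hsm.comp (contMDiff_const.prodMk contMDiff_id)
  refine ⟨⟨permOfFlow ψ h0 hadd, Equiv.ext h0, fun s t => Equiv.ext fun q => hadd s t q, hsm,
    fun s q => ⟨0, fun v => ?_⟩, univ, isCompact_univ, fun s q hq => (hq (mem_univ q)).elim⟩, hint⟩
  rw [Real.exp_zero, one_mul]
  exact pullForm_eq_of_hasDerivAt α h0 hadd hslice (hasDerivAt_pullForm_reeb α h0 hsm hint) s q v

end ContactGeometry

/-! ### Contact Hamiltonians on the standard contact space -/

namespace ContactGeometry

variable {n : ℕ}

/-- The index of the last coordinate of the standard contact space. -/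
abbrev zIdx (n : ℕ) : Fin n ⊕ Fin n ⊕ Unit := Sum.inr (Sum.inr ())

/-- The coordinate functions on the standard contact space. -/
abbrev coord (j : Fin n ⊕ Fin n ⊕ Unit) : StdSpace n →L[ℝ] ℝ := EuclideanSpace.proj j

/-- The linear part of the standard contact form, as a bilinear form. -/
def stdBilin (n : ℕ) : StdSpace n →L[ℝ] StdSpace n →L[ℝ] ℝ :=
  (1 / 2 : ℝ) • ∑ i : Fin n, ((coord (Sum.inl i)).smulRight (coord (Sum.inr (Sum.inl i))) -
    (coord (Sum.inr (Sum.inl i))).smulRight (coord (Sum.inl i)))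

/-- The standard contact form as a 1-form. -/
def stdFormCLM (n : ℕ) (p : StdSpace n) : StdSpace n →L[ℝ] ℝ := coord (zIdx n) + stdBilin n p

theorem stdBilin_apply (p v : StdSpace n) : stdBilin n p v =
    (1 / 2) * ∑ i : Fin n, (p (Sum.inl i) * v (Sum.inr (Sum.inl i)) -
      p (Sum.inr (Sum.inl i)) * v (Sum.inl i)) := by
  simp [stdBilin]

theorem stdFormCLM_apply (p v : StdSpace n) : stdFormCLM n p v = stdForm n p v := by
  simp [stdFormCLM, stdBilin_apply, stdForm]

theorem hasFDerivAt_stdFormCLM (p : StdSpace n) : HasFDerivAt (stdFormCLM n) (stdBilin n) p := by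
  exact ((stdBilin n).hasFDerivAt (x := p)).const_add (coord (zIdx n))

/-- The partial derivatives of a function on the standard contact space. -/
def partialDeriv (H : StdSpace n → ℝ) (j : Fin n ⊕ Fin n ⊕ Unit) (p : StdSpace n) : ℝ :=
  fderiv ℝ H p (EuclideanSpace.single j 1)

/-- The contact Hamiltonian vector field of a function on the standard contact space. -/
def hamField (H : StdSpace n → ℝ) (p : StdSpace n) : StdSpace n :=
  WithLp.toLp 2 (Sum.elim
    (fun i => 1 / 2 * p (Sum.inl i) * partialDeriv H (zIdx n) p -
      partialDeriv H (Sum.inr (Sum.inl i)) p)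
    (Sum.elim
      (fun i => 1 / 2 * p (Sum.inr (Sum.inl i)) * partialDeriv H (zIdx n) p +
        partialDeriv H (Sum.inl i) p)
      fun _ => H p - 1 / 2 * ∑ i : Fin n, (p (Sum.inl i) * partialDeriv H (Sum.inl i) p +
        p (Sum.inr (Sum.inl i)) * partialDeriv H (Sum.inr (Sum.inl i)) p)))

theorem hamField_x (H : StdSpace n → ℝ) (p : StdSpace n) (i : Fin n) :
    hamField H p (Sum.inl i) = 1 / 2 * p (Sum.inl i) * partialDeriv H (zIdx n) p -
      partialDeriv H (Sum.inr (Sum.inl i)) p := rfl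

theorem hamField_y (H : StdSpace n → ℝ) (p : StdSpace n) (i : Fin n) :
    hamField H p (Sum.inr (Sum.inl i)) = 1 / 2 * p (Sum.inr (Sum.inl i)) *
      partialDeriv H (zIdx n) p + partialDeriv H (Sum.inl i) p := rfl

theorem hamField_z (H : StdSpace n → ℝ) (p : StdSpace n) :
    hamField H p (zIdx n) = H p - 1 / 2 * ∑ i : Fin n,
      (p (Sum.inl i) * partialDeriv H (Sum.inl i) p +
        p (Sum.inr (Sum.inl i)) * partialDeriv H (Sum.inr (Sum.inl i)) p) := rfl

theorem fderiv_apply_eq_sum (H : StdSpace n → ℝ) (p w : StdSpace n) :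
    fderiv ℝ H p w = ∑ i : Fin n, (partialDeriv H (Sum.inl i) p * w (Sum.inl i) +
      partialDeriv H (Sum.inr (Sum.inl i)) p * w (Sum.inr (Sum.inl i))) +
      partialDeriv H (zIdx n) p * w (zIdx n) := by
  have hw : w = ∑ j, w j • EuclideanSpace.single j (1 : ℝ) := by
    ext k
    rw [WithLp.ofLp_sum, Finset.sum_apply, Finset.sum_eq_single k]
    · simp
    · intro j _ hj; simp [hj.symm]
    · simp
  conv_lhs => rw [hw]
  rw [map_sum]
  simp only [map_smul, Fintype.sum_sum_type, Finset.univ_unique, Finset.sum_singleton,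
    smul_eq_mul, partialDeriv, Finset.sum_add_distrib, mul_comm (w _)]
  rw [add_assoc]

/-- The ∂_z terms cancel by antisymmetry, and the sum that remains cancels against the correction in
the last component. Thus the Hamiltonian is the transverse speed of its flow, and a positive
Hamiltonian gives a positive flow. -/
theorem stdForm_hamField (H : StdSpace n → ℝ) (p : StdSpace n) :
    stdForm n p (hamField H p) = H p := by
  have h : ∑ i : Fin n, (p (Sum.inl i) * hamField H p (Sum.inr (Sum.inl i)) -
      p (Sum.inr (Sum.inl i)) * hamField H p (Sum.inl i)) =
      ∑ i : Fin n, (p (Sum.inl i) * partialDeriv H (Sum.inl i) p +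
        p (Sum.inr (Sum.inl i)) * partialDeriv H (Sum.inr (Sum.inl i)) p) := by
    refine Finset.sum_congr rfl fun i _ => ?_
    rw [hamField_x, hamField_y]; ring
  rw [stdForm, h, hamField_z]; ring

theorem contDiff_partialDeriv {H : StdSpace n → ℝ} (hH : ContDiff ℝ ∞ H)
    (j : Fin n ⊕ Fin n ⊕ Unit) : ContDiff ℝ ∞ (partialDeriv H j) :=
  (hH.fderiv_right (m := ∞) (by simp)).clm_apply contDiff_const

theorem contDiff_hamField {H : StdSpace n → ℝ} (hH : ContDiff ℝ ∞ H) :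
    ContDiff ℝ ∞ (hamField H) := by
  have hc : ∀ j, ContDiff ℝ ∞ fun p : StdSpace n => p j := fun j => (coord j).contDiff
  have hz := contDiff_partialDeriv hH (zIdx n)
  refine contDiff_euclidean.2 fun j => ?_
  rcases j with i | i | u
  · exact ((contDiff_const.mul (hc _)).mul hz).sub (contDiff_partialDeriv hH _)
  · exact ((contDiff_const.mul (hc _)).mul hz).add (contDiff_partialDeriv hH _)
  · exact hH.sub (contDiff_const.mul (ContDiff.sum fun i _ =>
      ((hc _).mul (contDiff_partialDeriv hH _)).add ((hc _).mul (contDiff_partialDeriv hH _))))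

/-- The Lie derivative of the standard contact form along a contact Hamiltonian vector field. -/
theorem lieDeriv_stdFormCLM {H : StdSpace n → ℝ} (hH : ContDiff ℝ ∞ H) (p w : StdSpace n) :
    fderiv ℝ (stdFormCLM n) p (hamField H p) w + stdFormCLM n p (fderiv ℝ (hamField H) p w) =
      partialDeriv H (zIdx n) p * stdForm n p w := by
  -- Differentiating this identity expresses the term with the derivative of `hamField H` through
  -- first derivatives of `H` only.
  have h1 : (fun q => stdFormCLM n q (hamField H q)) = H := by
    funext q; rw [stdFormCLM_apply, stdForm_hamField]
  have h2 : fderiv ℝ H p w = stdFormCLM n p (fderiv ℝ (hamField H) p w) +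
      stdBilin n w (hamField H p) := by
    have := ((hasFDerivAt_stdFormCLM p).clm_apply
      (((contDiff_hamField hH).differentiable (by simp)) p).hasFDerivAt).fderiv
    rw [h1] at this
    rw [this]; rfl
  have h3 : stdFormCLM n p (fderiv ℝ (hamField H) p w) =
      fderiv ℝ H p w - stdBilin n w (hamField H p) := by rw [h2]; ring
  rw [h3, (hasFDerivAt_stdFormCLM p).fderiv, fderiv_apply_eq_sum, stdBilin_apply, stdBilin_apply,
    stdForm]
  have h4 : ∑ i : Fin n, (partialDeriv H (Sum.inl i) p * w (Sum.inl i) +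
      partialDeriv H (Sum.inr (Sum.inl i)) p * w (Sum.inr (Sum.inl i))) =
      1 / 2 * ∑ i : Fin n, (w (Sum.inl i) * hamField H p (Sum.inr (Sum.inl i)) -
        w (Sum.inr (Sum.inl i)) * hamField H p (Sum.inl i)) -
      1 / 2 * ∑ i : Fin n, (hamField H p (Sum.inl i) * w (Sum.inr (Sum.inl i)) -
        hamField H p (Sum.inr (Sum.inl i)) * w (Sum.inl i)) +
      partialDeriv H (zIdx n) p * ((1 / 2) * ∑ i : Fin n,
        (p (Sum.inl i) * w (Sum.inr (Sum.inl i)) - p (Sum.inr (Sum.inl i)) * w (Sum.inl i))) := by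
    simp only [Finset.mul_sum, ← Finset.sum_add_distrib, ← Finset.sum_sub_distrib]
    refine Finset.sum_congr rfl fun i _ => ?_
    rw [hamField_x, hamField_y]; ring
  rw [h4]; ring

/-- A smooth one-parameter group of contactomorphisms of the standard contact space with support
in the closed ball of radius `r`, generated by the contact Hamiltonian `H`. -/
structure StdFlow (n : ℕ) (r : ℝ) (H : StdSpace n → ℝ) where
  /-- the contactomorphism at time `s` -/
  toFun : ℝ → StdSpace n → StdSpace n
  map_zero : ∀ p, toFun 0 p = p
  map_add : ∀ s t p, toFun (s + t) p = toFun s (toFun t p)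
  smooth : ContDiff ℝ ∞ fun x : ℝ × StdSpace n => toFun x.1 x.2
  hasDerivAt : ∀ p s, HasDerivAt (fun τ => toFun τ p) (hamField H (toFun s p)) s
  scales : ∀ s p, ∃ c, ∀ v, stdForm n (toFun s p) (fderiv ℝ (toFun s) p v) =
    Real.exp c * stdForm n p v
  eq_self : ∀ s, ∀ p ∉ Metric.closedBall (0 : StdSpace n) r, toFun s p = p

theorem hamField_eq_zero {H : StdSpace n → ℝ} {p : StdSpace n} (hH : H =ᶠ[𝓝 p] fun _ => 0) :
    hamField H p = 0 := by
  have hd : ∀ j, partialDeriv H j p = 0 := fun j => by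
    rw [partialDeriv, hH.fderiv_eq]; simp
  ext j
  rcases j with i | i | u
  · rw [hamField_x, hd, hd]; simp
  · rw [hamField_y, hd, hd]; simp
  · rw [hamField_z, hH.self_of_nhds]; simp [hd]

theorem hamField_eq_zero_of_notMem {H : StdSpace n → ℝ} {r : ℝ}
    (hr : ∀ p ∉ Metric.closedBall (0 : StdSpace n) r, H p = 0) {p : StdSpace n}
    (hp : p ∉ Metric.closedBall (0 : StdSpace n) r) : hamField H p = 0 :=
  hamField_eq_zero <| by
    filter_upwards [Metric.isClosed_closedBall.isOpen_compl.mem_nhds hp] with q hq using hr q hq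

/-- For a fixed vector v, the value of the form on its image under the time-s map solves the linear
equation u' = (∂_z H)u along the orbit. Hence the flow rescales the form by the exponential of the
integral of ∂_z H, independently of v. -/
theorem exists_stdFlow {H : StdSpace n → ℝ} (hH : ContDiff ℝ ∞ H) {r : ℝ}
    (hr : ∀ p ∉ Metric.closedBall (0 : StdSpace n) r, H p = 0) : Nonempty (StdFlow n r H) := by
  have hsm : ∀ x₀ : StdSpace n, ContDiffOn ℝ ∞
      (SmoothFlow.fieldInChart (I := 𝓘(ℝ, StdSpace n)) (hamField H) x₀)
      (extChartAt 𝓘(ℝ, StdSpace n) x₀).target := by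
    intro x₀
    have hchart : ∀ (κ : PartialEquiv (StdSpace n) (StdSpace n)), κ = PartialEquiv.refl _ → ∀ y,
        mfderiv 𝓘(ℝ, StdSpace n) 𝓘(ℝ, StdSpace n) κ (κ.symm y) (hamField H (κ.symm y)) =
          hamField H y := by
      rintro _ rfl y
      exact DFunLike.congr_fun
        (mfderiv_id (I := 𝓘(ℝ, StdSpace n)) (x := y)) (hamField H y)
    have : SmoothFlow.fieldInChart (I := 𝓘(ℝ, StdSpace n)) (hamField H) x₀ = hamField H :=
      funext fun y => hchart _ (extChartAt_model_space_eq_id _ x₀) y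
    rw [this]
    exact (contDiff_hamField hH).contDiffOn
  obtain ⟨θ, h0, hadd, hθ, hint, hfix⟩ := SmoothFlow.exists_smooth_globalFlow
    (I := 𝓘(ℝ, StdSpace n)) hsm (isCompact_closedBall (0 : StdSpace n) r)
    fun _ hp => hamField_eq_zero_of_notMem hr hp
  have hθ' : ContDiff ℝ ∞ fun x : ℝ × StdSpace n => θ x.1 x.2 := by
    rw [← contMDiff_iff_contDiff]
    rw [modelWithCornersSelf_prod, ← chartedSpaceSelf_prod] 
    exact hθ
  have hder : ∀ p s, HasDerivAt (fun τ => θ τ p) (hamField H (θ s p)) s := by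
    intro p s
    have h1 := (hint p s).hasFDerivAt
    have h2 : HasDerivAt (fun τ => θ τ p) _ s := HasFDerivAt.hasDerivAt (F := StdSpace n) h1
    refine h2.congr_deriv ?_
    exact one_smul ℝ (hamField H (θ s p))
  refine ⟨⟨θ, h0, hadd, hθ', hder, fun s p => ?_, hfix⟩⟩
  have hslice : ∀ s, Differentiable ℝ (θ s) := fun s =>
    (hθ'.comp (contDiff_const.prodMk contDiff_id)).differentiable (by simp)
  refine ⟨∫ τ in (0 : ℝ)..s, partialDeriv H (zIdx n) (θ τ p), fun v => ?_⟩
  set u : ℝ → ℝ := fun s => stdFormCLM n (θ s p) (fderiv ℝ (θ s) p v) with hu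
  have hu' : ∀ s, HasDerivAt u (partialDeriv H (zIdx n) (θ s p) * u s) s := by
    intro s
    have h1 := hasDerivAt_pullback_flow (Ψ := fun x : ℝ × StdSpace n => θ x.1 x.2) (y := θ s p)
      ((hθ'.of_le (by norm_cast)).contDiffAt) (hasFDerivAt_stdFormCLM _).differentiableAt
      (X := hamField H) (Filter.Eventually.of_forall h0)
      (Filter.Eventually.of_forall fun z => by simpa [h0] using hder z 0) (fderiv ℝ (θ s) p v)
    rw [lieDeriv_stdFormCLM hH, ← stdFormCLM_apply] at h1
    have h2 : (fun τ => stdFormCLM n (θ τ (θ s p))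
        (fderiv ℝ (fun z => θ τ z) (θ s p) (fderiv ℝ (θ s) p v))) = fun τ => u (τ + s) := by
      funext τ
      have e : θ (τ + s) = θ τ ∘ θ s := funext fun q => hadd τ s q
      simp only [hu, e]
      rw [fderiv_comp p (hslice τ _) (hslice s p)]
      rfl
    rw [h2] at h1
    have h3 := HasDerivAt.comp_sub_const (f := fun τ => u (τ + s)) (x := s) (a := s)
      (by rwa [sub_self])
    simpa using h3
  have hcont : Continuous fun τ => partialDeriv H (zIdx n) (θ τ p) :=
    (contDiff_partialDeriv hH _).continuous.comp
      (hθ'.continuous.comp (Continuous.prodMk_left p))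
  have hI : ∀ s, HasDerivAt (fun s => ∫ τ in (0 : ℝ)..s, partialDeriv H (zIdx n) (θ τ p))
      (partialDeriv H (zIdx n) (θ s p)) s := fun s =>
    intervalIntegral.integral_hasDerivAt_right (hcont.intervalIntegrable _ _)
      (hcont.stronglyMeasurableAtFilter _ _) hcont.continuousAt
  have hd : ∀ s, HasDerivAt (fun s => Real.exp
      (-∫ τ in (0 : ℝ)..s, partialDeriv H (zIdx n) (θ τ p)) * u s) 0 s := by
    intro s
    exact (((hI s).fun_neg.exp).fun_mul (hu' s)).congr_deriv (by ring)
  have hconst := is_const_of_deriv_eq_zero (fun s => (hd s).differentiableAt)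
    (fun s => (hd s).deriv) s 0
  have e0 : θ 0 = id := funext h0
  simp only [intervalIntegral.integral_same, neg_zero, Real.exp_zero, one_mul, Real.exp_neg]
    at hconst
  have hu0 : u 0 = stdForm n p v := by simp [hu, e0, stdFormCLM_apply]
  rw [hu0, inv_mul_eq_iff_eq_mul₀ (Real.exp_ne_zero _)] at hconst
  rw [← stdFormCLM_apply, ← hconst]

end ContactGeometry

/-! ### Contact dilations and a positive radial Hamiltonian -/

namespace ContactGeometry

variable {n : ℕ}

/-- The contact dilation `(x, y, z) ↦ (c x, c y, c² z)`. -/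
def dilation (n : ℕ) (c : ℝ) : StdSpace n →L[ℝ] StdSpace n :=
  c • ContinuousLinearMap.id ℝ (StdSpace n) +
    (c ^ 2 - c) • (coord (zIdx n)).smulRight (EuclideanSpace.single (zIdx n) (1 : ℝ))

theorem dilation_apply_z (c : ℝ) (p : StdSpace n) :
    dilation n c p (zIdx n) = c ^ 2 * p (zIdx n) := by
  simp [dilation]; ring

theorem dilation_apply_x (c : ℝ) (p : StdSpace n) (i : Fin n) :
    dilation n c p (Sum.inl i) = c * p (Sum.inl i) := by
  simp [dilation]

theorem dilation_apply_y (c : ℝ) (p : StdSpace n) (i : Fin n) :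
    dilation n c p (Sum.inr (Sum.inl i)) = c * p (Sum.inr (Sum.inl i)) := by
  simp [dilation]

theorem stdForm_dilation (c : ℝ) (p v : StdSpace n) :
    stdForm n (dilation n c p) (dilation n c v) = c ^ 2 * stdForm n p v := by
  simp only [stdForm, dilation_apply_z, dilation_apply_x, dilation_apply_y, mul_add]
  congr 1
  simp only [Finset.mul_sum]
  exact Finset.sum_congr rfl fun i _ => by ring

theorem norm_dilation_le {c : ℝ} (h0 : 0 ≤ c) (h1 : c ≤ 1) (p : StdSpace n) :
    ‖dilation n c p‖ ≤ c * ‖p‖ := by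
  have hc2 : c ^ 2 ≤ c := by nlinarith
  rw [EuclideanSpace.norm_eq, EuclideanSpace.norm_eq]
  refine Real.sqrt_le_iff.2 ⟨by positivity, ?_⟩
  rw [mul_pow, Real.sq_sqrt (by positivity), Finset.mul_sum]
  refine Finset.sum_le_sum fun j _ => ?_
  rw [Real.norm_eq_abs, Real.norm_eq_abs, sq_abs, sq_abs]
  rcases j with i | i | u
  · rw [dilation_apply_x, mul_pow]
  · rw [dilation_apply_y, mul_pow]
  · rw [show (Sum.inr (Sum.inr u) : Fin n ⊕ Fin n ⊕ Unit) = zIdx n from rfl, dilation_apply_z,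
      mul_pow]
    refine mul_le_mul_of_nonneg_right ?_ (sq_nonneg _)
    exact pow_le_pow_left₀ (sq_nonneg c) hc2 2

/-- The contact Hamiltonian that generates the contact dilations near the origin. -/
theorem hamField_neg_two_z {H : StdSpace n → ℝ} {p : StdSpace n}
    (hH : H =ᶠ[𝓝 p] fun q => -2 * q (zIdx n)) :
    hamField H p = -p - (p (zIdx n)) • EuclideanSpace.single (zIdx n) (1 : ℝ) := by
  have hd : ∀ j, partialDeriv H j p = -2 * (EuclideanSpace.single j (1 : ℝ)) (zIdx n) := fun j => by
    have h1 : HasFDerivAt (fun q : StdSpace n => -2 * q (zIdx n)) ((-2 : ℝ) • coord (zIdx n)) p :=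
      ((coord (zIdx n)).hasFDerivAt (x := p)).const_mul (-2)
    rw [partialDeriv, hH.fderiv_eq, h1.fderiv]
    rfl
  ext j
  rcases j with i | i | u
  · rw [hamField_x, hd, hd]; simp; ring
  · rw [hamField_y, hd, hd]; simp; ring
  · rw [show (Sum.inr (Sum.inr u) : Fin n ⊕ Fin n ⊕ Unit) = zIdx n from rfl, hamField_z,
      hH.self_of_nhds]
    simp [hd]; ring

theorem hasDerivAt_dilation_exp (p : StdSpace n) (s : ℝ) :
    HasDerivAt (fun τ => dilation n (Real.exp (-τ)) p)
      (-dilation n (Real.exp (-s)) p - (dilation n (Real.exp (-s)) p (zIdx n)) •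
        EuclideanSpace.single (zIdx n) (1 : ℝ)) s := by
  have h1 : HasDerivAt (fun τ : ℝ => Real.exp (-τ)) (-Real.exp (-s)) s := by
    simpa using (hasDerivAt_neg s).exp
  have h2 := (h1.smul_const p).add (((h1.pow 2).sub h1).smul_const
    ((p (zIdx n)) • EuclideanSpace.single (zIdx n) (1 : ℝ)))
  refine HasDerivAt.congr_deriv (f := fun τ => dilation n (Real.exp (-τ)) p) h2 ?_
  rw [dilation_apply_z]
  ext j
  by_cases hj : j = zIdx n
  · simp [dilation, hj]; ring
  · simp [dilation, hj]

/-- A contact flow that restricts to contact dilations on a given ball. -/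
theorem exists_dilationFlow {r₁ r₂ : ℝ} (h₁ : 0 < r₁) (h₂ : r₁ < r₂) :
    ∃ H : StdSpace n → ℝ, ∃ F : StdFlow n r₂ H, ∀ s, 0 ≤ s → ∀ p : StdSpace n, ‖p‖ ≤ r₁ →
      F.toFun s p = dilation n (Real.exp (-s)) p := by
  -- The cutoff is 1 up to a radius r' > r₁. For nonnegative times dilations do not increase norms,
  -- so the whole dilation orbit of p has the Hamiltonian −2z on a neighbourhood, and ODE uniqueness
  -- for the compactly supported, hence globally Lipschitz, field identifies the two curves.
  obtain ⟨r', hr1, hr2⟩ := exists_between h₂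
  let f : ContDiffBump (0 : StdSpace n) := ⟨r', r₂, h₁.trans hr1, hr2⟩
  set H : StdSpace n → ℝ := fun p => -2 * p (zIdx n) * f p with hHdef
  have hH : ContDiff ℝ ∞ H := (contDiff_const.mul (coord (zIdx n)).contDiff).mul f.contDiff
  have hr : ∀ p ∉ Metric.closedBall (0 : StdSpace n) r₂, H p = 0 := by
    intro p hp
    have : f p = 0 := f.zero_of_le_dist (by simpa using (not_le.1 (by simpa using hp) : r₂ < ‖p‖).le)
    simp [hHdef, this]
  obtain ⟨F⟩ := exists_stdFlow hH hr
  refine ⟨H, F, fun s hs p hp => ?_⟩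
  have hcs : HasCompactSupport (hamField H) := by
    refine HasCompactSupport.intro (isCompact_closedBall (0 : StdSpace n) r₂) fun q hq =>
      hamField_eq_zero_of_notMem hr hq
  obtain ⟨L, hL⟩ := (contDiff_hamField hH).lipschitzWith_of_hasCompactSupport hcs (by simp)
  have hγ : ∀ τ : ℝ, 0 ≤ τ → hamField H (dilation n (Real.exp (-τ)) p) =
      -dilation n (Real.exp (-τ)) p - (dilation n (Real.exp (-τ)) p (zIdx n)) •
        EuclideanSpace.single (zIdx n) (1 : ℝ) := by
    intro τ hτ
    refine hamField_neg_two_z ?_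
    have hn : ‖dilation n (Real.exp (-τ)) p‖ < r' := by
      refine lt_of_le_of_lt ((norm_dilation_le (Real.exp_pos _).le
        (Real.exp_le_one_iff.2 (by linarith)) p).trans ?_) hr1
      calc Real.exp (-τ) * ‖p‖ ≤ 1 * ‖p‖ := by
            gcongr; exact Real.exp_le_one_iff.2 (by linarith)
        _ ≤ r₁ := by rwa [one_mul]
    filter_upwards [Metric.isOpen_ball.mem_nhds (mem_ball_zero_iff.2 hn)] with q hq
    simp only [hHdef]
    rw [f.one_of_mem_closedBall (Metric.ball_subset_closedBall hq), mul_one]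
  have := ODE_solution_unique (v := fun _ => hamField H) (K := L) (a := 0) (b := s)
    (f := fun τ => F.toFun τ p) (g := fun τ => dilation n (Real.exp (-τ)) p)
    (fun t => hL) (fun t _ => (F.hasDerivAt p t).continuousAt.continuousWithinAt)
    (fun t _ => (F.hasDerivAt p t).hasDerivWithinAt)
    (fun t _ => (hasDerivAt_dilation_exp p t).continuousAt.continuousWithinAt)
    (fun t ht => by
      rw [hγ t ht.1]; exact (hasDerivAt_dilation_exp p t).hasDerivWithinAt)
    (by
      rw [F.map_zero]; ext j
      simp [dilation])
  exact this (right_mem_Icc.2 hs)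

/-- A contact Hamiltonian that is positive on an open ball and vanishes elsewhere. -/
def ballHam (n : ℕ) (r : ℝ) (p : StdSpace n) : ℝ := expNegInvGlue (r ^ 2 - ‖p‖ ^ 2)

theorem contDiff_ballHam (r : ℝ) : ContDiff ℝ ∞ (ballHam n r) :=
  expNegInvGlue.contDiff.comp (contDiff_const.sub (contDiff_norm_sq ℝ))

theorem ballHam_pos {r : ℝ} {p : StdSpace n} (hp : ‖p‖ < r) :
    0 < ballHam n r p :=
  expNegInvGlue.pos_of_pos (by nlinarith [norm_nonneg p])

theorem ballHam_eq_zero {r : ℝ} (hr : 0 ≤ r) {p : StdSpace n} (hp : r ≤ ‖p‖) :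
    ballHam n r p = 0 :=
  expNegInvGlue.zero_of_nonpos (by nlinarith [norm_nonneg p])

theorem monotone_expNegInvGlue : Monotone expNegInvGlue := by
  intro x y hxy
  rcases le_or_gt x 0 with hx | hx
  · rw [expNegInvGlue.zero_of_nonpos hx]; exact expNegInvGlue.nonneg y
  · have hy : 0 < y := hx.trans_le hxy
    simp only [expNegInvGlue, not_le.2 hx, not_le.2 hy, if_false]
    exact Real.exp_le_exp.2 (neg_le_neg (inv_anti₀ hx hxy))

/-- A radially decreasing Hamiltonian makes −½Σ(x ∂_x H + y ∂_y H) nonnegative, so the last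
component is at least `H`, which is positive. Thus z strictly increases along orbits in the open
ball, and none of them is periodic. -/
theorem hamField_ballHam_z_pos {r : ℝ} {p : StdSpace n} (hp : ‖p‖ < r) :
    0 < hamField (ballHam n r) p (zIdx n) := by
  set w := r ^ 2 - ‖p‖ ^ 2
  have hg : HasDerivAt expNegInvGlue (deriv expNegInvGlue w) w :=
    ((expNegInvGlue.contDiff (n := 1)).differentiable (by simp) w).hasDerivAt
  have hg0 : 0 ≤ deriv expNegInvGlue w := monotone_expNegInvGlue.deriv_nonneg
  have hd : ∀ j, partialDeriv (ballHam n r) j p = -2 * deriv expNegInvGlue w * p j := by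
    intro j
    have h1 : HasFDerivAt (fun q : StdSpace n => r ^ 2 - ‖q‖ ^ 2) (-(2 • innerSL ℝ p)) p :=
      (hasStrictFDerivAt_norm_sq p).hasFDerivAt.const_sub _
    have h2 := hg.comp_hasFDerivAt p h1
    have h3 : fderiv ℝ (ballHam n r) p = _ := h2.fderiv
    rw [partialDeriv, h3]
    simp [EuclideanSpace.inner_single_right]
    ring
  rw [hamField_z]
  have h4 : ∑ i : Fin n, (p (Sum.inl i) * partialDeriv (ballHam n r) (Sum.inl i) p +
      p (Sum.inr (Sum.inl i)) * partialDeriv (ballHam n r) (Sum.inr (Sum.inl i)) p) ≤ 0 := by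
    refine Finset.sum_nonpos fun i _ => ?_
    rw [hd, hd]
    nlinarith [mul_nonneg hg0 (sq_nonneg (p (Sum.inl i))),
      mul_nonneg hg0 (sq_nonneg (p (Sum.inr (Sum.inl i))))]
  have := ballHam_pos hp
  linarith

end ContactGeometry

/-! ### Cooriented Darboux charts and extension of flows -/

namespace ContactGeometry

variable {n : ℕ} {M : Type*} [TopologicalSpace M] [ChartedSpace (Model n) M]
  [IsManifold (𝓡 (2 * n + 1)) ∞ M]

/-- Coordinates on a Darboux ball which preserve the coorientations of the contact structures. -/
structure DarbouxChart (α : ContactForm n M) (r : ℝ) where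
  /-- the parametrization of the Darboux ball -/
  e : OpenPartialHomeomorph (StdSpace n) M
  source_eq : e.source = Metric.ball 0 r
  smooth : ContMDiffOn 𝓘(ℝ, StdSpace n) (𝓡 (2 * n + 1)) ∞ e (Metric.ball 0 r)
  smooth_symm : ContMDiffOn (𝓡 (2 * n + 1)) 𝓘(ℝ, StdSpace n) ∞ e.symm e.target
  /-- the ratio between the contact form and the standard contact form -/
  factor : StdSpace n → ℝ
  factor_pos : ∀ p ∈ Metric.ball 0 r, 0 < factor p
  continuousOn_factor : ContinuousOn factor (Metric.ball 0 r)
  pullParam_eq : ∀ p ∈ Metric.ball 0 r, ∀ v, pullParam α e p v = factor p * stdForm n p v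

/-- The linear isometry `(x, y, z) ↦ (x, -y, -z)`, which reverses the coorientation of the standard
contact structure. -/
def flip (n : ℕ) : StdSpace n ≃ₗᵢ[ℝ] StdSpace n :=
  LinearIsometryEquiv.piLpCongrRight 2 (Sum.elim (fun _ => LinearIsometryEquiv.refl ℝ ℝ)
    (fun _ => LinearIsometryEquiv.neg ℝ))

theorem flip_inl (p : StdSpace n) (i : Fin n) : flip n p (Sum.inl i) = p (Sum.inl i) := rfl

theorem flip_inr (p : StdSpace n) (i : Fin n ⊕ Unit) : flip n p (Sum.inr i) = -p (Sum.inr i) := rfl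

theorem stdForm_flip (p v : StdSpace n) : stdForm n (flip n p) (flip n v) = -stdForm n p v := by
  simp only [stdForm, flip_inl, flip_inr, neg_add]
  rw [← mul_neg, ← Finset.sum_neg_distrib]
  congr 2
  exact Finset.sum_congr rfl fun i _ => by ring

theorem mdifferentiableAt_of_contMDiffOn_ball {N : Type*} [TopologicalSpace N]
    [ChartedSpace (Model n) N] {r : ℝ} {e : StdSpace n → N}
    (he : ContMDiffOn 𝓘(ℝ, StdSpace n) (𝓡 (2 * n + 1)) ∞ e (Metric.ball 0 r)) {p : StdSpace n}
    (hp : p ∈ Metric.ball (0 : StdSpace n) r) :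
    MDifferentiableAt 𝓘(ℝ, StdSpace n) (𝓡 (2 * n + 1)) e p :=
  (he.contMDiffAt (Metric.isOpen_ball.mem_nhds hp)).mdifferentiableAt (by simp)

/-- Equal kernels make the pulled-back form a nowhere vanishing multiple of the standard one; the
multiple has constant sign because a ball is connected. If it is negative, precompose with `flip`,
which maps the ball to itself and changes the sign of the standard form. -/
theorem IsDarbouxBall.exists_chart {α : ContactForm n M} {B : Set M} (hB : IsDarbouxBall α B) :
    ∃ r, 0 < r ∧ ∃ D : DarbouxChart α r, D.e.target = B := by
  obtain ⟨r, hr, e, hs, ht, hsm, hsm', hker⟩ := hB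
  rw [hs] at hsm hker
  refine ⟨r, hr, ?_⟩
  set w : StdSpace n := EuclideanSpace.single (zIdx n) (1 : ℝ) with hw
  have hstdw : ∀ p, stdForm n p w = 1 := by intro p; simp [stdForm, hw]
  set h : StdSpace n → ℝ := fun p => pullParam α e p w with hh
  have hmul : ∀ p ∈ Metric.ball (0 : StdSpace n) r, ∀ v,
      pullParam α e p v = h p * stdForm n p v := by
    intro p hp v
    have h1 : stdForm n p (v - stdForm n p v • w) = 0 := by
      rw [← stdFormCLM_apply, map_sub, map_smul, stdFormCLM_apply, stdFormCLM_apply, hstdw]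
      simp
    have h2 : pullParam α e p (v - stdForm n p v • w) = 0 := (hker p hp _).2 h1
    rw [map_sub, map_smul, smul_eq_mul, sub_eq_zero] at h2
    rw [h2, mul_comm]
  have hne : ∀ p ∈ Metric.ball (0 : StdSpace n) r, h p ≠ 0 := by
    intro p hp h0
    have := (hker p hp w).1 h0
    rw [hstdw] at this
    exact one_ne_zero this
  have hcont : ContinuousOn h (Metric.ball 0 r) :=
    (contDiffOn_pullParam_apply α Metric.isOpen_ball hsm w).continuousOn
  have hconv : (h '' Metric.ball 0 r).OrdConnected :=
    ((convex_ball (0 : StdSpace n) r).isPreconnected.image h hcont).ordConnected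
  have h00 : (0 : StdSpace n) ∈ Metric.ball (0 : StdSpace n) r := Metric.mem_ball_self hr
  rcases lt_or_gt_of_ne (hne 0 h00) with hneg | hpos
  · have hneg' : ∀ p ∈ Metric.ball (0 : StdSpace n) r, h p < 0 := by
      intro p hp
      by_contra! hc
      obtain ⟨q, hq, hq0⟩ := hconv.out (mem_image_of_mem h h00) (mem_image_of_mem h hp)
        ⟨hneg.le, hc⟩
      exact hne q hq hq0
    have hflip : ∀ p ∈ Metric.ball (0 : StdSpace n) r,
        flip n p ∈ Metric.ball (0 : StdSpace n) r := by
      intro p hp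
      rw [mem_ball_zero_iff] at hp ⊢
      rwa [LinearIsometryEquiv.norm_map]
    have hfl : ContMDiff 𝓘(ℝ, StdSpace n) 𝓘(ℝ, StdSpace n) ∞ (flip n) :=
      (flip n).contDiff.contMDiff
    have hfl' : ContMDiff 𝓘(ℝ, StdSpace n) 𝓘(ℝ, StdSpace n) ∞ (flip n).symm :=
      (flip n).symm.contDiff.contMDiff
    refine ⟨⟨(flip n).toHomeomorph.transOpenPartialHomeomorph e, ?_, ?_, ?_,
      fun p => -h (flip n p), fun p hp => neg_pos.2 (hneg' _ (hflip p hp)), ?_, ?_⟩, ?_⟩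
    · ext p
      simp [hs]
    · exact hsm.comp hfl.contMDiffOn hflip
    · exact hfl'.comp_contMDiffOn hsm'
    · exact (hcont.comp (flip n).continuous.continuousOn hflip).neg
    · intro p hp v
      have h1 := pullParam_comp α (G := e) (τ := flip n) (y := p)
        (mdifferentiableAt_of_contMDiffOn_ball hsm (hflip p hp)) (flip n).differentiableAt
      have h2 : fderiv ℝ (flip n) p v = flip n v :=
        DFunLike.congr_fun ((flip n).toContinuousLinearEquiv.toContinuousLinearMap.fderiv) v
      refine (DFunLike.congr_fun h1 v).trans ?_
      rw [ContinuousLinearMap.comp_apply, h2, hmul _ (hflip p hp), stdForm_flip]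
      ring
    · exact ht
  · have hpos' : ∀ p ∈ Metric.ball (0 : StdSpace n) r, 0 < h p := by
      intro p hp
      by_contra! hc
      obtain ⟨q, hq, hq0⟩ := hconv.out (mem_image_of_mem h hp) (mem_image_of_mem h h00)
        ⟨hc, le_of_lt hpos⟩
      exact hne q hq hq0
    exact ⟨⟨e, hs, hsm, hsm', h, hpos', hcont, hmul⟩, ht⟩

namespace StdFlow

variable {r₂ : ℝ} {H : StdSpace n → ℝ}

theorem neg_apply (F : StdFlow n r₂ H) (s : ℝ) (p : StdSpace n) :
    F.toFun (-s) (F.toFun s p) = p := by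
  rw [← F.map_add, neg_add_cancel, F.map_zero]

theorem mem_closedBall (F : StdFlow n r₂ H) (s : ℝ) {p : StdSpace n}
    (hp : p ∈ Metric.closedBall (0 : StdSpace n) r₂) :
    F.toFun s p ∈ Metric.closedBall (0 : StdSpace n) r₂ := by
  by_contra hc
  have h := F.eq_self (-s) _ hc
  rw [F.neg_apply] at h
  exact hc (h ▸ hp)

theorem mem_ball (F : StdFlow n r₂ H) {r : ℝ} (hr : r₂ < r) (s : ℝ) {p : StdSpace n}
    (hp : p ∈ Metric.ball (0 : StdSpace n) r) : F.toFun s p ∈ Metric.ball (0 : StdSpace n) r := by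
  by_cases h : p ∈ Metric.closedBall (0 : StdSpace n) r₂
  · exact Metric.closedBall_subset_ball hr (F.mem_closedBall s h)
  · rwa [F.eq_self s p h]

theorem differentiable (F : StdFlow n r₂ H) (s : ℝ) : Differentiable ℝ (F.toFun s) :=
  (F.smooth.comp (contDiff_const.prodMk contDiff_id)).differentiable (by simp)

end StdFlow

namespace DarbouxChart

variable {α : ContactForm n M} {r : ℝ}

theorem symm_mem (D : DarbouxChart α r) {q : M} (hq : q ∈ D.e.target) :
    D.e.symm q ∈ Metric.ball (0 : StdSpace n) r := by
  rw [← D.source_eq]; exact D.e.map_target hq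

theorem mem_target (D : DarbouxChart α r) {p : StdSpace n}
    (hp : p ∈ Metric.ball (0 : StdSpace n) r) : D.e p ∈ D.e.target :=
  D.e.map_source (by rwa [D.source_eq])

theorem symm_apply (D : DarbouxChart α r) {p : StdSpace n}
    (hp : p ∈ Metric.ball (0 : StdSpace n) r) : D.e.symm (D.e p) = p :=
  D.e.left_inv (by rwa [D.source_eq])

theorem isCompact_image (D : DarbouxChart α r) {r₂ : ℝ} (hr : r₂ < r) :
    IsCompact (D.e '' Metric.closedBall 0 r₂) :=
  (isCompact_closedBall _ _).image_of_continuousOn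
    (D.smooth.continuousOn.mono (Metric.closedBall_subset_ball hr))

open Classical in
/-- The extension by the identity of a family of maps defined in Darboux coordinates. -/
def extend (D : DarbouxChart α r) (θ : StdSpace n → StdSpace n) (q : M) : M :=
  if q ∈ D.e.target then D.e (θ (D.e.symm q)) else q

theorem extend_apply (D : DarbouxChart α r) (θ : StdSpace n → StdSpace n) {p : StdSpace n}
    (hp : p ∈ Metric.ball (0 : StdSpace n) r) : D.extend θ (D.e p) = D.e (θ p) := by
  rw [extend, if_pos (D.mem_target hp), D.symm_apply hp]

theorem extend_of_notMem (D : DarbouxChart α r) {θ : StdSpace n → StdSpace n} {r₂ : ℝ}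
    (hθ : ∀ p ∉ Metric.closedBall (0 : StdSpace n) r₂, θ p = p) {q : M}
    (hq : q ∉ D.e '' Metric.closedBall 0 r₂) : D.extend θ q = q := by
  by_cases h : q ∈ D.e.target
  · rw [extend, if_pos h, hθ, D.e.right_inv h]
    exact fun hc => hq ⟨_, hc, D.e.right_inv h⟩
  · rw [extend, if_neg h]

/-- A contact flow of the standard contact space that is supported in the interior of a ball
extends to a contact flow of the manifold. -/
theorem exists_extension [T2Space M] (D : DarbouxChart α r) {r₂ : ℝ} (hr : r₂ < r)
    {H : StdSpace n → ℝ} (F : StdFlow n r₂ H) :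
    ∃ Ψ : ContactFlow α,
      (∀ s, ∀ p ∈ Metric.ball (0 : StdSpace n) r, Ψ.toFun s (D.e p) = D.e (F.toFun s p)) ∧
      ∀ s, ∀ q ∉ D.e '' Metric.closedBall 0 r₂, Ψ.toFun s q = q := by
  have h0 : ∀ q, D.extend (F.toFun 0) q = q := by
    intro q
    by_cases h : q ∈ D.e.target
    · rw [extend, if_pos h, F.map_zero, D.e.right_inv h]
    · rw [extend, if_neg h]
  have hadd : ∀ s t q, D.extend (F.toFun (s + t)) q =
      D.extend (F.toFun s) (D.extend (F.toFun t) q) := by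
    intro s t q
    by_cases h : q ∈ D.e.target
    · rw [← D.e.right_inv h, D.extend_apply _ (D.symm_mem h), D.extend_apply _ (D.symm_mem h),
        D.extend_apply _ (F.mem_ball hr t (D.symm_mem h)), F.map_add]
    · have ht : D.extend (F.toFun t) q = q := if_neg h
      rw [ht, extend, extend, if_neg h, if_neg h]
  have hfix : ∀ s, ∀ q ∉ D.e '' Metric.closedBall 0 r₂, D.extend (F.toFun s) q = q :=
    fun s q hq => D.extend_of_notMem (F.eq_self s) hq
  have hsm : ContMDiff (𝓘(ℝ, ℝ).prod (𝓡 (2 * n + 1))) (𝓡 (2 * n + 1)) ∞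
      (fun x : ℝ × M => D.extend (F.toFun x.1) x.2) := by
    rintro ⟨s, q⟩
    by_cases h : q ∈ D.e.target
    · have h1 : ContMDiffAt (𝓘(ℝ, ℝ).prod (𝓡 (2 * n + 1))) 𝓘(ℝ, StdSpace n) ∞
          (fun x : ℝ × M => D.e.symm x.2) (s, q) :=
        ContMDiffAt.comp (g := D.e.symm) (s, q)
          (D.smooth_symm.contMDiffAt (D.e.open_target.mem_nhds h)) contMDiffAt_snd
      have h2 : ContMDiffAt (𝓘(ℝ, ℝ).prod (𝓡 (2 * n + 1))) 𝓘(ℝ, ℝ × StdSpace n) ∞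
          (fun x : ℝ × M => (x.1, D.e.symm x.2)) (s, q) := contMDiffAt_fst.prodMk_space h1
      have h3 : ContMDiffAt (𝓘(ℝ, ℝ).prod (𝓡 (2 * n + 1))) 𝓘(ℝ, StdSpace n) ∞
          (fun x : ℝ × M => F.toFun x.1 (D.e.symm x.2)) (s, q) :=
        ContMDiffAt.comp (g := fun x : ℝ × StdSpace n => F.toFun x.1 x.2) (s, q)
          F.smooth.contMDiff.contMDiffAt h2
      have h4 : ContMDiffAt (𝓘(ℝ, ℝ).prod (𝓡 (2 * n + 1))) (𝓡 (2 * n + 1)) ∞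
          (fun x : ℝ × M => D.e (F.toFun x.1 (D.e.symm x.2))) (s, q) :=
        ContMDiffAt.comp (g := D.e) (s, q) (D.smooth.contMDiffAt (Metric.isOpen_ball.mem_nhds
          (F.mem_ball hr s (D.symm_mem h)))) h3
      refine h4.congr_of_eventuallyEq ?_
      filter_upwards [continuousAt_snd.eventually (D.e.open_target.mem_nhds h)] with x hx
      exact if_pos hx
    · have hq : q ∉ D.e '' Metric.closedBall 0 r₂ := by
        rintro ⟨p, hp, rfl⟩
        exact h (D.mem_target (Metric.closedBall_subset_ball hr hp))
      refine (contMDiffAt_snd (I := 𝓘(ℝ, ℝ)) (J := 𝓡 (2 * n + 1))).congr_of_eventuallyEq ?_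
      filter_upwards [continuousAt_snd.eventually
        ((D.isCompact_image hr).isClosed.isOpen_compl.mem_nhds hq)] with x hx
      exact hfix x.1 x.2 hx
  have hslice : ∀ τ, ContMDiff (𝓡 (2 * n + 1)) (𝓡 (2 * n + 1)) ∞ (D.extend (F.toFun τ)) := fun τ =>
    hsm.comp (contMDiff_const.prodMk contMDiff_id)
  refine ⟨⟨permOfFlow (fun s => D.extend (F.toFun s)) h0 hadd, Equiv.ext h0,
    fun s t => Equiv.ext fun q => hadd s t q, hsm, fun s q => ?_, _, D.isCompact_image hr, hfix⟩,
    fun s p hp => D.extend_apply _ hp, hfix⟩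
  by_cases h : q ∈ D.e.target
  · set p := D.e.symm q with hp
    have hpb : p ∈ Metric.ball (0 : StdSpace n) r := D.symm_mem h
    have hpq : D.e p = q := D.e.right_inv h
    have hθp : F.toFun s p ∈ Metric.ball (0 : StdSpace n) r := F.mem_ball hr s hpb
    obtain ⟨c, hc⟩ := F.scales s p
    -- The flow scales the standard form by e^c; the form on the manifold differs from it by
    -- `factor`, taken at the image point and at the source point respectively.
    refine ⟨c + Real.log (D.factor (F.toFun s p)) - Real.log (D.factor p), fun v => ?_⟩
    have hgerm : D.extend (F.toFun s) ∘ D.e =ᶠ[𝓝 p] D.e ∘ F.toFun s := by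
      filter_upwards [Metric.isOpen_ball.mem_nhds hpb] with z hz
      exact D.extend_apply _ hz
    have hde : MDifferentiableAt 𝓘(ℝ, StdSpace n) (𝓡 (2 * n + 1)) D.e p :=
      mdifferentiableAt_of_contMDiffOn_ball D.smooth hpb
    have h1 : ∀ u : StdSpace n, pullForm α (D.extend (F.toFun s)) (D.e p)
        (mfderiv 𝓘(ℝ, StdSpace n) (𝓡 (2 * n + 1)) D.e p u) =
        D.factor (F.toFun s p) * (Real.exp c * stdForm n p u) := by
      intro u
      have h2 := pullParam_congr α hgerm
      rw [pullParam_comp α (G := D.e) (mdifferentiableAt_of_contMDiffOn_ball D.smooth hθp)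
        (F.differentiable s p)] at h2
      have h3 : _ = (pullParam α D.e (F.toFun s p)) (fderiv ℝ (F.toFun s) p u) :=
        DFunLike.congr_fun h2 u
      rw [D.pullParam_eq _ hθp, hc] at h3
      rw [← h3]
      have h4 := mfderiv_comp p ((hslice s).mdifferentiableAt (x := D.e p) (by simp)) hde
      exact α.form_congr rfl (DFunLike.congr_fun h4 u).symm
    have hd' : MDifferentiableAt (𝓡 (2 * n + 1)) 𝓘(ℝ, StdSpace n) D.e.symm q :=
      (D.smooth_symm.contMDiffAt (D.e.open_target.mem_nhds h)).mdifferentiableAt (by simp)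
    have hinv : mfderiv 𝓘(ℝ, StdSpace n) (𝓡 (2 * n + 1)) D.e p
        (mfderiv (𝓡 (2 * n + 1)) 𝓘(ℝ, StdSpace n) D.e.symm q v) = v := by
      have h5 : D.e ∘ D.e.symm =ᶠ[𝓝 q] id := by
        filter_upwards [D.e.open_target.mem_nhds h] with z hz using D.e.right_inv hz
      have h6 := mfderiv_comp q (g := D.e) (f := D.e.symm) hde hd'
      rw [h5.mfderiv_eq, mfderiv_id] at h6
      exact (DFunLike.congr_fun h6 v).symm
    set u : StdSpace n := mfderiv (𝓡 (2 * n + 1)) 𝓘(ℝ, StdSpace n) D.e.symm q v with hu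
    have h7 : α.form q v = D.factor p * stdForm n p u := by
      rw [← D.pullParam_eq p hpb]
      exact α.form_congr hpq.symm hinv.symm
    have h8 : α.form (D.extend (F.toFun s) q)
        (mfderiv (𝓡 (2 * n + 1)) (𝓡 (2 * n + 1)) (D.extend (F.toFun s)) q v) =
        D.factor (F.toFun s p) * (Real.exp c * stdForm n p u) := by
      rw [← h1 u]
      refine α.form_congr (congrArg _ hpq.symm) ?_
      have h9 := congrArg (fun z => (mfderiv (𝓡 (2 * n + 1)) (𝓡 (2 * n + 1))
        (D.extend (F.toFun s)) z : Model n →L[ℝ] Model n) v) hpq.symm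
      exact h9.trans (congrArg (mfderiv (𝓡 (2 * n + 1)) (𝓡 (2 * n + 1))
        (D.extend (F.toFun s)) (D.e p)) hinv.symm)
    refine h8.trans ?_
    rw [h7, Real.exp_sub, Real.exp_add, Real.exp_log (D.factor_pos _ hθp),
      Real.exp_log (D.factor_pos _ hpb)]
    have : D.factor p ≠ 0 := (D.factor_pos _ hpb).ne'
    field_simp
  · have hq : q ∉ D.e '' Metric.closedBall 0 r₂ := by
      rintro ⟨p, hp, rfl⟩
      exact h (D.mem_target (Metric.closedBall_subset_ball hr hp))
    have hev : D.extend (F.toFun s) =ᶠ[𝓝 q] id := by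
      filter_upwards [(D.isCompact_image hr).isClosed.isOpen_compl.mem_nhds hq] with x hx
      exact hfix s x hx
    refine ⟨0, fun v => ?_⟩
    rw [Real.exp_zero, one_mul]
    refine α.form_congr hev.self_of_nhds ?_
    have h1 := hev.mfderiv_eq (I := 𝓡 (2 * n + 1)) (I' := 𝓡 (2 * n + 1))
    rw [mfderiv_id] at h1
    exact congrArg (fun T : Model n →L[ℝ] Model n => T v) h1

end DarbouxChart

end ContactGeometry

/-! ### Regularity and embeddedness of contact isotopies -/

namespace ContactGeometry

/-- The unit vector field on the unit interval is smooth. -/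
theorem contMDiff_one_unitInterval : ContMDiff (𝓡∂ 1) (𝓡∂ 1).tangent ∞
    (fun t : unitInterval => (⟨t, 1⟩ : TangentBundle (𝓡∂ 1) unitInterval)) := by
  have h1 : ContMDiff 𝓘(ℝ, ℝ) 𝓘(ℝ, ℝ).tangent ∞
      (fun s : ℝ => (⟨s, (1 : ℝ)⟩ : TangentBundle 𝓘(ℝ, ℝ) ℝ)) := by
    refine SmoothFlow.contMDiff_of_fieldInChart (I := 𝓘(ℝ, ℝ)) (X := fun _ => (1 : ℝ)) fun x₀ => ?_
    have hchart : ∀ (κ : PartialEquiv ℝ ℝ), κ = PartialEquiv.refl _ → ∀ y,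
        mfderiv 𝓘(ℝ, ℝ) 𝓘(ℝ, ℝ) κ (κ.symm y) (1 : ℝ) = (1 : ℝ) := by
      rintro _ rfl y
      exact DFunLike.congr_fun (mfderiv_id (I := 𝓘(ℝ, ℝ)) (x := y)) (1 : ℝ)
    have : SmoothFlow.fieldInChart (I := 𝓘(ℝ, ℝ)) (fun _ : ℝ => (1 : ℝ)) x₀ = fun _ => (1 : ℝ) :=
      funext fun y => hchart _ (extChartAt_model_space_eq_id _ x₀) y
    rw [this]
    exact contDiffOn_const
  rw [← contMDiffOn_comp_projIcc_iff (x := (0 : ℝ)) (y := 1)]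
  have h2 := (contMDiffOn_projIcc (x := (0 : ℝ)) (y := 1) (n := ∞)).contMDiffOn_tangentMapWithin
    (m := ∞) (by simp) (uniqueMDiffOn_iff_uniqueDiffOn.2 (uniqueDiffOn_Icc one_pos))
  refine (h2.comp h1.contMDiffOn fun s hs => hs).congr fun s hs => ?_
  simp only [Function.comp_apply, tangentMapWithin]
  congr 1
  exact (mfderivWithin_projIcc_one hs).symm

variable {n : ℕ} {M : Type*} [TopologicalSpace M] [ChartedSpace (Model n) M]
  [IsManifold (𝓡 (2 * n + 1)) ∞ M] {α : ContactForm n M}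

namespace ContactIsotopy

theorem contMDiff_uncurry (φ : ContactIsotopy α) :
    ContMDiff ((𝓡∂ 1).prod (𝓡 (2 * n + 1))) (𝓡 (2 * n + 1)) ∞
      (fun x : unitInterval × M => φ.1 x.1 x.2) := φ.2.1.1

theorem contMDiff_orbit (φ : ContactIsotopy α) (q : M) :
    ContMDiff (𝓡∂ 1) (𝓡 (2 * n + 1)) ∞ (fun t => φ.1 t q) :=
  (contMDiff_uncurry φ).comp (contMDiff_id.prodMk contMDiff_const)

theorem exp_conformalFactor (φ : ContactIsotopy α) (t : unitInterval) (q : M)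
    (v : TangentSpace (𝓡 (2 * n + 1)) q) :
    pullForm α (φ.1 t) q v = Real.exp (conformalFactor α (φ.1 t) q) * α.form q v := by
  have h : ∃ c, ScalesAt α (φ.1 t) q c := φ.2.1.2.2.1 t q
  rw [conformalFactor, dif_pos h]
  exact h.choose_spec v

/-- The derivative of the isotopy in both variables. -/
theorem mfderiv_apply (φ : ContactIsotopy α) (t : unitInterval) (q : M)
    (a : TangentSpace (𝓡∂ 1) t) (v : TangentSpace (𝓡 (2 * n + 1)) q) :
    (mfderiv ((𝓡∂ 1).prod (𝓡 (2 * n + 1))) (𝓡 (2 * n + 1))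
      (fun x : unitInterval × M => φ.1 x.1 x.2) (t, q) (a, v) : Model n) =
    (mfderiv (𝓡∂ 1) (𝓡 (2 * n + 1)) (fun s => φ.1 s q) t a : Model n) +
      (mfderiv (𝓡 (2 * n + 1)) (𝓡 (2 * n + 1)) (φ.1 t) q v : Model n) :=
  mfderiv_prod_eq_add_apply ((contMDiff_uncurry φ).mdifferentiableAt (by simp))

/-- The contact form, evaluated on the image of a smooth vector field on the domain of the
isotopy. -/
theorem contMDiff_form_mfderiv (φ : ContactIsotopy α)
    {a : ∀ t : unitInterval, TangentSpace (𝓡∂ 1) t} {v : ∀ q : M, TangentSpace (𝓡 (2 * n + 1)) q}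
    (ha : ContMDiff (𝓡∂ 1) (𝓡∂ 1).tangent ∞
      (fun t : unitInterval => (⟨t, a t⟩ : TangentBundle (𝓡∂ 1) unitInterval)))
    (hv : ContMDiff (𝓡 (2 * n + 1)) (𝓡 (2 * n + 1)).tangent ∞
      (fun q => (⟨q, v q⟩ : TangentBundle (𝓡 (2 * n + 1)) M))) :
    ContMDiff ((𝓡∂ 1).prod (𝓡 (2 * n + 1))) 𝓘(ℝ, ℝ) ∞ (fun x : unitInterval × M =>
      α.form (φ.1 x.1 x.2) (mfderiv ((𝓡∂ 1).prod (𝓡 (2 * n + 1))) (𝓡 (2 * n + 1))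
        (fun x : unitInterval × M => φ.1 x.1 x.2) x (a x.1, v x.2))) := by
  have h1 : ContMDiff ((𝓡∂ 1).prod (𝓡 (2 * n + 1))) (((𝓡∂ 1).prod (𝓡 (2 * n + 1))).tangent) ∞
      (fun x : unitInterval × M => (equivTangentBundleProd (𝓡∂ 1) unitInterval
        (𝓡 (2 * n + 1)) M).symm (⟨x.1, a x.1⟩, ⟨x.2, v x.2⟩)) :=
    contMDiff_equivTangentBundleProd_symm.comp
      ((ha.comp contMDiff_fst).prodMk (hv.comp contMDiff_snd))
  have h2 := ((contMDiff_uncurry φ).contMDiff_tangentMap (m := ∞) (by simp)).comp h1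
  intro x
  exact α.contMDiffWithinAt_apply (b := fun x : unitInterval × M => φ.1 x.1 x.2)
    (h2.contMDiffAt (x := x)).contMDiffWithinAt

theorem continuous_form_velocity (φ : ContactIsotopy α) :
    Continuous fun x : unitInterval × M => α.form (φ.1 x.1 x.2) (velocity φ x.1 x.2) := by
  have h := (contMDiff_form_mfderiv φ contMDiff_one_unitInterval
    (v := fun _ => 0) (Bundle.contMDiff_zeroSection ℝ
      (TangentSpace (𝓡 (2 * n + 1)) : M → Type _))).continuous
  refine h.congr fun x => ?_
  refine α.form_congr rfl ((mfderiv_apply φ x.1 x.2 1 0).trans ?_)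
  rw [map_zero]
  exact add_zero _

/-- Evaluating φ_t^*α = e^g α on the Reeb field gives e^g as the form applied to a smooth vector
field along the isotopy; then take logarithms. -/
theorem contMDiff_conformalFactor (φ : ContactIsotopy α) :
    ContMDiff ((𝓡∂ 1).prod (𝓡 (2 * n + 1))) 𝓘(ℝ, ℝ) ∞
      (fun x : unitInterval × M => conformalFactor α (φ.1 x.1) x.2) := by
  have h := contMDiff_form_mfderiv φ (a := fun _ => 0) (Bundle.contMDiff_zeroSection ℝ
      (TangentSpace (𝓡∂ 1) : unitInterval → Type _))
    (SmoothFlow.contMDiff_of_fieldInChart (contDiffOn_fieldInChart_reeb α))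
  have hexp : ∀ x : unitInterval × M, α.form (φ.1 x.1 x.2)
      (mfderiv ((𝓡∂ 1).prod (𝓡 (2 * n + 1))) (𝓡 (2 * n + 1))
        (fun x : unitInterval × M => φ.1 x.1 x.2) x (0, reeb α x.2)) =
      Real.exp (conformalFactor α (φ.1 x.1) x.2) := by
    intro x
    have h1 := exp_conformalFactor φ x.1 x.2 (reeb α x.2)
    rw [form_reeb, mul_one] at h1
    rw [← h1]
    refine α.form_congr rfl ((mfderiv_apply φ x.1 x.2 0 (reeb α x.2)).trans ?_)
    rw [map_zero]
    exact zero_add _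
  intro x
  have h2 : ContMDiffAt 𝓘(ℝ, ℝ) 𝓘(ℝ, ℝ) ∞ Real.log
      (Real.exp (conformalFactor α (φ.1 x.1) x.2)) :=
    (Real.contDiffAt_log.2 (Real.exp_pos _).ne').contMDiffAt
  rw [← hexp] at h2
  refine (ContMDiffAt.comp x h2 h.contMDiffAt).congr_of_eventuallyEq ?_
  refine Filter.Eventually.of_forall fun y => ?_
  exact (Real.log_exp _).symm.trans (congrArg Real.log (hexp y).symm)

theorem continuous_graphMap (φ : ContactIsotopy α) : Continuous (graphMap φ) :=
  continuous_snd.prodMk ((contMDiff_uncurry φ).continuous.prodMk (contMDiff_conformalFactor φ).continuous)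

/-- An isotopy that is transverse to the contact structure and whose orbits are injective is
embedded. -/
theorem isEmbeddedIsotopy [T2Space M] (φ : ContactIsotopy α)
    (hne : ∀ t, ∀ q ∈ testRegion φ, α.form (φ.1 t q) (velocity φ t q) ≠ 0)
    (hinj : ∀ q ∈ testRegion φ, Function.Injective fun t => φ.1 t q) : IsEmbeddedIsotopy φ := by
  refine ⟨?_, fun t q hq => ?_⟩
  · have hcont : Continuous
        ((univ ×ˢ testRegion φ : Set (unitInterval × M)).domRestrict (graphMap φ)) :=
      (continuous_graphMap φ).comp continuous_subtype_val
    refine ⟨Topology.isInducing_iff_nhds.2 fun x => le_antisymm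
      (hcont.tendsto x).le_comap (Filter.le_iff_ultrafilter.2 fun g hg => ?_), ?_⟩
    · have hf := Filter.tendsto_iff_comap.2 hg
      have hf1 : Filter.Tendsto (fun y : (univ ×ˢ testRegion φ : Set (unitInterval × M)) => y.1.2)
          g (𝓝 x.1.2) := (continuous_fst.tendsto _).comp hf
      have hf2 : Filter.Tendsto (fun y : (univ ×ˢ testRegion φ : Set (unitInterval × M)) =>
          φ.1 y.1.1 y.1.2) g (𝓝 (φ.1 x.1.1 x.1.2)) :=
        ((continuous_fst.comp continuous_snd).tendsto _).comp hf
      -- Convergence of the images controls the point q but not the time. Compactness of [0,1]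
      -- provides a limit time, and injectivity of the orbit of the limit point identifies it.
      obtain ⟨t', -, ht'⟩ := isCompact_univ.ultrafilter_le_nhds
        (g.map fun y : (univ ×ˢ testRegion φ : Set (unitInterval × M)) => y.1.1) (by simp)
      have hf0 : Filter.Tendsto (fun y : (univ ×ˢ testRegion φ : Set (unitInterval × M)) => y.1)
          g (𝓝 (t', x.1.2)) := Filter.Tendsto.prodMk_nhds ht' hf1
      have ht : t' = x.1.1 := hinj _ x.2.2
        (tendsto_nhds_unique (((contMDiff_uncurry φ).continuous.tendsto _).comp hf0) hf2)
      rw [ht] at hf0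
      rw [nhds_subtype_eq_comap]
      exact Filter.tendsto_iff_comap.1 hf0
    · rintro ⟨⟨t, q⟩, hq⟩ ⟨⟨t', q'⟩, hq'⟩ h
      obtain rfl : q = q' := congrArg Prod.fst h
      obtain rfl : t = t' := hinj q hq.2 (congrArg (fun z => z.2.1) h)
      rfl
  · have h1 : MDifferentiableAt ((𝓡∂ 1).prod (𝓡 (2 * n + 1))) (𝓡 (2 * n + 1))
      (fun x : unitInterval × M => φ.1 x.1 x.2) (t, q) := (contMDiff_uncurry φ).mdifferentiableAt (by simp)
    have h2 : MDifferentiableAt ((𝓡∂ 1).prod (𝓡 (2 * n + 1))) 𝓘(ℝ, ℝ)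
        (fun x : unitInterval × M => conformalFactor α (φ.1 x.1) x.2) (t, q) :=
      (contMDiff_conformalFactor φ).mdifferentiableAt (by simp)
    have h3 : MDifferentiableAt ((𝓡∂ 1).prod (𝓡 (2 * n + 1))) (𝓡 (2 * n + 1))
      (Prod.snd : unitInterval × M → M) (t, q) := mdifferentiableAt_snd
    have hd := mfderiv_prodMk h3 (h1.prodMk h2)
    rw [mfderiv_prodMk h1 h2] at hd
    -- The component q of the graph map forces the spatial part of a kernel vector to vanish; the
    -- next component then annihilates a multiple of the velocity, which is nonzero by
    -- transversality.
    have hz : ∀ y : TangentSpace ((𝓡∂ 1).prod (𝓡 (2 * n + 1))) (t, q),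
        mfderiv ((𝓡∂ 1).prod (𝓡 (2 * n + 1)))
          ((𝓡 (2 * n + 1)).prod ((𝓡 (2 * n + 1)).prod 𝓘(ℝ, ℝ))) (graphMap φ) (t, q) y = 0 →
        y = 0 := by
      rintro ⟨a, v⟩ hy
      have hy' := (DFunLike.congr_fun hd (a, v)).symm.trans hy
      have e1 : v = 0 := by
        have := congrArg Prod.fst hy'
        rw [mfderiv_snd] at this
        exact this
      have e2 : (mfderiv (𝓡∂ 1) (𝓡 (2 * n + 1)) (fun s => φ.1 s q) t a : Model n) = 0 := by
        have h4 := congrArg (fun z => z.2.1) hy'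
        have h5 := (mfderiv_apply φ t q a v).symm.trans h4
        subst e1
        have h6 : (mfderiv (𝓡 (2 * n + 1)) (𝓡 (2 * n + 1)) (φ.1 t) q 0 : Model n) = 0 :=
          map_zero (mfderiv (𝓡 (2 * n + 1)) (𝓡 (2 * n + 1)) (φ.1 t) q)
        exact (add_zero _).symm.trans ((congrArg (fun w : Model n => _ + w) h6.symm).trans h5)
      have hvel := hne t q hq
      have hone : (1 : TangentSpace (𝓡∂ 1) t) ≠ 0 := by
        intro h0
        refine hvel ?_
        rw [velocity, h0, map_zero, map_zero]
      obtain ⟨c, hc⟩ := exists_smul_eq_of_finrank_eq_one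
        (K := ℝ) (V := EuclideanSpace ℝ (Fin 1)) finrank_euclideanSpace_fin hone a
      have e3 : c * α.form (φ.1 t q) (velocity φ t q) = 0 := by
        rw [← smul_eq_mul, ← map_smul, velocity, ← map_smul]
        have h7 := (congrArg (mfderiv (𝓡∂ 1) (𝓡 (2 * n + 1)) (fun s => φ.1 s q) t) hc).trans e2
        exact (congrArg (α.form (φ.1 t q)) h7).trans (map_zero _)
      have hc0 : c = 0 := (mul_eq_zero.1 e3).resolve_right hvel
      have ha : a = 0 := by rw [← hc, hc0]; exact zero_smul ℝ _
      rw [ha, e1]; rfl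
    intro y y' hyy
    refine sub_eq_zero.1 (hz _ ?_)
    rw [map_sub, hyy, sub_self]

end ContactIsotopy

end ContactGeometry

/-! ### Positivity of products and inverses; word norms -/

namespace ContactGeometry

variable {n : ℕ} {M : Type*} [TopologicalSpace M] [ChartedSpace (Model n) M]
  [IsManifold (𝓡 (2 * n + 1)) ∞ M] {α : ContactForm n M}

namespace ContactIsotopy

/-- The rate at which the orbit of a point moves transversely to the contact structure. -/
def transverseSpeed (φ : ContactIsotopy α) (t : unitInterval) (q : M) : ℝ :=
  α.form (φ.1 t q) (velocity φ t q)

theorem velocity_mul (φ ψ : ContactIsotopy α) (t : unitInterval) (q : M) :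
    (velocity (φ * ψ) t q : Model n) = (velocity φ t (ψ.1 t q) : Model n) +
      (mfderiv (𝓡 (2 * n + 1)) (𝓡 (2 * n + 1)) (φ.1 t) (ψ.1 t q) (velocity ψ t q) : Model n) := by
  have h1 : MDifferentiableAt ((𝓡∂ 1).prod (𝓡 (2 * n + 1))) (𝓡 (2 * n + 1))
      (fun x : unitInterval × M => φ.1 x.1 x.2) (t, ψ.1 t q) :=
    (contMDiff_uncurry φ).mdifferentiableAt (by simp)
  have h2 : MDifferentiableAt (𝓡∂ 1) (𝓡 (2 * n + 1)) (fun s => ψ.1 s q) t :=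
    (contMDiff_orbit ψ q).mdifferentiableAt (by simp)
  have h3 : MDifferentiableAt (𝓡∂ 1) (𝓡∂ 1) (id : unitInterval → unitInterval) t :=
    mdifferentiableAt_id
  have h4 := mfderiv_comp (g := fun x : unitInterval × M => φ.1 x.1 x.2)
    (f := fun s : unitInterval => (id s, ψ.1 s q)) t h1 (h3.prodMk h2)
  rw [mfderiv_prodMk h3 h2, mfderiv_id] at h4
  exact (DFunLike.congr_fun h4 1).trans (mfderiv_apply φ t (ψ.1 t q) 1 (velocity ψ t q))

/-- The product rule, where the velocity of ψ is pushed forward by φ_t and its transverse part is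
therefore multiplied by e^g. A bounded first term can be outweighed by making ψ fast. -/
theorem transverseSpeed_mul (φ ψ : ContactIsotopy α) (t : unitInterval) (q : M) :
    transverseSpeed (φ * ψ) t q = transverseSpeed φ t (ψ.1 t q) +
      Real.exp (conformalFactor α (φ.1 t) (ψ.1 t q)) * transverseSpeed ψ t q := by
  refine (α.form_congr (q' := φ.1 t (ψ.1 t q)) rfl (velocity_mul φ ψ t q)).trans ?_
  refine (map_add (α.form (φ.1 t (ψ.1 t q))) (velocity φ t (ψ.1 t q)) _).trans ?_
  congr 1
  exact exp_conformalFactor φ t (ψ.1 t q) (velocity ψ t q)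

theorem transverseSpeed_one (t : unitInterval) (q : M) :
    transverseSpeed (1 : ContactIsotopy α) t q = 0 := by
  have : velocity (1 : ContactIsotopy α) t q = 0 := by
    have h : mfderiv (𝓡∂ 1) (𝓡 (2 * n + 1)) (fun _ : unitInterval => q) t = 0 := mfderiv_const
    exact DFunLike.congr_fun h 1
  rw [transverseSpeed, this, map_zero]

theorem transverseSpeed_eq_zero {φ : ContactIsotopy α} {q : M} (h : ∀ t, φ.1 t q = q)
    (t : unitInterval) : transverseSpeed φ t q = 0 := by
  have : velocity φ t q = 0 := by
    have h1 : (fun s : unitInterval => φ.1 s q) = fun _ => q := funext h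
    rw [velocity, h1, mfderiv_const]
    rfl
  rw [transverseSpeed, this, map_zero]

theorem transverseSpeed_inv (φ : ContactIsotopy α) (t : unitInterval) (q : M) :
    transverseSpeed φ t ((φ.1 t)⁻¹ q) =
      -(Real.exp (conformalFactor α (φ.1 t) ((φ.1 t)⁻¹ q)) * transverseSpeed φ⁻¹ t q) := by
  have h := transverseSpeed_mul φ φ⁻¹ t q
  rw [mul_inv_cancel, transverseSpeed_one] at h
  exact eq_neg_of_add_eq_zero_left h.symm

/-- The interior of the support may contain points that are never moved. The regularity condition on
`W` keeps such points inside `W`, where positivity is known; in the compact case the test region is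
everything. -/
theorem testRegion_subset (φ : ContactIsotopy α) {W : Set M} (hW : ∀ t, ∀ q ∉ W, φ.1 t q = q)
    (hc : CompactSpace M → W = univ) (hi : interior (closure W) ⊆ W) : testRegion φ ⊆ W := by
  rintro q (h | h)
  · rw [hc h]; trivial
  · refine hi (interior_mono (closure_mono ?_) h)
    rintro x ⟨t, ht⟩
    by_contra hx
    exact ht (hW t x hx)

variable [T2Space M]

/-- The inverse of a positive isotopy with injective orbits is negative and embedded. -/
theorem inv_mem_negativeEmbedded (Ψ : ContactIsotopy α) {W : Set M}
    (hW : ∀ t, ∀ q ∉ W, Ψ.1 t q = q) (hc : CompactSpace M → W = univ)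
    (hi : interior (closure W) ⊆ W) (hpos : ∀ t, ∀ q ∈ W, 0 < transverseSpeed Ψ t q)
    (hinj : ∀ q ∈ W, Function.Injective fun t => Ψ.1 t q) :
    homotopyClass α Ψ⁻¹ ∈ negativeEmbedded α := by
  have hinv : ∀ t q, (Ψ⁻¹).1 t q = (Ψ.1 t)⁻¹ q := fun _ _ => rfl
  have hW' : ∀ t, ∀ q ∉ W, (Ψ⁻¹).1 t q = q := fun t q hq => by
    rw [hinv, Equiv.Perm.inv_eq_iff_eq, hW t q hq]
  have hsub := testRegion_subset Ψ⁻¹ hW' hc hi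
  have hmem : ∀ t, ∀ q ∈ W, (Ψ.1 t)⁻¹ q ∈ W := fun t q hq => by
    by_contra h
    have h1 := hW t _ h
    rw [Equiv.Perm.eq_inv_iff_eq.1 (rfl : (Ψ.1 t)⁻¹ q = _)] at h1
    exact h (h1 ▸ hq)
  have hneg : ∀ t, ∀ q ∈ W, transverseSpeed Ψ⁻¹ t q < 0 := fun t q hq => by
    have h1 := hpos t _ (hmem t q hq)
    rw [transverseSpeed_inv] at h1
    by_contra! h2
    have := mul_nonneg (Real.exp_pos (conformalFactor α (Ψ.1 t) ((Ψ.1 t)⁻¹ q))).le h2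
    linarith
  refine ⟨Ψ⁻¹, rfl, isEmbeddedIsotopy Ψ⁻¹ (fun t q hq => (hneg t q (hsub hq)).ne) ?_,
    fun t q hq => hneg t q (hsub hq)⟩
  intro q hq t t' h
  simp only [hinv] at h
  refine hinj _ (hmem t q (hsub hq)) ?_
  show Ψ.1 t ((Ψ.1 t)⁻¹ q) = Ψ.1 t' ((Ψ.1 t)⁻¹ q)
  rw [Equiv.Perm.eq_inv_iff_eq.1 (rfl : (Ψ.1 t)⁻¹ q = _), h,
    Equiv.Perm.eq_inv_iff_eq.1 (rfl : (Ψ.1 t')⁻¹ q = _)]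

/-- A criterion for a product with a sufficiently positive isotopy to be positive and embedded. -/
theorem mul_mem_positiveEmbedded (φ Ψ : ContactIsotopy α) {K W : Set M}
    (hφ : ∀ t, ∀ q ∉ K, φ.1 t q = q) (hKW : K ⊆ W)
    (hW : ∀ t, ∀ q ∉ W, Ψ.1 t q = q) (hc : CompactSpace M → W = univ)
    (hi : interior (closure W) ⊆ W) (hpos : ∀ t, ∀ q ∈ W, 0 < transverseSpeed Ψ t q)
    (hinj : ∀ q ∈ W, Function.Injective fun t => Ψ.1 t q)
    (hK : ∀ t q, Ψ.1 t q ∈ K → 0 < transverseSpeed (φ * Ψ) t q)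
    (hK' : ∀ t t' q, t < t' → Ψ.1 t q ∈ K → Ψ.1 t' q ∈ K →
      φ.1 t (Ψ.1 t q) ≠ φ.1 t' (Ψ.1 t' q)) :
    homotopyClass α (φ * Ψ) ∈ positiveEmbedded α := by
  have hmul : ∀ t q, (φ * Ψ).1 t q = φ.1 t (Ψ.1 t q) := fun _ _ => rfl
  have hsub : testRegion (φ * Ψ) ⊆ W := testRegion_subset _ (fun t q hq => by
    rw [hmul, hW t q hq, hφ t q fun h => hq (hKW h)]) hc hi
  have hpos' : ∀ t, ∀ q ∈ W, 0 < transverseSpeed (φ * Ψ) t q := fun t q hq => by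
    by_cases h : Ψ.1 t q ∈ K
    · exact hK t q h
    · rw [transverseSpeed_mul, transverseSpeed_eq_zero (fun s => hφ s _ h), zero_add]
      exact mul_pos (Real.exp_pos _) (hpos t q hq)
  have hlt : ∀ t t' : unitInterval, t < t' → ∀ q ∈ W, (φ * Ψ).1 t q ≠ (φ * Ψ).1 t' q := by
    intro t t' htt q hq h
    rw [hmul, hmul] at h
    have hne : Ψ.1 t q ≠ Ψ.1 t' q := fun he => htt.ne (hinj q hq he)
    -- A point outside `K` is fixed by φ at every time, so if one of the two points is outside `K`,
    -- both sides can be written with the same φ_t, and its injectivity reduces the equation to the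
    -- orbit of Ψ.
    by_cases h1 : Ψ.1 t q ∈ K
    · by_cases h2 : Ψ.1 t' q ∈ K
      · exact hK' t t' q htt h1 h2 h
      · rw [hφ t' _ h2, ← hφ t _ h2] at h
        exact hne ((φ.1 t).injective h)
    · rw [hφ t _ h1, ← hφ t' _ h1] at h
      exact hne ((φ.1 t').injective h)
  refine ⟨φ * Ψ, rfl, isEmbeddedIsotopy _ (fun t q hq => (hpos' t q (hsub hq)).ne') ?_,
    fun t q hq => hpos' t q (hsub hq)⟩
  intro q hq t t' h
  rcases lt_trichotomy t t' with hlt' | heq | hgt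
  · exact (hlt t t' hlt' q (hsub hq) h).elim
  · exact heq
  · exact (hlt t' t hgt q (hsub hq) h.symm).elim

end ContactIsotopy

/-- If every generator of a first set is a product of two generators of a second set, then the
second word norm is at most twice the first. -/
theorem wordNorm_le_two_mul {G : Type*} [Group G] {S D : Set G} (h : D ⊆ S ^ 2) (g : G) :
    wordNorm S g ≤ 2 * wordNorm D g := by
  by_cases hD : {k : ℕ∞ | ∃ m : ℕ, k = m ∧ g ∈ D ^ m}.Nonempty
  · obtain ⟨m, hm, hg⟩ := csInf_mem hD
    have h1 : wordNorm D g = m := hm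
    rw [h1]
    refine sInf_le ⟨2 * m, by push_cast; rfl, ?_⟩
    rw [pow_mul]
    exact Set.pow_subset_pow_left h hg
  · have h1 : wordNorm D g = ⊤ := by
      rw [wordNorm, Set.not_nonempty_iff_eq_empty.1 hD, sInf_empty]
    rw [h1]
    simp

end ContactGeometry

/-! ### Speed and displacement of contact flows; conjugation -/

namespace ContactGeometry

/-- If the derivative of a function in a given direction is positive, then the function increases
at a definite rate in this direction, locally uniformly. -/
theorem exists_mul_le_sub_of_deriv_pos {E : Type*} [NormedAddCommGroup E] [NormedSpace ℝ E]
    {F : ℝ × E → ℝ} {y₀ : E} (hF : ContDiffAt ℝ ∞ F (0, y₀))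
    (hd : 0 < deriv (fun s => F (s, y₀)) 0) :
    ∃ ε > 0, ∃ m > 0, ∀ᶠ y in 𝓝 y₀, ∀ s ∈ Icc 0 ε, m * s ≤ F (s, y) - F (0, y) := by
  have hev : ∀ᶠ p in 𝓝 ((0 : ℝ), y₀), ContDiffAt ℝ 1 F p :=
    (hF.of_le (by simp : (1 : ℕ∞ω) ≤ ∞)).eventually (by simp)
  have hi : ∀ (z : E) (s : ℝ), HasDerivAt (fun τ : ℝ => (τ, z)) ((1 : ℝ), (0 : E)) s :=
    fun z s => (hasDerivAt_id s).prodMk (hasDerivAt_const s z)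
  have hpart : ∀ p : ℝ × E, DifferentiableAt ℝ F p →
      HasDerivAt (fun τ => F (τ, p.2)) (fderiv ℝ F p (1, 0)) p.1 := fun p hp =>
    HasFDerivAt.comp_hasDerivAt (l := F) (f := fun τ : ℝ => (τ, p.2)) p.1 hp.hasFDerivAt (hi p.2 p.1)
  have hd0 := (hpart _ (hev.self_of_nhds.differentiableAt (by simp))).deriv
  simp only at hd0
  rw [hd0] at hd
  set m := fderiv ℝ F (0, y₀) (1, 0) / 2 with hm
  have hcont : ContinuousAt (fun p => fderiv ℝ F p (1, 0)) ((0 : ℝ), y₀) :=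
    ((hF.fderiv_right (m := 0) (by simp)).continuousAt).clm_apply continuousAt_const
  have hgt : ∀ᶠ p in 𝓝 ((0 : ℝ), y₀), m < fderiv ℝ F p (1, 0) :=
    hcont.eventually (lt_mem_nhds (by rw [hm]; linarith))
  have hall := hev.and hgt
  rw [nhds_prod_eq] at hall
  obtain ⟨pa, hpa, pb, hpb, hab⟩ := Filter.eventually_prod_iff.1 hall
  obtain ⟨ε, hε, hball⟩ := Metric.eventually_nhds_iff.1 hpa
  refine ⟨ε / 2, by positivity, m, by positivity, hpb.mono fun y hy s hs => ?_⟩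
  have hin : ∀ τ ∈ Icc (0 : ℝ) (ε / 2), HasDerivAt (fun τ => F (τ, y)) (fderiv ℝ F (τ, y) (1, 0)) τ ∧
      m < fderiv ℝ F (τ, y) (1, 0) := by
    intro τ hτ
    have h1 : pa τ := hball (by
      rw [Real.dist_eq, sub_zero, abs_of_nonneg hτ.1]; linarith [hτ.2])
    have h2 := hab h1 hy
    exact ⟨hpart (τ, y) (h2.1.differentiableAt (by simp)), h2.2⟩
  have := (convex_Icc (0 : ℝ) (ε / 2)).mul_sub_le_image_sub_of_le_deriv (f := fun τ => F (τ, y))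
    (C := m) (fun τ hτ => (hin τ hτ).1.continuousAt.continuousWithinAt)
    (fun τ hτ => (hin τ (interior_subset hτ)).1.differentiableAt.differentiableWithinAt)
    (fun τ hτ => by
      have := hin τ (interior_subset hτ)
      rw [this.1.deriv]; exact this.2.le)
    0 ⟨le_rfl, by positivity⟩ s hs hs.1
  simpa using this

/-- Fixed point sets are closed, and the complement of the closed ball is dense in the complement of
the open ball. The moved region can thus be taken open. -/
theorem StdFlow.eq_self_of_notMem_ball {n : ℕ} {r₂ : ℝ} (hr : r₂ ≠ 0) {H : StdSpace n → ℝ}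
    (F : StdFlow n r₂ H) (s : ℝ) {p : StdSpace n} (hp : p ∉ Metric.ball (0 : StdSpace n) r₂) :
    F.toFun s p = p := by
  have hcl : IsClosed {p | F.toFun s p = p} :=
    isClosed_eq (F.differentiable s).continuous continuous_id
  have hsub : closure (Metric.closedBall (0 : StdSpace n) r₂)ᶜ ⊆ {p | F.toFun s p = p} :=
    hcl.closure_subset_iff.2 fun p hp => F.eq_self s p hp
  rw [closure_compl, interior_closedBall _ hr] at hsub
  exact hsub hp

theorem StdFlow.apply_mem_ball {n : ℕ} {r₂ : ℝ} (hr : r₂ ≠ 0) {H : StdSpace n → ℝ}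
    (F : StdFlow n r₂ H) (s : ℝ) {p : StdSpace n} (hp : p ∈ Metric.ball (0 : StdSpace n) r₂) :
    F.toFun s p ∈ Metric.ball (0 : StdSpace n) r₂ := by
  by_contra hc
  have h := F.eq_self_of_notMem_ball hr (-s) hc
  rw [F.neg_apply] at h
  exact hc (h ▸ hp)

variable {n : ℕ} {M : Type*} [TopologicalSpace M] [ChartedSpace (Model n) M]
  [IsManifold (𝓡 (2 * n + 1)) ∞ M] {α : ContactForm n M}

namespace ContactFlow

theorem add_apply' (Ψ : ContactFlow α) (s t : ℝ) (q : M) :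
    Ψ.toFun (s + t) q = Ψ.toFun s (Ψ.toFun t q) := by
  rw [Ψ.map_add]; rfl

theorem zero_apply' (Ψ : ContactFlow α) (q : M) : Ψ.toFun 0 q = q := by
  rw [Ψ.map_zero]; rfl

theorem inv_toFun (Ψ : ContactFlow α) (s : ℝ) : (Ψ.toFun s)⁻¹ = Ψ.toFun (-s) := by
  rw [inv_eq_iff_mul_eq_one, ← Ψ.map_add, add_neg_cancel, Ψ.map_zero]

theorem smooth_slice (Ψ : ContactFlow α) (s : ℝ) :
    ContMDiff (𝓡 (2 * n + 1)) (𝓡 (2 * n + 1)) ∞ (Ψ.toFun s) :=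
  Ψ.smooth.comp (contMDiff_const.prodMk contMDiff_id)

theorem smooth_orbit (Ψ : ContactFlow α) (q : M) :
    ContMDiff 𝓘(ℝ, ℝ) (𝓡 (2 * n + 1)) ∞ (fun s => Ψ.toFun s q) :=
  Ψ.smooth.comp (contMDiff_id.prodMk contMDiff_const)

/-- The value of the contact form on the velocity of a contact flow. -/
def speed (Ψ : ContactFlow α) (q : M) : ℝ := pullParam α (fun s => Ψ.toFun s q) 0 1

theorem pullParam_orbit (Ψ : ContactFlow α) (q : M) (s a : ℝ) :
    pullParam α (fun τ => Ψ.toFun τ q) s a = a * Ψ.speed (Ψ.toFun s q) := by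
  have h1 : (fun τ => Ψ.toFun τ q) =
      (fun τ => Ψ.toFun τ (Ψ.toFun s q)) ∘ fun τ => τ - s := by
    funext τ
    simp only [Function.comp_apply]
    rw [← Ψ.add_apply', sub_add_cancel]
  rw [h1, pullParam_comp α (G := fun τ => Ψ.toFun τ (Ψ.toFun s q)) (τ := fun τ => τ - s) (y := s)
    ((Ψ.smooth_orbit _).mdifferentiableAt (by simp)) (by fun_prop), sub_self]
  have h2 : fderiv ℝ (fun τ : ℝ => τ - s) s = ContinuousLinearMap.id ℝ ℝ := by
    rw [fderiv_sub_const]; exact fderiv_id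
  rw [h2, ContinuousLinearMap.comp_id, speed, ← smul_eq_mul, ← map_smul, smul_eq_mul, mul_one]

theorem family_mem (Ψ : ContactFlow α) {f : unitInterval → ℝ}
    (hf : ContMDiff (𝓡∂ 1) 𝓘(ℝ, ℝ) ∞ f) :
    (fun t => Ψ.toFun (f t)) ∈ contactFamilies α (𝓡∂ 1) unitInterval := by
  obtain ⟨K, hK, hfix⟩ := Ψ.compact
  refine ⟨Ψ.smooth.comp ((hf.comp contMDiff_fst).prodMk contMDiff_snd), ?_,
    fun t q => Ψ.scales (f t) q, K, hK, fun t q hq => hfix (f t) q hq⟩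
  simp only [inv_toFun]
  have hf' : ContMDiff (𝓡∂ 1) 𝓘(ℝ, ℝ) ∞ fun t => -f t :=
    (contDiff_neg (𝕜 := ℝ) (F := ℝ)).contMDiff.comp hf
  exact Ψ.smooth.comp ((hf'.comp contMDiff_fst).prodMk contMDiff_snd)

theorem contMDiff_mul_unitInterval (ε : ℝ) :
    ContMDiff (𝓡∂ 1) 𝓘(ℝ, ℝ) ∞ fun t : unitInterval => ε * (t : ℝ) := by
  have h : ContDiff ℝ ∞ fun s : ℝ => ε * s := contDiff_const.mul contDiff_id
  exact h.contMDiff.comp contMDiff_subtypeVal_Icc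

/-- The contact isotopy generated by a rescaled flow, conjugated by a contactomorphism. -/
def conj (Ψ D : ContactFlow α) (σ ε : ℝ) : ContactIsotopy α :=
  ⟨(fun _ => D.toFun σ)⁻¹ * (fun t : unitInterval => Ψ.toFun (ε * (t : ℝ))) *
    fun _ => D.toFun σ,
    mul_mem (mul_mem (inv_mem (D.family_mem contMDiff_const))
      (Ψ.family_mem (contMDiff_mul_unitInterval ε))) (D.family_mem contMDiff_const), by
      ext q; simp [Ψ.map_zero]⟩

theorem conj_apply (Ψ D : ContactFlow α) (σ ε : ℝ) (t : unitInterval) (q : M) :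
    D.toFun σ ((conj Ψ D σ ε).1 t q) = Ψ.toFun (ε * t) (D.toFun σ q) :=
  (D.toFun σ).apply_symm_apply _

/-- Differentiate the conjugation relation in time and apply the form. Conjugating by a
contactomorphism that strongly contracts the form makes the isotopy fast: its speed is divided by
the contraction factor e^c. -/
theorem transverseSpeed_conj (Ψ D : ContactFlow α) (σ ε : ℝ) (t : unitInterval) (q : M) {c : ℝ}
    (hc : ScalesAt α (D.toFun σ) ((conj Ψ D σ ε).1 t q) c) :
    Real.exp c * ContactIsotopy.transverseSpeed (conj Ψ D σ ε) t q =
      ε * Ψ.speed (D.toFun σ ((conj Ψ D σ ε).1 t q)) := by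
  set γ : ℝ → M := fun s => Ψ.toFun s (D.toFun σ q) with hγ
  set f : unitInterval → ℝ := fun t => ε * (t : ℝ) with hf
  have hfd : MDifferentiableAt (𝓡∂ 1) 𝓘(ℝ, ℝ) f t :=
    (contMDiff_mul_unitInterval ε).mdifferentiableAt (by simp)
  have h1 : (D.toFun σ ∘ fun s => (conj Ψ D σ ε).1 s q) = γ ∘ f :=
    funext fun s => conj_apply Ψ D σ ε s q
  have h2 := mfderiv_comp t
    ((D.smooth_slice σ).mdifferentiableAt (x := (conj Ψ D σ ε).1 t q) (by simp))
    ((ContactIsotopy.contMDiff_orbit (conj Ψ D σ ε) q).mdifferentiableAt (x := t) (by simp))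
  have h3 := mfderiv_comp t (g := γ) (f := f)
    ((Ψ.smooth_orbit _).mdifferentiableAt (by simp)) hfd
  have h4 : mfderiv (𝓡∂ 1) 𝓘(ℝ, ℝ) f t 1 = ε := by
    have h5 : HasMFDerivAt 𝓘(ℝ, ℝ) 𝓘(ℝ, ℝ) (fun s : ℝ => ε * s) (t : ℝ)
        (ε • ContinuousLinearMap.id ℝ ℝ) :=
      ((hasFDerivAt_id (𝕜 := ℝ) (t : ℝ)).const_mul ε).hasMFDerivAt
    have h6 : MDifferentiableAt (𝓡∂ 1) 𝓘(ℝ, ℝ) (Subtype.val : unitInterval → ℝ) t :=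
      (contMDiff_subtypeVal_Icc (n := 1) t).mdifferentiableAt one_ne_zero
    have h7 := (h5.comp t h6.hasMFDerivAt).mfderiv
    have h8 := DFunLike.congr_fun h7 1
    refine h8.trans ?_
    refine (congrArg (fun z : ℝ => ε * z) (mfderiv_subtypeVal_Icc_one t)).trans (mul_one ε)
  have h9 := hc (velocity (conj Ψ D σ ε) t q)
  refine h9.symm.trans ?_
  rw [congrArg Ψ.speed (conj_apply Ψ D σ ε t q), ← pullParam_orbit]
  refine α.form_congr (conj_apply Ψ D σ ε t q) ?_
  have h10 := (DFunLike.congr_fun h2 1).symm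
  refine h10.trans ?_
  have h11 : (mfderiv (𝓡∂ 1) (𝓡 (2 * n + 1)) (D.toFun σ ∘ fun s => (conj Ψ D σ ε).1 s q) t 1 :
      Model n) = (mfderiv (𝓡∂ 1) (𝓡 (2 * n + 1)) (γ ∘ f) t 1 : Model n) :=
    congrArg (fun g => (mfderiv (𝓡∂ 1) (𝓡 (2 * n + 1)) g t 1 : Model n)) h1
  refine h11.trans ((DFunLike.congr_fun h3 1).trans ?_)
  exact congrArg (mfderiv 𝓘(ℝ, ℝ) (𝓡 (2 * n + 1)) γ (f t)) h4

/-- A flow of positive speed at a point moves the nearby points at a definite rate. -/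
theorem exists_mul_le_sub {E' : Type*} [NormedAddCommGroup E'] [NormedSpace ℝ E']
    (Ψ : ContactFlow α) {e : E' → M} {e' : M → E'} {y₀ : E'}
    (he : ContMDiffAt 𝓘(ℝ, E') (𝓡 (2 * n + 1)) ∞ e y₀)
    (he' : ContMDiffAt (𝓡 (2 * n + 1)) 𝓘(ℝ, E') ∞ e' (e y₀)) (hl : e' (e y₀) = y₀)
    (hr : ∀ᶠ q in 𝓝 (e y₀), e (e' q) = q) (hs : 0 < Ψ.speed (e y₀)) :
    ∃ ε > 0, ∃ m > 0, ∀ᶠ y in 𝓝 y₀, ∀ s ∈ Icc 0 ε,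
      m * s ≤ pullParam α e y₀ (e' (Ψ.toFun s (e y))) - pullParam α e y₀ (e' (e y)) := by
  -- The contact form at the centre, frozen to a linear functional on the parameter space, is a
  -- coordinate whose derivative along the orbit of the centre at time 0 is the speed.
  set l := pullParam α e y₀ with hldef
  have hfst : ContMDiffAt 𝓘(ℝ, ℝ × E') 𝓘(ℝ, ℝ) ∞ (Prod.fst : ℝ × E' → ℝ) ((0 : ℝ), y₀) :=
    contDiff_fst.contMDiff.contMDiffAt
  have hsnd : ContMDiffAt 𝓘(ℝ, ℝ × E') 𝓘(ℝ, E') ∞ (Prod.snd : ℝ × E' → E') ((0 : ℝ), y₀) :=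
    contDiff_snd.contMDiff.contMDiffAt
  have hin : ContMDiffAt 𝓘(ℝ, ℝ × E') (𝓘(ℝ, ℝ).prod (𝓡 (2 * n + 1))) ∞
      (fun p : ℝ × E' => (p.1, e p.2)) ((0 : ℝ), y₀) :=
    hfst.prodMk (ContMDiffAt.comp (g := e) ((0 : ℝ), y₀) he hsnd)
  have h1 : ContMDiffAt 𝓘(ℝ, ℝ × E') (𝓡 (2 * n + 1)) ∞
      (fun p : ℝ × E' => Ψ.toFun p.1 (e p.2)) ((0 : ℝ), y₀) :=
    ContMDiffAt.comp (g := fun p : ℝ × M => Ψ.toFun p.1 p.2) ((0 : ℝ), y₀)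
      Ψ.smooth.contMDiffAt hin
  have h2 : ContDiffAt ℝ ∞ (fun p : ℝ × E' => e' (Ψ.toFun p.1 (e p.2))) ((0 : ℝ), y₀) := by
    rw [← contMDiffAt_iff_contDiffAt]
    refine ContMDiffAt.comp (g := e') (f := fun p : ℝ × E' => Ψ.toFun p.1 (e p.2))
      ((0 : ℝ), y₀) ?_ h1
    simp only [zero_apply']
    exact he'
  have h3 : ContDiffAt ℝ ∞ (fun p : ℝ × E' => l (e' (Ψ.toFun p.1 (e p.2)))) ((0 : ℝ), y₀) :=
    l.contDiff.contDiffAt.comp _ h2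
  have hc : DifferentiableAt ℝ (fun s => e' (Ψ.toFun s (e y₀))) 0 :=
    (h2.differentiableAt (by simp)).comp (0 : ℝ)
      (f := fun s : ℝ => (s, y₀)) (by fun_prop)
  have hcurve : (fun s => Ψ.toFun s (e y₀)) =ᶠ[𝓝 (0 : ℝ)]
      e ∘ fun s => e' (Ψ.toFun s (e y₀)) := by
    have hcont : ContinuousAt (fun s => Ψ.toFun s (e y₀)) 0 :=
      (Ψ.smooth_orbit (e y₀)).continuous.continuousAt
    have : ∀ᶠ s in 𝓝 (0 : ℝ), e (e' (Ψ.toFun s (e y₀))) = Ψ.toFun s (e y₀) := by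
      refine hcont.eventually (p := fun q => e (e' q) = q) ?_
      show ∀ᶠ q in 𝓝 (Ψ.toFun 0 (e y₀)), e (e' q) = q
      rwa [Ψ.zero_apply']
    filter_upwards [this] with s hs using hs.symm
  have hc0 : e' (Ψ.toFun 0 (e y₀)) = y₀ := by rw [Ψ.zero_apply', hl]
  have hspeed : Ψ.speed (e y₀) = l (deriv (fun s => e' (Ψ.toFun s (e y₀))) 0) := by
    rw [speed, pullParam_congr α hcurve, pullParam_comp α (G := e)
      (τ := fun s => e' (Ψ.toFun s (e y₀))) (y := 0)
      (by simp only [hc0]; exact he.mdifferentiableAt (by simp)) hc, hc0]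
    rfl
  have hd : 0 < deriv (fun s => l (e' (Ψ.toFun s (e y₀)))) 0 := by
    have h4 := (l.hasFDerivAt.comp_hasDerivAt (0 : ℝ) hc.hasDerivAt).deriv
    have h5 : deriv (fun s => l (e' (Ψ.toFun s (e y₀)))) 0 = _ := h4
    rwa [h5, ← hspeed]
  obtain ⟨ε, hε, m, hm, hy⟩ := exists_mul_le_sub_of_deriv_pos h3 hd
  refine ⟨ε, hε, m, hm, hy.mono fun y hy s hs => ?_⟩
  have := hy s hs
  simp only [zero_apply'] at this
  exact this

/-- A flow of positive speed on a compact manifold has no short periodic orbits. -/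
theorem exists_forall_ne [CompactSpace M] (Ψ : ContactFlow α) (hpos : ∀ q, 0 < Ψ.speed q) :
    ∃ ε > 0, ∀ q, ∀ s ∈ Ioc 0 ε, Ψ.toFun s q ≠ q := by
  have key : ∃ ε > 0, ∀ q ∈ (univ : Set M), ∀ s ∈ Ioc 0 ε, Ψ.toFun s q ≠ q := by
    refine isCompact_univ.induction_on
      (p := fun S => ∃ ε > 0, ∀ q ∈ S, ∀ s ∈ Ioc 0 ε, Ψ.toFun s q ≠ q)
      ⟨1, one_pos, fun q hq => hq.elim⟩ ?_ ?_ ?_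
    · rintro S T hST ⟨ε, hε, h⟩
      exact ⟨ε, hε, fun q hq => h q (hST hq)⟩
    · rintro S T ⟨ε, hε, h⟩ ⟨ε', hε', h'⟩
      refine ⟨min ε ε', lt_min hε hε', ?_⟩
      rintro q (hq | hq) s hs
      · exact h q hq s ⟨hs.1, hs.2.trans (min_le_left _ _)⟩
      · exact h' q hq s ⟨hs.1, hs.2.trans (min_le_right _ _)⟩
    · intro x _
      set κ := extChartAt (𝓡 (2 * n + 1)) x with hκ
      have hx : κ.symm (κ x) = x := extChartAt_to_inv x
      obtain ⟨ε, hε, m, hm, hev⟩ := Ψ.exists_mul_le_sub (e := κ.symm) (e' := κ) (y₀ := κ x)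
        ((contMDiffOn_extChartAt_symm (n := ∞) x).contMDiffAt (extChartAt_target_mem_nhds x))
        (by rw [hx]; exact contMDiffAt_extChartAt) (by rw [hx])
        (by
          rw [hx]
          filter_upwards [extChartAt_source_mem_nhds (I := 𝓡 (2 * n + 1)) x] with q hq
          exact κ.left_inv hq)
        (hpos _)
      have hev' := (continuousAt_extChartAt (I := 𝓡 (2 * n + 1)) x).eventually hev
      rw [nhdsWithin_univ]
      refine ⟨_, hev'.and (extChartAt_source_mem_nhds (I := 𝓡 (2 * n + 1)) x), ε, hε, ?_⟩
      rintro q ⟨hq, hqs⟩ s hs heq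
      have h1 := hq s ⟨hs.1.le, hs.2⟩
      rw [κ.left_inv hqs, heq, sub_self] at h1
      have := mul_pos hm hs.1
      linarith
  obtain ⟨ε, hε, h⟩ := key
  exact ⟨ε, hε, fun q => h q (mem_univ q)⟩

end ContactFlow

end ContactGeometry

/-! ### Positive flows adapted to a Darboux ball -/

namespace ContactGeometry

variable {n : ℕ} {M : Type*} [TopologicalSpace M] [ChartedSpace (Model n) M]
  [IsManifold (𝓡 (2 * n + 1)) ∞ M] {α : ContactForm n M}

namespace DarbouxChart

variable {r : ℝ}

theorem mem_image (D : DarbouxChart α r) {s : Set (StdSpace n)}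
    (hs : s ⊆ Metric.ball (0 : StdSpace n) r) {p : StdSpace n}
    (hp : p ∈ Metric.ball (0 : StdSpace n) r) : D.e p ∈ D.e '' s ↔ p ∈ s := by
  refine ⟨?_, mem_image_of_mem _⟩
  rintro ⟨p', hp', he⟩
  rw [← D.symm_apply hp, ← he, D.symm_apply (hs hp')]
  exact hp'

theorem contMDiffAt_symm (D : DarbouxChart α r) {p : StdSpace n}
    (hp : p ∈ Metric.ball (0 : StdSpace n) r) :
    ContMDiffAt (𝓡 (2 * n + 1)) 𝓘(ℝ, StdSpace n) ∞ D.e.symm (D.e p) :=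
  D.smooth_symm.contMDiffAt (D.e.open_target.mem_nhds (D.mem_target hp))

/-- The image of the closed ball is compact, hence closed, and the chart pulls its interior back
into the interior of the closed ball. This is the regularity required of the region of a positive
flow. -/
theorem interior_closure_image_ball [T2Space M] (D : DarbouxChart α r) {r₂ : ℝ} (h0 : r₂ ≠ 0)
    (hr : r₂ < r) :
    interior (closure (D.e '' Metric.ball 0 r₂)) ⊆ D.e '' Metric.ball 0 r₂ := by
  have h1 : closure (D.e '' Metric.ball 0 r₂) ⊆ D.e '' Metric.closedBall 0 r₂ :=
    closure_minimal (image_mono Metric.ball_subset_closedBall) (D.isCompact_image hr).isClosed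
  intro q hq
  obtain ⟨p, hp, rfl⟩ := interior_mono h1 hq |> interior_subset
  refine mem_image_of_mem _ ?_
  rw [← interior_closedBall _ h0]
  have ho : IsOpen (D.e.source ∩ D.e ⁻¹' interior (D.e '' Metric.closedBall 0 r₂)) :=
    D.e.isOpen_inter_preimage isOpen_interior
  refine mem_interior.2 ⟨_, ?_, ho, ?_, interior_mono h1 hq⟩
  · rintro p' ⟨hp1, hp2⟩
    rw [D.source_eq] at hp1
    exact (D.mem_image (Metric.closedBall_subset_ball hr) hp1).1 (interior_subset hp2)
  · rw [D.source_eq]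
    exact Metric.closedBall_subset_ball hr hp

/-- The rate of change of the last coordinate along the inverse of an isotopy supported in a
Darboux ball is bounded. -/
theorem exists_abs_sub_le (D : DarbouxChart α r) (φ : ContactIsotopy α) {r₁ : ℝ} (hr : r₁ < r)
    (hφ : ∀ t, ∀ q ∉ D.e '' Metric.closedBall 0 r₁, φ.1 t q = q) :
    ∃ L : ℝ, ∀ t t' : unitInterval, ∀ p ∈ Metric.closedBall (0 : StdSpace n) r₁,
      |D.e.symm ((φ.1 t)⁻¹ (D.e p)) (zIdx n) - D.e.symm ((φ.1 t')⁻¹ (D.e p)) (zIdx n)| ≤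
        L * |(t : ℝ) - t'| := by
  set K := D.e '' Metric.closedBall 0 r₁ with hK
  have hinv : ∀ t, ∀ q ∈ K, (φ.1 t)⁻¹ q ∈ K := fun t q hq => by
    by_contra h
    have h1 := hφ t _ h
    rw [Equiv.Perm.eq_inv_iff_eq.1 (rfl : (φ.1 t)⁻¹ q = _)] at h1
    exact h (h1 ▸ hq)
  have hKt : K ⊆ D.e.target := by
    rintro _ ⟨p, hp, rfl⟩
    exact D.mem_target (Metric.closedBall_subset_ball hr hp)
  -- Times are taken in ℝ through `projIcc` so that the function lives on a compact convex subset of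
  -- a vector space, where smoothness yields a Lipschitz constant.
  set S : Set (ℝ × StdSpace n) := Icc 0 1 ×ˢ Metric.closedBall 0 r₁ with hS
  set f : ℝ × StdSpace n → ℝ := fun x =>
    D.e.symm ((φ.1 (projIcc 0 1 zero_le_one x.1))⁻¹ (D.e x.2)) (zIdx n) with hf
  have hfst : ContMDiffOn 𝓘(ℝ, ℝ × StdSpace n) (𝓡∂ 1) ∞
      (fun x : ℝ × StdSpace n => projIcc (0 : ℝ) 1 zero_le_one x.1) S :=
    (contMDiffOn_projIcc (x := (0 : ℝ)) (y := 1)).comp contDiff_fst.contMDiff.contMDiffOn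
      fun x hx => hx.1
  have hsnd : ContMDiffOn 𝓘(ℝ, ℝ × StdSpace n) (𝓡 (2 * n + 1)) ∞
      (fun x : ℝ × StdSpace n => D.e x.2) S :=
    D.smooth.comp contDiff_snd.contMDiff.contMDiffOn
      fun x hx => Metric.closedBall_subset_ball hr hx.2
  have hcomp : ContMDiffOn 𝓘(ℝ, ℝ × StdSpace n) (𝓡 (2 * n + 1)) ∞
      (fun x : ℝ × StdSpace n => (φ.1 (projIcc 0 1 zero_le_one x.1))⁻¹ (D.e x.2)) S :=
    φ.2.1.2.1.comp_contMDiffOn (hfst.prodMk hsnd)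
  have hmaps : MapsTo (fun x : ℝ × StdSpace n =>
      (φ.1 (projIcc 0 1 zero_le_one x.1))⁻¹ (D.e x.2)) S D.e.target :=
    fun x hx => hKt (hinv _ _ (mem_image_of_mem _ hx.2))
  have hfs : ContDiffOn ℝ ∞ f S := by
    rw [← contMDiffOn_iff_contDiffOn]
    exact (coord (zIdx n)).contMDiff.comp_contMDiffOn (D.smooth_symm.comp hcomp hmaps)
  have hconv : Convex ℝ S := (convex_Icc 0 1).prod (convex_closedBall 0 r₁)
  have hloc : LocallyLipschitzOn S f := fun x hx =>
    ((hfs x hx).of_le (by simp)).exists_lipschitzOnWith hconv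
  obtain ⟨L, hL⟩ := hloc.exists_lipschitzOnWith_of_compact
    (isCompact_Icc.prod (isCompact_closedBall 0 r₁))
  refine ⟨L, fun t t' p hp => ?_⟩
  have := hL.dist_le_mul ((t : ℝ), p) ⟨t.2, hp⟩ ((t' : ℝ), p) ⟨t'.2, hp⟩
  rw [Real.dist_eq, Prod.dist_eq, dist_self, max_eq_left dist_nonneg, Real.dist_eq] at this
  simpa [hf] using this

end DarbouxChart

/-- A contact flow that is positively transverse to the contact structure exactly on a given open
region, which contains the centre of a Darboux ball, and which has no short periodic orbits there;
the region is the whole manifold if the latter is compact. -/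
structure PositiveFlow {r : ℝ} (D : DarbouxChart α r) where
  /-- the underlying contact flow -/
  flow : ContactFlow α
  /-- the region where the flow is transverse to the contact structure -/
  region : Set M
  eq_self : ∀ s, ∀ q ∉ region, flow.toFun s q = q
  region_eq : CompactSpace M → region = univ
  interior_closure : interior (closure region) ⊆ region
  isOpen_region : IsOpen region
  center_mem : D.e 0 ∈ region
  speed_pos : ∀ q ∈ region, 0 < flow.speed q
  exists_forall_ne : ∃ ε > 0, ∀ q ∈ region, ∀ s ∈ Ioc 0 ε, flow.toFun s q ≠ q

/-- On a compact manifold the Reeb flow has speed 1 everywhere, and compactness excludes short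
periods. Otherwise the flow of `ballHam` on half the Darboux ball serves: its speed is a positive
multiple of the Hamiltonian, and since z increases along orbits there are no periods at all, so any
time bound works. -/
theorem exists_positiveFlow [T2Space M] {r : ℝ} (hr : 0 < r) (D : DarbouxChart α r) :
    Nonempty (PositiveFlow D) := by
  by_cases hM : CompactSpace M
  · obtain ⟨Ψ, hΨ⟩ := exists_reebFlow α
    have hsp : ∀ q, Ψ.speed q = 1 := by
      intro q
      have h1 := (hΨ q 0).mfderiv
      have h2 : Ψ.speed q = α.form (Ψ.toFun 0 q) (reeb α (Ψ.toFun 0 q)) := by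
        refine α.form_congr rfl ((DFunLike.congr_fun h1 (1 : ℝ)).trans ?_)
        exact one_smul ℝ (reeb α (Ψ.toFun 0 q))
      rw [h2, form_reeb]
    obtain ⟨ε, hε, h⟩ := Ψ.exists_forall_ne fun q => by rw [hsp]; exact one_pos
    exact ⟨⟨Ψ, univ, fun s q hq => (hq trivial).elim, fun _ => rfl, subset_univ _, isOpen_univ,
      trivial, fun q _ => by rw [hsp]; exact one_pos, ε, hε, fun q _ => h q⟩⟩
  · have hr2 : r / 2 < r := by linarith
    have h0 : r / 2 ≠ 0 := by positivity
    obtain ⟨F⟩ := exists_stdFlow (contDiff_ballHam (n := n) (r / 2)) (r := r / 2) fun p hp =>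
      ballHam_eq_zero (by positivity) (by simpa using (not_le.1 (by simpa using hp) : r / 2 < ‖p‖).le)
    obtain ⟨Ψ, hΨ, hfix⟩ := D.exists_extension hr2 F
    have hsub : Metric.ball (0 : StdSpace n) (r / 2) ⊆ Metric.ball 0 r :=
      Metric.ball_subset_ball hr2.le
    refine ⟨⟨Ψ, D.e '' Metric.ball 0 (r / 2), fun s q hq => ?_, fun h => (hM h).elim,
      D.interior_closure_image_ball h0 hr2,
      D.e.isOpen_image_of_subset_source Metric.isOpen_ball (by rwa [D.source_eq]),
      mem_image_of_mem _ (Metric.mem_ball_self (by positivity)), ?_, 1, one_pos, ?_⟩⟩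
    · by_cases hq' : q ∈ D.e '' Metric.closedBall 0 (r / 2)
      · obtain ⟨p, hp, rfl⟩ := hq'
        rw [hΨ s p (Metric.closedBall_subset_ball hr2 hp), F.eq_self_of_notMem_ball h0 s]
        exact fun h => hq (mem_image_of_mem _ h)
      · exact hfix s q hq'
    · rintro _ ⟨p, hp, rfl⟩
      have h1 : (fun s => Ψ.toFun s (D.e p)) = D.e ∘ fun s => F.toFun s p :=
        funext fun s => hΨ s p (hsub hp)
      have h2 : Ψ.speed (D.e p) = D.factor p * ballHam n (r / 2) p := by
        rw [ContactFlow.speed, h1, pullParam_comp α (G := D.e) (τ := fun s => F.toFun s p) (y := 0)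
          (by
            simp only [F.map_zero]
            exact mdifferentiableAt_of_contMDiffOn_ball D.smooth (hsub hp))
          (F.hasDerivAt p 0).differentiableAt, ContinuousLinearMap.comp_apply]
        simp only [F.map_zero]
        rw [D.pullParam_eq p (hsub hp), fderiv_apply_one_eq_deriv, (F.hasDerivAt p 0).deriv,
          F.map_zero, stdForm_hamField]
      rw [h2]
      exact mul_pos (D.factor_pos p (hsub hp)) (ballHam_pos (mem_ball_zero_iff.1 hp))
    · rintro _ ⟨p, hp, rfl⟩ s hs h
      rw [hΨ s p (hsub hp)] at h
      have h3 : F.toFun s p = p := by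
        rw [← D.symm_apply (F.mem_ball hr2 s (hsub hp)), h, D.symm_apply (hsub hp)]
      have hmono : StrictMono fun s => F.toFun s p (zIdx n) := by
        refine strictMono_of_hasDerivAt_pos (f' := fun s => hamField (ballHam n (r / 2))
          (F.toFun s p) (zIdx n)) (fun s => ?_) fun s => ?_
        · exact (coord (zIdx n)).hasFDerivAt.comp_hasDerivAt s (F.hasDerivAt p s)
        · exact hamField_ballHam_z_pos (mem_ball_zero_iff.1 (F.apply_mem_ball h0 s hp))
      have h4 := hmono hs.1
      simp only [h3, F.map_zero, lt_self_iff_false] at h4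

/-- The speed of a contact flow depends continuously on the point. -/
theorem ContactFlow.continuousAt_speed {E : Type*} [NormedAddCommGroup E] [NormedSpace ℝ E]
    (Ψ : ContactFlow α) {e : E → M} {O : Set E} (hO : IsOpen O)
    (he : ContMDiffOn 𝓘(ℝ, E) (𝓡 (2 * n + 1)) ∞ e O) {p₀ : E} (hp₀ : p₀ ∈ O) :
    ContinuousAt (fun p => Ψ.speed (e p)) p₀ := by
  let G : ℝ × E → M := fun x => Ψ.toFun x.1 (e x.2)
  have hO' : IsOpen ((univ : Set ℝ) ×ˢ O) := isOpen_univ.prod hO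
  have hfst : ContMDiffOn 𝓘(ℝ, ℝ × E) 𝓘(ℝ, ℝ) ∞ (Prod.fst : ℝ × E → ℝ) (univ ×ˢ O) :=
    contDiff_fst.contMDiff.contMDiffOn
  have hsnd : ContMDiffOn 𝓘(ℝ, ℝ × E) (𝓡 (2 * n + 1)) ∞ (fun x : ℝ × E => e x.2) (univ ×ˢ O) :=
    he.comp contDiff_snd.contMDiff.contMDiffOn fun x hx => hx.2
  have hG : ContMDiffOn 𝓘(ℝ, ℝ × E) (𝓡 (2 * n + 1)) ∞ G (univ ×ˢ O) :=
    Ψ.smooth.comp_contMDiffOn (hfst.prodMk hsnd)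
  have h1 := (contDiffOn_pullParam_apply α hO' hG ((1 : ℝ), (0 : E))).continuousOn
  have h2 : ContinuousAt (fun p : E => pullParam α G ((0 : ℝ), p) ((1 : ℝ), (0 : E))) p₀ :=
    ContinuousAt.comp (g := fun y => pullParam α G y ((1 : ℝ), (0 : E)))
      (f := fun p : E => ((0 : ℝ), p)) (h1.continuousAt (hO'.mem_nhds ⟨trivial, hp₀⟩))
      (by fun_prop)
  refine h2.congr ?_
  filter_upwards [hO.mem_nhds hp₀] with p hp
  have h3 : MDifferentiableAt 𝓘(ℝ, ℝ × E) (𝓡 (2 * n + 1)) G ((0 : ℝ), p) :=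
    (hG.contMDiffAt (hO'.mem_nhds ⟨trivial, hp⟩)).mdifferentiableAt (by simp)
  have hτ : HasDerivAt (fun s : ℝ => (s, p)) ((1 : ℝ), (0 : E)) 0 :=
    (hasDerivAt_id (0 : ℝ)).prodMk (hasDerivAt_const 0 p)
  have h4 := pullParam_comp α (G := G) (τ := fun s : ℝ => (s, p)) (y := 0) h3 hτ.differentiableAt
  have h6 : pullParam α (G ∘ fun s : ℝ => (s, p)) 0 1 =
      pullParam α G ((0 : ℝ), p) (fderiv ℝ (fun s : ℝ => (s, p)) 0 1) := DFunLike.congr_fun h4 1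
  rw [fderiv_apply_one_eq_deriv, hτ.deriv] at h6
  exact h6.symm

namespace PositiveFlow

variable {r : ℝ} {D : DarbouxChart α r}

/-- Near the centre of the Darboux ball the flow has speed bounded from below, and increases the
last coordinate at a definite rate. -/
theorem exists_rate (hr : 0 < r) (X : PositiveFlow D) : ∃ ε > 0, ∃ m > 0, ∃ ρ > 0,
    (∀ q ∈ X.region, ∀ s ∈ Ioc 0 ε, X.flow.toFun s q ≠ q) ∧
    ∀ p ∈ Metric.ball (0 : StdSpace n) ρ, D.e p ∈ X.region ∧ m ≤ X.flow.speed (D.e p) ∧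
      ∀ p' ∈ Metric.ball (0 : StdSpace n) ρ, ∀ s ∈ Icc 0 ε, X.flow.toFun s (D.e p) = D.e p' →
        m * s ≤ p' (zIdx n) - p (zIdx n) := by
  have h00 : (0 : StdSpace n) ∈ Metric.ball (0 : StdSpace n) r := Metric.mem_ball_self hr
  have hnb : Metric.ball (0 : StdSpace n) r ∈ 𝓝 (0 : StdSpace n) := Metric.isOpen_ball.mem_nhds h00
  obtain ⟨ε₀, hε₀, hne⟩ := X.exists_forall_ne
  have hsp0 := X.speed_pos _ X.center_mem
  obtain ⟨ε₁, hε₁, m₁, hm₁, hev⟩ := X.flow.exists_mul_le_sub (e := D.e) (e' := D.e.symm) (y₀ := 0)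
    (D.smooth.contMDiffAt hnb) (D.contMDiffAt_symm h00) (D.symm_apply h00)
    (by filter_upwards [D.e.open_target.mem_nhds (D.mem_target h00)] with q hq
        exact D.e.right_inv hq) hsp0
  -- At the origin the standard form is dz, so the frozen functional is a multiple of z; dividing by
  -- the factor converts its growth into growth of z.
  have hl : ∀ v, pullParam α D.e 0 v = D.factor 0 * v (zIdx n) := by
    intro v
    rw [D.pullParam_eq 0 h00, stdForm]
    simp
  set h := D.factor 0
  have hh : 0 < h := D.factor_pos 0 h00
  have hreg : ∀ᶠ p in 𝓝 (0 : StdSpace n), D.e p ∈ X.region :=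
    (D.smooth.continuousOn.continuousAt hnb).eventually (X.isOpen_region.mem_nhds X.center_mem)
  have hcont : ContinuousAt (fun p => X.flow.speed (D.e p)) (0 : StdSpace n) :=
    X.flow.continuousAt_speed Metric.isOpen_ball D.smooth h00
  set m₂ := X.flow.speed (D.e 0) / 2 with hm₂
  have hm₂pos : 0 < m₂ := by positivity
  have hspeed : ∀ᶠ p in 𝓝 (0 : StdSpace n), m₂ < X.flow.speed (D.e p) :=
    hcont.eventually (lt_mem_nhds (by rw [hm₂]; linarith))
  obtain ⟨ρ, hρ, hball⟩ := Metric.eventually_nhds_iff_ball.1 (hev.and (hreg.and hspeed))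
  refine ⟨min ε₀ ε₁, lt_min hε₀ hε₁, min (m₁ / h) m₂, lt_min (by positivity) hm₂pos, min ρ r,
    lt_min hρ hr, fun q hq s hs => hne q hq s ⟨hs.1, hs.2.trans (min_le_left _ _)⟩,
    fun p hp => ?_⟩
  obtain ⟨h1, h2, h3⟩ := hball p (Metric.ball_subset_ball (min_le_left _ _) hp)
  refine ⟨h2, (min_le_right _ _).trans h3.le, fun p' hp' s hs heq => ?_⟩
  have h4 := h1 s ⟨hs.1, hs.2.trans (min_le_right _ _)⟩
  rw [heq, D.symm_apply (Metric.ball_subset_ball (min_le_right _ _) hp'),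
    D.symm_apply (Metric.ball_subset_ball (min_le_right _ _) hp), hl, hl, ← mul_sub] at h4
  calc min (m₁ / h) m₂ * s ≤ m₁ / h * s := mul_le_mul_of_nonneg_right (min_le_left _ _) hs.1
    _ = m₁ * s / h := by ring
    _ ≤ p' (zIdx n) - p (zIdx n) := by rw [div_le_iff₀ hh]; linarith

end PositiveFlow

end ContactGeometry

/-! ### Factorization of isotopies supported in a Darboux ball -/

namespace ContactGeometry

variable {n : ℕ} {M : Type*} [TopologicalSpace M] [ChartedSpace (Model n) M]
  [IsManifold (𝓡 (2 * n + 1)) ∞ M] {α : ContactForm n M}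

/-- The conformal factor of a contactomorphism that is a contact dilation in Darboux coordinates. -/
theorem DarbouxChart.exp_mul_factor {r : ℝ} (D : DarbouxChart α r) {δ : M → M}
    (hδ : ContMDiff (𝓡 (2 * n + 1)) (𝓡 (2 * n + 1)) ∞ δ) {c : ℝ} {p : StdSpace n}
    (hp : p ∈ Metric.ball (0 : StdSpace n) r) (hcp : dilation n c p ∈ Metric.ball (0 : StdSpace n) r)
    (hdil : ∀ᶠ z in 𝓝 p, δ (D.e z) = D.e (dilation n c z)) {b : ℝ} (hb : ScalesAt α δ (D.e p) b) :
    Real.exp b * D.factor p = c ^ 2 * D.factor (dilation n c p) := by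
  set w : StdSpace n := EuclideanSpace.single (zIdx n) (1 : ℝ) with hw
  have hstdw : stdForm n p w = 1 := by simp [stdForm, hw]
  have h1 := pullParam_congr α (G := δ ∘ D.e) (G' := D.e ∘ dilation n c) hdil
  rw [pullParam_comp α (G := D.e) (mdifferentiableAt_of_contMDiffOn_ball D.smooth hcp)
    (dilation n c).differentiableAt, (dilation n c).fderiv] at h1
  have h2 := DFunLike.congr_fun h1 w
  rw [ContinuousLinearMap.comp_apply, D.pullParam_eq _ hcp, stdForm_dilation, hstdw] at h2
  have h3 := mfderiv_comp p (hδ.mdifferentiableAt (x := D.e p) (by simp))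
    (mdifferentiableAt_of_contMDiffOn_ball D.smooth hp)
  have h4 : pullParam α (δ ∘ D.e) p w = Real.exp b * pullParam α D.e p w :=
    (α.form_congr rfl (DFunLike.congr_fun h3 w)).trans (hb _)
  rw [D.pullParam_eq p hp, hstdw, h2] at h4
  linarith

namespace ContactFlow

/-- The contactomorphisms of a contact flow are homeomorphisms. -/
def homeomorph (D : ContactFlow α) (σ : ℝ) : M ≃ₜ M where
  toEquiv := D.toFun σ
  continuous_toFun := (D.smooth_slice σ).continuous
  continuous_invFun := by
    have h := (D.smooth_slice (-σ)).continuous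
    rw [← D.inv_toFun] at h
    exact h

end ContactFlow

namespace PositiveFlow

variable {r : ℝ} {D : DarbouxChart α r}

theorem apply_mem_region (X : PositiveFlow D) (s : ℝ) {q : M} (hq : q ∈ X.region) :
    X.flow.toFun s q ∈ X.region := by
  by_contra h
  have h1 := X.eq_self (-s) _ h
  rw [← X.flow.add_apply', neg_add_cancel, X.flow.zero_apply'] at h1
  exact h (h1 ▸ hq)

end PositiveFlow

section Fragment

variable [T2Space M]

/-- The isotopy `t ↦ φ_t Ψ_t`, where `Ψ` is a positive isotopy that has been sped up sufficiently
on the support of `φ`, is positive and embedded. -/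
theorem exists_mul_mem_positiveEmbedded (φ : ContactIsotopy α) {B : Set M} (hB : IsDarbouxBall α B)
    (hφ : isotopySupport φ ⊆ B) : ∃ Ψ : ContactIsotopy α,
      homotopyClass α (φ * Ψ) ∈ positiveEmbedded α ∧
        homotopyClass α Ψ⁻¹ ∈ negativeEmbedded α := by
  obtain ⟨r, hr, D, rfl⟩ := hB.exists_chart
  -- the support of the isotopy in Darboux coordinates
  obtain ⟨K', hK', hfixK'⟩ := φ.2.1.2.2.2
  have hsc : IsCompact (isotopySupport φ) := by
    refine hK'.of_isClosed_subset isClosed_closure (closure_minimal ?_ hK'.isClosed)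
    rintro q ⟨t, ht⟩
    by_contra hq
    exact ht (hfixK' t q hq)
  have hsE : IsCompact (D.e.symm '' isotopySupport φ) :=
    hsc.image_of_continuousOn (D.smooth_symm.continuousOn.mono hφ)
  obtain ⟨r₁, ⟨hr₁, hr₁r⟩, hr₁s⟩ := exists_pos_lt_subset_ball hr hsE.isClosed
    (by rintro _ ⟨q, hq, rfl⟩; exact D.symm_mem (hφ hq))
  set K := D.e '' Metric.closedBall 0 r₁ with hKdef
  have hfix : ∀ t, ∀ q ∉ K, φ.1 t q = q := by
    intro t q hq
    by_contra h
    have hqs : q ∈ isotopySupport φ := subset_closure ⟨t, h⟩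
    refine hq ⟨D.e.symm q, Metric.ball_subset_closedBall (hr₁s (mem_image_of_mem _ hqs)), ?_⟩
    exact D.e.right_inv (hφ hqs)
  have hK : IsCompact K := D.isCompact_image hr₁r
  have hsub : Metric.closedBall (0 : StdSpace n) r₁ ⊆ Metric.ball 0 r :=
    Metric.closedBall_subset_ball hr₁r
  -- bounds for the isotopy
  have hcomp : IsCompact ((univ : Set unitInterval) ×ˢ K) := isCompact_univ.prod hK
  obtain ⟨A, hA⟩ := hcomp.exists_bound_of_continuousOn
    (ContactIsotopy.continuous_form_velocity φ).continuousOn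
  obtain ⟨g, hg⟩ := hcomp.exists_bound_of_continuousOn
    (ContactIsotopy.contMDiff_conformalFactor φ).continuous.continuousOn
  obtain ⟨b, hb⟩ := (isCompact_closedBall (0 : StdSpace n) r₁).exists_bound_of_continuousOn
    ((D.continuousOn_factor.mono hsub).log fun p hp => (D.factor_pos p (hsub hp)).ne')
  obtain ⟨L, hL⟩ := D.exists_abs_sub_le φ hr₁r hfix
  -- the positive flow and the contact dilations
  obtain ⟨X⟩ := exists_positiveFlow hr D
  obtain ⟨ε, hε, m, hm, ρ, hρ, hne, hrate⟩ := X.exists_rate hr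
  -- The dilation formula has to hold on a neighbourhood of the r₁-ball (radius r₃), so that
  -- derivatives can be read off, while the flow that generates it must be supported in a ball
  -- (radius r₂) strictly inside the Darboux ball to extend to the manifold.
  obtain ⟨r₃, hr13, hr₃⟩ := exists_between hr₁r
  obtain ⟨r₂, hr32, hr₂⟩ := exists_between hr₃
  obtain ⟨H, F, hF⟩ := exists_dilationFlow (n := n) (hr₁.trans hr13) hr32
  obtain ⟨T, hT, -⟩ := D.exists_extension hr₂ F
  have hlim : Filter.Tendsto (fun σ : ℝ => Real.exp (-σ)) Filter.atTop (𝓝 0) :=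
    Real.tendsto_exp_neg_atTop_nhds_zero
  have hlim1 : Filter.Tendsto (fun σ : ℝ => Real.exp (-σ) * r₁) Filter.atTop (𝓝 0) := by
    simpa using hlim.mul_const r₁
  have hlim2 : ∀ C : ℝ, Filter.Tendsto (fun σ : ℝ => Real.exp (-σ) ^ 2 * C) Filter.atTop (𝓝 0) :=
    fun C => by simpa using (hlim.pow 2).mul_const C
  -- The three smallness conditions on c = e^(−σ): the dilated support lies where the flow has
  -- definite rates; the growth of z beats the Lipschitz constant of φ⁻¹, which gives injective
  -- orbits; and the speed of Ψ, damped by e^g, beats the speed of φ, which gives positivity.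
  obtain ⟨σ, hσ0, hσ1, hσ2, hσ3⟩ := ((Filter.eventually_ge_atTop 0).and
    ((hlim1.eventually (gt_mem_nhds hρ)).and
      (((hlim2 L).eventually (gt_mem_nhds (show 0 < m * ε by positivity))).and
        ((hlim2 (Real.exp (2 * b) * A)).eventually
          (gt_mem_nhds (show 0 < Real.exp (-g) * (ε * m) by positivity)))))).exists
  set c := Real.exp (-σ) with hc
  have hc0 : 0 < c := Real.exp_pos _
  have hc1 : c ≤ 1 := Real.exp_le_one_iff.2 (by linarith)
  have hdil : ∀ p : StdSpace n, ‖p‖ ≤ r₃ → T.toFun σ (D.e p) = D.e (dilation n c p) := by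
    intro p hp
    rw [hT σ p (mem_ball_zero_iff.2 (hp.trans_lt hr₃)), hF σ hσ0 p hp]
  have hnorm : ∀ p ∈ Metric.closedBall (0 : StdSpace n) r₁,
      dilation n c p ∈ Metric.ball (0 : StdSpace n) ρ := by
    intro p hp
    rw [mem_closedBall_zero_iff] at hp
    rw [mem_ball_zero_iff]
    exact ((norm_dilation_le hc0.le hc1 p).trans (mul_le_mul_of_nonneg_left hp hc0.le)).trans_lt hσ1
  have hnorm' : ∀ p ∈ Metric.closedBall (0 : StdSpace n) r₁,
      dilation n c p ∈ Metric.closedBall (0 : StdSpace n) r₁ := by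
    intro p hp
    rw [mem_closedBall_zero_iff] at hp ⊢
    refine (norm_dilation_le hc0.le hc1 p).trans ?_
    nlinarith [norm_nonneg p]
  have hdilK : ∀ p ∈ Metric.closedBall (0 : StdSpace n) r₁,
      T.toFun σ (D.e p) = D.e (dilation n c p) := fun p hp =>
    hdil p ((mem_closedBall_zero_iff.1 hp).trans hr13.le)
  set Ψ := ContactFlow.conj X.flow T σ ε with hΨ
  set W := T.homeomorph σ ⁻¹' X.region with hW
  have happly : ∀ t q, T.toFun σ (Ψ.1 t q) = X.flow.toFun (ε * t) (T.toFun σ q) :=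
    ContactFlow.conj_apply X.flow T σ ε
  have hmemW : ∀ q, q ∈ W ↔ T.toFun σ q ∈ X.region := fun q => Iff.rfl
  have hstep : ∀ (t t' : unitInterval) (q : M), X.flow.toFun (ε * (t' - t)) (T.toFun σ (Ψ.1 t q)) =
      T.toFun σ (Ψ.1 t' q) := by
    intro t t' q
    rw [happly, happly, ← X.flow.add_apply']
    congr 2
    ring
  have hWfix : ∀ t, ∀ q ∉ W, Ψ.1 t q = q := fun t q hq => by
    refine (T.toFun σ).injective ?_
    rw [happly]
    exact X.eq_self _ _ hq
  have hWc : CompactSpace M → W = univ := fun h => by rw [hW, X.region_eq h, preimage_univ]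
  have hWi : interior (closure W) ⊆ W := by
    rw [hW, ← Homeomorph.preimage_closure, ← Homeomorph.preimage_interior]
    exact preimage_mono X.interior_closure
  have hpos : ∀ t, ∀ q ∈ W, 0 < ContactIsotopy.transverseSpeed Ψ t q := fun t q hq => by
    obtain ⟨d, hd⟩ := T.scales σ (Ψ.1 t q)
    have h1 := ContactFlow.transverseSpeed_conj X.flow T σ ε t q hd
    have h2 : 0 < X.flow.speed (T.toFun σ (Ψ.1 t q)) := by
      rw [happly]
      exact X.speed_pos _ (X.apply_mem_region _ hq)
    have h3 := mul_pos hε h2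
    rw [← h1] at h3
    exact pos_of_mul_pos_right h3 (Real.exp_pos d).le
  -- A coincidence would close up an orbit of the original flow after time ε(t' − t), which lies in
  -- (0, ε], where closed orbits are excluded.
  have hlt : ∀ t t' : unitInterval, t < t' → ∀ q ∈ W, Ψ.1 t q ≠ Ψ.1 t' q := by
    intro t t' htt q hq h
    have htt' : (t : ℝ) < t' := htt
    have h1 := hstep t t' q
    rw [← h] at h1
    refine hne _ ?_ _ ⟨mul_pos hε (sub_pos.2 htt'), ?_⟩ h1
    · rw [happly]; exact X.apply_mem_region _ hq
    · have := t.2.1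
      have := t'.2.2
      nlinarith
  have hinj : ∀ q ∈ W, Function.Injective fun t => Ψ.1 t q := by
    intro q hq t t' h
    rcases lt_trichotomy t t' with h1 | h1 | h1
    · exact (hlt t t' h1 q hq h).elim
    · exact h1
    · exact (hlt t' t h1 q hq h.symm).elim
  have hKW : K ⊆ W := by
    rintro _ ⟨p, hp, rfl⟩
    rw [hmemW, hdilK p hp]
    exact (hrate _ (hnorm p hp)).1
  refine ⟨Ψ, ContactIsotopy.mul_mem_positiveEmbedded φ Ψ hfix hKW hWfix hWc hWi hpos hinj ?_ ?_,
    ContactIsotopy.inv_mem_negativeEmbedded Ψ hWfix hWc hWi hpos hinj⟩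
  · intro t q hq
    obtain ⟨p, hp, hpq⟩ := hq
    obtain ⟨d, hd⟩ := T.scales σ (Ψ.1 t q)
    have h1 := ContactFlow.transverseSpeed_conj X.flow T σ ε t q hd
    rw [← hΨ, ← hpq, hdilK p hp] at h1
    rw [← hpq] at hd
    have hev : ∀ᶠ z in 𝓝 p, T.toFun σ (D.e z) = D.e (dilation n c z) := by
      have : ∀ᶠ z in 𝓝 p, z ∈ Metric.ball (0 : StdSpace n) r₃ := Metric.isOpen_ball.mem_nhds
        (Metric.closedBall_subset_ball hr13 hp)
      filter_upwards [this] with z hz using hdil z (mem_ball_zero_iff.1 hz).le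
    have h2 := D.exp_mul_factor (T.smooth_slice σ) (hsub hp) (hsub (hnorm' p hp)) hev hd
    have hlog1 := abs_le.1 (hb p hp)
    have hlog2 := abs_le.1 (hb _ (hnorm' p hp))
    have hf1 : Real.exp (-b) ≤ D.factor p := by
      rw [← Real.exp_log (D.factor_pos p (hsub hp))]
      exact Real.exp_le_exp.2 hlog1.1
    have hf2 : D.factor (dilation n c p) ≤ Real.exp b := by
      rw [← Real.exp_log (D.factor_pos _ (hsub (hnorm' p hp)))]
      exact Real.exp_le_exp.2 hlog2.2
    -- The dilation contributes c², and the two values of `factor` that enter lie between e^(−b) and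
    -- e^b.
    have hd1 : Real.exp d ≤ c ^ 2 * Real.exp (2 * b) := by
      have h3 : Real.exp d * Real.exp (-b) ≤ c ^ 2 * Real.exp b :=
        (mul_le_mul_of_nonneg_left hf1 (Real.exp_pos d).le).trans
          (h2.le.trans (mul_le_mul_of_nonneg_left hf2 (sq_nonneg c)))
      have h4 := mul_le_mul_of_nonneg_right h3 (Real.exp_pos b).le
      rw [mul_assoc, ← Real.exp_add, neg_add_cancel, Real.exp_zero, mul_one, mul_assoc,
        ← Real.exp_add, ← two_mul] at h4
      exact h4
    set S := ContactIsotopy.transverseSpeed Ψ t q with hS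
    have hSpos : 0 < S := hpos t q (by
      by_contra hqW
      rw [hWfix t q hqW] at hpq
      exact hqW (hpq ▸ hKW (mem_image_of_mem _ hp)))
    have h5 : ε * m ≤ c ^ 2 * Real.exp (2 * b) * S :=
      (mul_le_mul_of_nonneg_left (hrate _ (hnorm p hp)).2.1 hε.le).trans
        (h1.symm.le.trans (mul_le_mul_of_nonneg_right hd1 hSpos.le))
    rw [ContactIsotopy.transverseSpeed_mul, ← hS, ← hpq]
    have hmem : ((t, D.e p) : unitInterval × M) ∈ (univ : Set unitInterval) ×ˢ K :=
      ⟨trivial, mem_image_of_mem _ hp⟩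
    have hA' := (abs_le.1 (hA _ hmem)).1
    have hg' := Real.exp_le_exp.2 (abs_le.1 (hg _ hmem)).1
    have h6 : -A ≤ ContactIsotopy.transverseSpeed φ t (D.e p) := hA'
    have h7 := mul_le_mul_of_nonneg_right hg' hSpos.le
    -- The lower bound for the speed is multiplied by c² e^(2b) to avoid dividing by it; the third
    -- smallness condition on c then gives the sign.
    have h8 : 0 < c ^ 2 * Real.exp (2 * b) * (Real.exp (-g) * S - A) := by
      have h9 := mul_le_mul_of_nonneg_left h5 (Real.exp_pos (-g)).le
      nlinarith
    have h10 := pos_of_mul_pos_right h8 (by positivity)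
    simp only at h7
    linarith
  · rintro t t' q htt ⟨p, hp, hpq⟩ ⟨p', hp', hpq'⟩ heq
    have htt' : 0 < (t' : ℝ) - t := sub_pos.2 htt
    -- The common value Q of the two products lies in `K`, so the bound for the z-coordinate of
    -- φ_t⁻¹(Q) as a function of t applies to it.
    have hQ : φ.1 t (Ψ.1 t q) ∈ K := by
      by_contra h
      have h1 := (φ.1 t).injective (hfix t _ h)
      rw [h1, ← hpq] at h
      exact h (mem_image_of_mem _ hp)
    obtain ⟨w, hw, hwQ⟩ := hQ
    have h2 := hL t t' w hw
    have e1 : (φ.1 t)⁻¹ (D.e w) = D.e p := by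
      rw [Equiv.Perm.inv_eq_iff_eq, hwQ, hpq]
    have e2 : (φ.1 t')⁻¹ (D.e w) = D.e p' := by
      rw [Equiv.Perm.inv_eq_iff_eq, hwQ, heq, hpq']
    rw [e1, e2, D.symm_apply (hsub hp), D.symm_apply (hsub hp'), abs_sub_comm,
      abs_sub_comm (t : ℝ), abs_of_pos htt'] at h2
    have h3 := hstep t t' q
    rw [← hpq, ← hpq', hdilK p hp, hdilK p' hp'] at h3
    have h4 := (hrate _ (hnorm p hp)).2.2 _ (hnorm p' hp') _
      ⟨by positivity, by nlinarith [t.2.1, t'.2.2]⟩ h3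
    rw [dilation_apply_z, dilation_apply_z, ← mul_sub] at h4
    have h5 := le_abs_self (p' (zIdx n) - p (zIdx n))
    -- The flow gives mε(t' − t) ≤ c²(z' − z), as dilation multiplies z by c². Together with this
    -- upper bound it contradicts c²L < mε.
    have h6 : c ^ 2 * (p' (zIdx n) - p (zIdx n)) ≤ c ^ 2 * (L * (t' - t)) :=
      mul_le_mul_of_nonneg_left (h5.trans h2) (sq_nonneg c)
    nlinarith

/-- The factorization φ = (φΨ)Ψ⁻¹ into a positive and a negative embedded isotopy; it is the source
of the factor two. -/
theorem darbouxSupported_subset (α : ContactForm n M) :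
    darbouxSupported α ⊆ (positiveEmbedded α ∪ negativeEmbedded α) ^ 2 := by
  rintro _ ⟨φ, rfl, B, hB, hφ⟩
  obtain ⟨Ψ, h1, h2⟩ := exists_mul_mem_positiveEmbedded φ hB hφ
  have h : homotopyClass α φ = homotopyClass α (φ * Ψ) * homotopyClass α Ψ⁻¹ := by
    have h3 : homotopyClass α (φ * Ψ) * homotopyClass α Ψ⁻¹ = homotopyClass α (φ * Ψ * Ψ⁻¹) := rfl
    rw [h3, mul_inv_cancel_right]
  rw [h, pow_two]
  exact Set.mul_mem_mul (Or.inl h1) (Or.inr h2)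

end Fragment

end ContactGeometry

end

theorem proposition5p2 (n : ℕ) {M : Type*} [TopologicalSpace M] [T2Space M]
    [SecondCountableTopology M] [ChartedSpace (ContactGeometry.Model n) M]
    [IsManifold (𝓡 (2 * n + 1)) ∞ M] (α : ContactGeometry.ContactForm n M)
    (a : ContactGeometry.UniversalCover α) :
    ContactGeometry.zigzagNorm α a ≤ 2 * ContactGeometry.fragmentationNorm α a :=
  ContactGeometry.wordNorm_le_two_mul (ContactGeometry.darbouxSupported_subset α) a
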